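/- **Proposition.** Let $d\ge 0$ be a fixed integer. There is an algorithm (a program for a unit-cost real random access machine, depending only on $d$) which, given $n$ and the coefficients of a homogeneous polynomial $f\in\mathbb{R}_{\ge 0}[z_1,\dots,z_n]$ of degree $d$ with nonnegative coefficients, decides in time $O(n^{d+1})$ whether $f$ is completely log concave. Here $f$ is *completely log concave* (Lorentzian) if for every $k\ge 0$ and every nonnegative matrix $V\in\mathbb{R}_{\ge 0}^{n\times k}$ the polynomial $D_Vf=\prod_{j=1}^k\bigl(\sum_{i=1}^n V_{ij}\partial_i\bigr)f$ is nonnegative and log concave on $\mathbb{R}^n_{>0}$, with $\log 0=-\infty$ (so the zero polynomial is log concave). The machine performs exact real arithmetic ($+,-,\times,/$) and comparisons, addition and truncated subtraction of natural numbers, and indirectly addressed loads and stores, each at cost one; it has no conversion between reals and natural numbers, and its only constants are natural numbers. Its input is $n$ together with the $d$-dimensional $n\times\dots\times n$ array whose entry at $(i_1,\dots,i_d)$ is the coefficient of $z_{i_1}\cdots z_{i_d}$ in $f$. Moreover, such an $f$ is completely log concave if and only if the following two conditions hold (so the algorithm decides whether both hold): 1. for every $\alpha\in\mathbb{Z}_{\ge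 0}^n$ with $|\alpha|\le d-2$, the polynomial $\partial^\alpha f$ is indecomposable, i.e. it is not a sum of two nonconstant polynomials in disjoint sets of variables; 2. for every $\alpha\in\mathbb{Z}_{\ge 0}^n$ with $|\alpha|=d-2$ and $\partial^\alpha f\ne 0$, the (constant) Hessian of the quadratic form $\partial^\alpha f$ has exactly one positive eigenvalue, counted with multiplicity. (For $d\le 1$ both conditions are empty.) -/

import Mathlib

open MvPolynomial

/-! ### Complete log-concavity -/

namespace CLC

/-- The open positive orthant of `ℝⁿ`. -/
def posOrthant (n : ℕ) : Set (Fin n → ℝ) := {x | ∀ i, 0 < x i}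

/-- `g` is nonnegative on the open positive orthant and `log g` is concave there. At a zero of `g`
the logarithm is `-∞`; an extended-valued function with values in `[-∞, ∞)` is concave iff its
effective domain is convex and it is concave on it, and `ConcaveOn` asserts both.
In particular the zero polynomial is log-concave. -/
def IsLogConcave {n : ℕ} (g : MvPolynomial (Fin n) ℝ) : Prop :=
  (∀ x ∈ posOrthant n, 0 ≤ eval x g) ∧
    ConcaveOn ℝ {x | x ∈ posOrthant n ∧ 0 < eval x g} (fun x => Real.log (eval x g))

/-- The operator `D_V = ∏ⱼ ∑ᵢ V i j ∂ᵢ` applied to `g`. -/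
noncomputable def dirDeriv {n k : ℕ} (V : Matrix (Fin n) (Fin k) ℝ)
    (g : MvPolynomial (Fin n) ℝ) : MvPolynomial (Fin n) ℝ :=
  (List.ofFn fun j : Fin k =>
    (∑ i : Fin n, V i j • (pderiv i).toLinearMap :
      Module.End ℝ (MvPolynomial (Fin n) ℝ))).prod g

/-- `g` is completely log-concave: every iterated directional derivative of `g` in nonnegative
directions is nonnegative and log-concave on the positive orthant. -/
def IsCompletelyLogConcave {n : ℕ} (g : MvPolynomial (Fin n) ℝ) : Prop :=
  ∀ (k : ℕ) (V : Matrix (Fin n) (Fin k) ℝ), (∀ i j, 0 ≤ V i j) → IsLogConcave (dirDeriv V g)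

/-- The partial derivative `∂^α g = ∂₁^{α₁} ⋯ ∂ₙ^{αₙ} g`. -/
noncomputable def partialDeriv {n : ℕ} (α : Fin n → ℕ) (g : MvPolynomial (Fin n) ℝ) :
    MvPolynomial (Fin n) ℝ :=
  (List.ofFn fun i : Fin n =>
    ((pderiv i).toLinearMap : Module.End ℝ (MvPolynomial (Fin n) ℝ)) ^ α i).prod g

/-- `g` is not a sum of two nonconstant polynomials in disjoint sets of variables. (Constant
summands must be excluded: `g = (g - 1) + 1` is always such a decomposition.) -/
def IsIndecomposable {n : ℕ} (g : MvPolynomial (Fin n) ℝ) : Prop :=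
  ¬ ∃ g₁ g₂ : MvPolynomial (Fin n) ℝ, g = g₁ + g₂ ∧ Disjoint g₁.vars g₂.vars ∧
    g₁.totalDegree ≠ 0 ∧ g₂.totalDegree ≠ 0

/-- The Hessian matrix of `g` at the point `z`. -/
noncomputable def hessian {n : ℕ} (g : MvPolynomial (Fin n) ℝ) (z : Fin n → ℝ) :
    Matrix (Fin n) (Fin n) ℝ :=
  Matrix.of fun i j => eval z (pderiv i (pderiv j g))

/-- The number of positive eigenvalues of a real matrix, counted with multiplicity. -/
noncomputable def numPosEigenvalues {n : ℕ} (A : Matrix (Fin n) (Fin n) ℝ) : ℕ :=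
  (A.charpoly.roots.filter fun μ => 0 < μ).card

end CLC

/-! ### The real random access machine

Structured programs over exact real arithmetic. The machine has natural-number registers and
memory, used for counting and addressing, and real registers and memory. Memory is accessed only
at an address held in a natural-number register. Every instruction and every evaluation of a test
costs one time unit. On natural numbers there are only addition and truncated subtraction, no
multiplication; there is no conversion between reals and natural numbers (in particular no
rounding), and the only real constants of a program are natural numbers. -/

namespace RealRAM

/-- A memory configuration. -/
structure State where
  natReg : ℕ → ℕ
  natMem : ℕ → ℕ
  realReg : ℕ → ℝ
  realMem : ℕ → ℝ

/-- The elementary instructions. Arguments are indices of registers, except for the constant `k`;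
the first argument `a` is the target register (for a store: the register holding the target
address). -/
inductive Instr where
  | natConst (a k : ℕ)
  | natAdd (a b c : ℕ)
  | natSub (a b c : ℕ)
  | natLoad (a b : ℕ)
  | natStore (a b : ℕ)
  | realConst (a k : ℕ)
  | realAdd (a b c : ℕ)
  | realSub (a b c : ℕ)
  | realMul (a b c : ℕ)
  | realDiv (a b c : ℕ)
  | realLoad (a b : ℕ)
  | realStore (a b : ℕ)

/-- Division by zero is not allowed; every other instruction can always be executed. -/
def Instr.Allowed : Instr → State → Prop
  | .realDiv _ _ c, s => s.realReg c ≠ 0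
  | _, _ => True

/-- The effect of an instruction. -/
noncomputable def Instr.run : Instr → State → State
  | .natConst a k, s => { s with natReg := Function.update s.natReg a k }
  | .natAdd a b c, s =>
      { s with natReg := Function.update s.natReg a (s.natReg b + s.natReg c) }
  | .natSub a b c, s =>
      { s with natReg := Function.update s.natReg a (s.natReg b - s.natReg c) }
  | .natLoad a b, s =>
      { s with natReg := Function.update s.natReg a (s.natMem (s.natReg b)) }
  | .natStore a b, s =>
      { s with natMem := Function.update s.natMem (s.natReg a) (s.natReg b) }
  | .realConst a k, s => { s with realReg := Function.update s.realReg a (k : ℝ) }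
  | .realAdd a b c, s =>
      { s with realReg := Function.update s.realReg a (s.realReg b + s.realReg c) }
  | .realSub a b c, s =>
      { s with realReg := Function.update s.realReg a (s.realReg b - s.realReg c) }
  | .realMul a b c, s =>
      { s with realReg := Function.update s.realReg a (s.realReg b * s.realReg c) }
  | .realDiv a b c, s =>
      { s with realReg := Function.update s.realReg a (s.realReg b / s.realReg c) }
  | .realLoad a b, s =>
      { s with realReg := Function.update s.realReg a (s.realMem (s.natReg b)) }
  | .realStore a b, s =>
      { s with realMem := Function.update s.realMem (s.natReg a) (s.realReg b) }

/-- The tests: comparisons of two registers. -/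
inductive Test where
  | natLt (a b : ℕ)
  | natEq (a b : ℕ)
  | realLt (a b : ℕ)
  | realEq (a b : ℕ)

/-- The outcome of a test. -/
def Test.Holds : Test → State → Prop
  | .natLt a b, s => s.natReg a < s.natReg b
  | .natEq a b, s => s.natReg a = s.natReg b
  | .realLt a b, s => s.realReg a < s.realReg b
  | .realEq a b, s => s.realReg a = s.realReg b

/-- Programs: finite structured programs. -/
inductive Program where
  | skip
  | instr (i : Instr)
  | seq (p q : Program)
  | cond (c : Test) (p q : Program)
  | loop (c : Test) (p : Program)

/-- `Exec p s s' t`: started in `s`, the program `p` halts in `s'` after exactly `t` time units.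
(`cond` is if-then-else, `loop` is a while loop.) -/
inductive Exec : Program → State → State → ℕ → Prop
  | skip (s : State) : Exec .skip s s 0
  | instr {i : Instr} {s : State} (h : i.Allowed s) : Exec (.instr i) s (i.run s) 1
  | seq {p q : Program} {s s' s'' : State} {t t' : ℕ} (h : Exec p s s' t)
      (h' : Exec q s' s'' t') : Exec (.seq p q) s s'' (t + t')
  | condTrue {c : Test} {p q : Program} {s s' : State} {t : ℕ} (hc : c.Holds s)
      (h : Exec p s s' t) : Exec (.cond c p q) s s' (t + 1)
  | condFalse {c : Test} {p q : Program} {s s' : State} {t : ℕ} (hc : ¬ c.Holds s)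
      (h : Exec q s s' t) : Exec (.cond c p q) s s' (t + 1)
  | loopEnd {c : Test} {p : Program} {s : State} (hc : ¬ c.Holds s) : Exec (.loop c p) s s 1
  | loopStep {c : Test} {p : Program} {s s' s'' : State} {t t' : ℕ} (hc : c.Holds s)
      (h : Exec p s s' t) (h' : Exec (.loop c p) s' s'' t') :
      Exec (.loop c p) s s'' (t + t' + 1)

/-- The machine is deterministic: final state and running time are determined by the start. -/
theorem Exec.deterministic {p : Program} {s s₁ s₂ : State} {t₁ t₂ : ℕ}
    (h₁ : Exec p s s₁ t₁) (h₂ : Exec p s s₂ t₂) : s₁ = s₂ ∧ t₁ = t₂ := by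
  induction h₁ generalizing s₂ t₂ with
  | skip s => cases h₂; exact ⟨rfl, rfl⟩
  | instr h => cases h₂; exact ⟨rfl, rfl⟩
  | seq _ _ ih ih' =>
    cases h₂ with
    | seq g g' =>
      obtain ⟨rfl, rfl⟩ := ih g
      obtain ⟨rfl, rfl⟩ := ih' g'
      exact ⟨rfl, rfl⟩
  | condTrue hc _ ih =>
    cases h₂ with
    | condTrue _ g => obtain ⟨rfl, rfl⟩ := ih g; exact ⟨rfl, rfl⟩
    | condFalse gc _ => exact absurd hc gc
  | condFalse hc _ ih =>
    cases h₂ with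
    | condTrue gc _ => exact absurd gc hc
    | condFalse _ g => obtain ⟨rfl, rfl⟩ := ih g; exact ⟨rfl, rfl⟩
  | loopEnd hc =>
    cases h₂ with
    | loopEnd _ => exact ⟨rfl, rfl⟩
    | loopStep gc _ _ => exact absurd gc hc
  | loopStep hc _ _ ih ih' =>
    cases h₂ with
    | loopEnd gc => exact absurd hc gc
    | loopStep _ g g' =>
      obtain ⟨rfl, rfl⟩ := ih g
      obtain ⟨rfl, rfl⟩ := ih' g'
      exact ⟨rfl, rfl⟩

/-- The input representing a homogeneous polynomial `f` of degree `d` in `n` variables: natural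
register `0` holds `n`, and the real memory holds the coefficients of `f` as a `d`-dimensional
array of side length `n`; the cell with address `∑ j, i j * n ^ j`, where `i : Fin d → Fin n`,
holds the coefficient of the monomial `∏ j, X (i j)`. Everything else is zero. -/
noncomputable def input (d n : ℕ) (f : MvPolynomial (Fin n) ℝ) : State where
  natReg := fun a => if a = 0 then n else 0
  natMem := fun _ => 0
  realReg := fun _ => 0
  realMem := fun k =>
    if h : k < n ^ d then
      coeff (∑ j : Fin d, Finsupp.single (finFunctionFinEquiv.symm ⟨k, h⟩ j) 1) f
    else 0

/-- Started in `s`, the program `p` halts within `T` time units and answers correctly whether `Q`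
is true: natural register `0` finally holds `1` if `Q` is true and `0` if `Q` is false. -/
def DecidesWithin (p : Program) (s : State) (T : ℕ) (Q : Prop) : Prop :=
  ∃ (s' : State) (t : ℕ), Exec p s s' t ∧ t ≤ T ∧
    (Q → s'.natReg 0 = 1) ∧ (¬ Q → s'.natReg 0 = 0)

end RealRAM

/-!
For a form `f` of degree `d` with nonnegative coefficients, three properties are shown to be
equivalent.

* `IsCompletelyLogConcave f`.
* `HasLorentzianContractions d f`: for every word `i₁ ⋯ iₘ` with `m ≤ d - 2`, the quadratic form
  `∂_{i₁} ⋯ ∂_{iₘ} D_1^{d-2-m} f`, where `1` is the all-ones vector, has at most one positive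
  eigenvalue. These are finitely many explicit matrices.
* `IsLorentzian d f`: all derivatives of `f` of degree at least three have connected variables, and
  all derivatives of degree two have at most one positive eigenvalue. For homogeneous polynomials
  connectivity of the variables is indecomposability, and in degree two it follows from the
  condition on the eigenvalues; so by `isLorentzian_iff_partialDeriv` this is the conjunction of the
  two conditions of the theorem.

A log-concave quadratic form has at most one positive eigenvalue
(`IsLogConcave.atMostOnePos_hessian`), so the first property implies the second. A nonnegative
matrix with at most one positive eigenvalue has a connected zero pattern
(`AtMostOnePos.connectedPattern`), and contraction with the positive all-ones vector creates no
zeros, so the second implies the third. The way back is the local-to-global step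
`atMostOnePos_of_slices`. By Euler's identity the Hessian `A` of `f` at a positive point is a
contraction of the Hessians of the `∂ᵢ f`; if these have at most one positive eigenvalue, their
reverse Cauchy–Schwarz inequalities add up to `B ≤ B²` for the normalization `B` of `A` with largest
eigenvalue `1`. Hence the positive eigenvalues of `B` all equal `1`, and by connectivity this
eigenvalue is simple. By induction the Hessians at positive points of all derivatives of `f` in
positive directions have at most one positive eigenvalue; nonnegative directions follow by
continuity, and reverse Cauchy–Schwarz for the Hessians gives log-concavity.

The algorithm decides the second property. Multiplying the coefficients by factorials turns the
input array into the array of all derivatives of order `d` (`nestProg`), and the contractions of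
this array with the all-ones vector are obtained in one pass (`fillProg`), because `D_1 = ∑ ∂ᵢ`:
behind the input, cell `n^d + t` receives the sum of the cells `n t, …, n t + n - 1`. The memory
then holds the `n^(d-2) + ⋯ + 1` matrices in question as consecutive blocks
(`hasLorentzianContractions_iff_blocks`), followed by their row sums and by the sums of their
entries. A nonnegative symmetric matrix `A` with row sums `r` and sum of entries `s` has at most one
positive eigenvalue if and only if `r rᵀ - s A` is positive semidefinite
(`atMostOnePos_iff_lorentzDefect`), which division-free elimination decides in `O(n³)` steps
(`nonneg_iff_eliminateFirst`, `blockProg`). All blocks together take `O(n^(d+1))` steps.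
-/

/-! ### Symmetric matrices with at most one positive eigenvalue -/

namespace CLC

open Matrix

theorem isHermitian_of_isSymm {ι : Type*} {A : Matrix ι ι ℝ} (hA : A.IsSymm) : A.IsHermitian := by
  rw [IsHermitian, conjTranspose_eq_transpose_of_trivial]; exact hA

section LinearAlgebra

variable {ι : Type*} [Fintype ι]

/-- The quadratic form of `A` is nonpositive on some hyperplane `c⊥` (or everywhere, if `c = 0`);
for a symmetric matrix this says that `A` has at most one positive eigenvalue. -/
def AtMostOnePos (A : Matrix ι ι ℝ) : Prop :=
  ∃ c : ι → ℝ, ∀ u, c ⬝ᵥ u = 0 → u ⬝ᵥ A *ᵥ u ≤ 0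

theorem dotProduct_mulVec_symm {A : Matrix ι ι ℝ} (hA : A.IsSymm) (x y : ι → ℝ) :
    x ⬝ᵥ A *ᵥ y = y ⬝ᵥ A *ᵥ x := by
  rw [dotProduct_mulVec, dotProduct_comm, ← mulVec_transpose, hA]

theorem quadForm_add_smul {A : Matrix ι ι ℝ} (hA : A.IsSymm) (x y : ι → ℝ) (a b : ℝ) :
    (a • x + b • y) ⬝ᵥ A *ᵥ (a • x + b • y) =
      a ^ 2 * (x ⬝ᵥ A *ᵥ x) + 2 * a * b * (x ⬝ᵥ A *ᵥ y) + b ^ 2 * (y ⬝ᵥ A *ᵥ y) := by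
  simp only [mulVec_add, mulVec_smul, add_dotProduct, dotProduct_add, smul_dotProduct,
    dotProduct_smul, smul_eq_mul]
  rw [dotProduct_mulVec_symm hA y x]
  ring

/-- A form that is nonpositive on a hyperplane is not positive definite on any plane: the plane
meets the hyperplane. -/
theorem AtMostOnePos.not_pos_pos {A : Matrix ι ι ℝ} (hA : A.IsSymm) (h : AtMostOnePos A)
    {x y : ι → ℝ} (hxy : x ⬝ᵥ A *ᵥ y = 0) (hx : 0 < x ⬝ᵥ A *ᵥ x) : y ⬝ᵥ A *ᵥ y ≤ 0 := by
  obtain ⟨c, hc⟩ := h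
  by_contra! hy
  have h1 := hc ((c ⬝ᵥ y) • x + (-(c ⬝ᵥ x)) • y) (by
    simp only [dotProduct_add, dotProduct_smul, smul_eq_mul]; ring)
  rw [quadForm_add_smul hA, hxy] at h1
  by_cases h0 : c ⬝ᵥ x = 0
  · exact absurd (hc x h0) (not_le.2 hx)
  · have h2 : 0 < (c ⬝ᵥ x) ^ 2 := by positivity
    nlinarith [mul_pos h2 hy, mul_nonneg (sq_nonneg (c ⬝ᵥ y)) hx.le]

theorem dotProduct_mulVec_eq_sum (A : Matrix ι ι ℝ) (x y : ι → ℝ) :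
    x ⬝ᵥ A *ᵥ y = ∑ i, ∑ j, x i * A i j * y j := by
  simp only [dotProduct, mulVec, Finset.mul_sum, mul_assoc]

theorem quadForm_nonneg {A : Matrix ι ι ℝ} (h0 : ∀ i j, 0 ≤ A i j) {w : ι → ℝ}
    (hw : ∀ i, 0 ≤ w i) : 0 ≤ w ⬝ᵥ A *ᵥ w := by
  rw [dotProduct_mulVec_eq_sum]
  exact Finset.sum_nonneg fun i _ => Finset.sum_nonneg fun j _ =>
    mul_nonneg (mul_nonneg (hw i) (h0 i j)) (hw j)

theorem entry_eq_zero_of_quadForm_eq_zero {A : Matrix ι ι ℝ} (h0 : ∀ i j, 0 ≤ A i j) {w : ι → ℝ}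
    (hw : ∀ i, 0 ≤ w i) (h : w ⬝ᵥ A *ᵥ w = 0) {i j : ι} (hi : 0 < w i) (hj : 0 < w j) :
    A i j = 0 := by
  rw [dotProduct_mulVec_eq_sum] at h
  have hn : ∀ i j, 0 ≤ w i * A i j * w j := fun i j =>
    mul_nonneg (mul_nonneg (hw i) (h0 i j)) (hw j)
  rw [Finset.sum_eq_zero_iff_of_nonneg fun i _ => Finset.sum_nonneg fun j _ => hn i j] at h
  have h1 := h i (Finset.mem_univ _)
  rw [Finset.sum_eq_zero_iff_of_nonneg fun j _ => hn i j] at h1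
  have h2 := h1 j (Finset.mem_univ _)
  simpa [hi.ne', hj.ne'] using h2

/-- The reverse Cauchy–Schwarz inequality, in the direction of a positive vector. -/
theorem AtMostOnePos.mul_le_sq {A : Matrix ι ι ℝ} (hA : A.IsSymm) (h0 : ∀ i j, 0 ≤ A i j)
    (h : AtMostOnePos A) {w : ι → ℝ} (hw : ∀ i, 0 < w i) (x : ι → ℝ) :
    (x ⬝ᵥ A *ᵥ x) * (w ⬝ᵥ A *ᵥ w) ≤ (x ⬝ᵥ A *ᵥ w) ^ 2 := by
  rcases (quadForm_nonneg h0 fun i => (hw i).le).eq_or_lt with hz | hpos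
  · rw [← hz, mul_zero]; positivity
  · have h1 := h.not_pos_pos hA (x := w)
      (y := (w ⬝ᵥ A *ᵥ w) • x + (-(x ⬝ᵥ A *ᵥ w)) • w) (by
        simp only [mulVec_add, mulVec_smul, dotProduct_add, dotProduct_smul, smul_eq_mul]
        rw [dotProduct_mulVec_symm hA w x]; ring) hpos
    rw [quadForm_add_smul hA] at h1
    have : (w ⬝ᵥ A *ᵥ w) * ((x ⬝ᵥ A *ᵥ x) * (w ⬝ᵥ A *ᵥ w) - (x ⬝ᵥ A *ᵥ w) ^ 2) ≤ 0 := by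
      nlinarith
    nlinarith [nonpos_of_mul_nonpos_right this hpos]

theorem AtMostOnePos.of_mul_le_sq {A : Matrix ι ι ℝ} (h0 : ∀ i j, 0 ≤ A i j)
    {w : ι → ℝ} (hw : ∀ i, 0 < w i)
    (h : ∀ x, (x ⬝ᵥ A *ᵥ x) * (w ⬝ᵥ A *ᵥ w) ≤ (x ⬝ᵥ A *ᵥ w) ^ 2) : AtMostOnePos A := by
  rcases (quadForm_nonneg h0 fun i => (hw i).le).eq_or_lt with hz | hpos
  · refine ⟨0, fun u _ => ?_⟩
    have hA0 : ∀ i j, A i j = 0 := fun i j =>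
      entry_eq_zero_of_quadForm_eq_zero h0 (fun i => (hw i).le) hz.symm (hw i) (hw j)
    rw [dotProduct_mulVec_eq_sum]
    simp [hA0]
  · refine ⟨A *ᵥ w, fun u hu => ?_⟩
    have h1 := h u
    rw [dotProduct_comm u (A *ᵥ w), hu] at h1
    nlinarith

/-- Connectivity of a zero pattern: if the entries between `S` and its complement all vanish, then
so do all rows in `S` or all rows outside `S`. -/
def ConnectedPattern {ι : Type*} (Z : ι → ι → Prop) : Prop :=
  ∀ S : Set ι, (∀ i ∈ S, ∀ j ∉ S, Z i j) → (∀ i ∈ S, ∀ j, Z i j) ∨ (∀ i ∉ S, ∀ j, Z i j)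

/-- If the rows of `S` and those outside `S` were both nonzero and `S` were not joined to its
complement, the indicator vectors of `S` and of its complement would span a plane on which the form
is positive definite. -/
theorem AtMostOnePos.connectedPattern {A : Matrix ι ι ℝ} (hA : A.IsSymm)
    (h0 : ∀ i j, 0 ≤ A i j) (h : AtMostOnePos A) : ConnectedPattern fun i j => A i j = 0 := by
  classical
  intro S hS
  have hS' : ∀ i ∉ S, ∀ j ∈ S, A i j = 0 := fun i hi j hj => by
    rw [← hA.apply]; exact hS j hj i hi
  set u : ι → ℝ := fun i => if i ∈ S then 1 else 0 with hu
  set w : ι → ℝ := fun i => if i ∈ S then 0 else 1 with hw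
  have hu0 : ∀ i, 0 ≤ u i := fun i => by simp only [hu]; split_ifs <;> norm_num
  have hw0 : ∀ i, 0 ≤ w i := fun i => by simp only [hw]; split_ifs <;> norm_num
  have huw : u ⬝ᵥ A *ᵥ w = 0 := by
    rw [dotProduct_mulVec_eq_sum]
    refine Finset.sum_eq_zero fun i _ => Finset.sum_eq_zero fun j _ => ?_
    by_cases hi : i ∈ S
    · by_cases hj : j ∈ S
      · simp [hw, hj]
      · simp [hS i hi j hj]
    · simp [hu, hi]
  rcases (quadForm_nonneg h0 hu0).eq_or_lt with hz | hpos
  · left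
    intro i hi j
    by_cases hj : j ∈ S
    · exact entry_eq_zero_of_quadForm_eq_zero h0 hu0 hz.symm (by simp [hu, hi]) (by simp [hu, hj])
    · exact hS i hi j hj
  · right
    have hz := le_antisymm (h.not_pos_pos hA huw hpos) (quadForm_nonneg h0 hw0)
    intro i hi j
    by_cases hj : j ∈ S
    · exact hS' i hi j hj
    · exact entry_eq_zero_of_quadForm_eq_zero h0 hw0 hz (by simp [hw, hi]) (by simp [hw, hj])

section Spectral

variable [DecidableEq ι]

/-- The `i`-th vector of an orthonormal eigenbasis, as a plain function. -/
noncomputable def eigenvec {A : Matrix ι ι ℝ} (hA : A.IsHermitian) (i : ι) : ι → ℝ :=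
  ⇑(hA.eigenvectorBasis i)

theorem mulVec_eigenvec {A : Matrix ι ι ℝ} (hA : A.IsHermitian) (i : ι) :
    A *ᵥ eigenvec hA i = hA.eigenvalues i • eigenvec hA i :=
  hA.mulVec_eigenvectorBasis i

theorem eigenvec_dotProduct_eigenvec {A : Matrix ι ι ℝ} (hA : A.IsHermitian) (i j : ι) :
    eigenvec hA i ⬝ᵥ eigenvec hA j = if i = j then 1 else 0 := by
  have h := orthonormal_iff_ite.1 hA.eigenvectorBasis.orthonormal i j
  rw [← h, EuclideanSpace.inner_eq_star_dotProduct, star_trivial, dotProduct_comm]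
  rfl

theorem sum_eigenvec_smul {A : Matrix ι ι ℝ} (hA : A.IsHermitian) (x : ι → ℝ) :
    ∑ i, (eigenvec hA i ⬝ᵥ x) • eigenvec hA i = x := by
  have h := hA.eigenvectorBasis.sum_repr' (WithLp.toLp 2 x)
  have h2 := congrArg WithLp.ofLp h
  simp only [WithLp.ofLp_sum, WithLp.ofLp_smul] at h2
  rw [← h2]
  refine Finset.sum_congr rfl fun i _ => ?_
  congr 1
  rw [h2, EuclideanSpace.inner_eq_star_dotProduct, star_trivial, dotProduct_comm]
  rfl

theorem quadForm_eq_sum_eigenvalues {A : Matrix ι ι ℝ} (hA : A.IsHermitian) (x : ι → ℝ) :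
    x ⬝ᵥ A *ᵥ x = ∑ i, hA.eigenvalues i * (eigenvec hA i ⬝ᵥ x) ^ 2 := by
  conv_lhs => rw [← sum_eigenvec_smul hA x]
  simp only [mulVec_sum, mulVec_smul, mulVec_eigenvec, sum_dotProduct, dotProduct_sum,
    smul_dotProduct, dotProduct_smul, eigenvec_dotProduct_eigenvec, smul_eq_mul]
  refine Finset.sum_congr rfl fun i _ => ?_
  simp
  ring

end Spectral

theorem numPosEigenvalues_eq_card {n : ℕ} {A : Matrix (Fin n) (Fin n) ℝ} (hA : A.IsHermitian) :
    numPosEigenvalues A = (Finset.univ.filter fun i => 0 < hA.eigenvalues i).card := by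
  classical
  rw [numPosEigenvalues, hA.roots_charpoly_eq_eigenvalues, Multiset.filter_map, Multiset.card_map]
  rfl

/-- A nonzero nonnegative matrix has a positive eigenvalue, because its quadratic form is positive
at the all-ones vector. -/
theorem numPosEigenvalues_eq_one_iff {n : ℕ} {A : Matrix (Fin n) (Fin n) ℝ} (hA : A.IsSymm)
    (h0 : ∀ i j, 0 ≤ A i j) (hne : A ≠ 0) : numPosEigenvalues A = 1 ↔ AtMostOnePos A := by
  have hH := isHermitian_of_isSymm hA
  rw [numPosEigenvalues_eq_card hH]
  constructor
  · intro h
    obtain ⟨i₀, hi₀⟩ := Finset.card_eq_one.1 h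
    refine ⟨eigenvec hH i₀, fun u hu => ?_⟩
    rw [quadForm_eq_sum_eigenvalues hH]
    refine Finset.sum_nonpos fun i _ => ?_
    by_cases hi : i = i₀
    · subst hi; simp [hu]
    · have : i ∉ Finset.univ.filter fun i => 0 < hH.eigenvalues i := by
        rw [hi₀]; simpa using hi
      simp only [Finset.mem_filter, Finset.mem_univ, true_and, not_lt] at this
      exact mul_nonpos_of_nonpos_of_nonneg this (sq_nonneg _)
  · intro h
    have hq : ∀ i, eigenvec hH i ⬝ᵥ A *ᵥ eigenvec hH i = hH.eigenvalues i := fun i => by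
      rw [mulVec_eigenvec, dotProduct_smul, eigenvec_dotProduct_eigenvec]; simp
    refine le_antisymm (Finset.card_le_one.2 fun i hi j hj => ?_) (Finset.card_pos.2 ?_)
    · simp only [Finset.mem_filter, Finset.mem_univ, true_and] at hi hj
      by_contra hij
      have := h.not_pos_pos hA (x := eigenvec hH i) (y := eigenvec hH j) (by
        rw [mulVec_eigenvec, dotProduct_smul, eigenvec_dotProduct_eigenvec]; simp [hij])
        (by rwa [hq])
      rw [hq] at this
      linarith
    · by_contra hemp
      rw [Finset.not_nonempty_iff_eq_empty, Finset.filter_eq_empty_iff] at hemp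
      apply hne
      have h1 : (1 : Fin n → ℝ) ⬝ᵥ A *ᵥ 1 ≤ 0 := by
        rw [quadForm_eq_sum_eigenvalues hH]
        exact Finset.sum_nonpos fun i _ =>
          mul_nonpos_of_nonpos_of_nonneg (not_lt.1 (hemp (Finset.mem_univ i))) (sq_nonneg _)
      have h2 := le_antisymm h1 (quadForm_nonneg h0 fun _ => zero_le_one)
      ext i j
      exact entry_eq_zero_of_quadForm_eq_zero h0 (fun _ => zero_le_one) h2 zero_lt_one zero_lt_one

end LinearAlgebra

end CLC

/-! ### From the derivatives to the form itself -/

namespace CLC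

open Matrix

section TrickleDown

variable {ι : Type*} [Fintype ι]

theorem sum_mul_sub_quadForm_eq {A : Matrix ι ι ℝ} (hA : A.IsSymm) (x : ι → ℝ) :
    ∑ j, (∑ k, A j k) * x j ^ 2 - x ⬝ᵥ A *ᵥ x =
      (∑ j, ∑ k, A j k * (x j - x k) ^ 2) / 2 := by
  have h1 : ∑ j, ∑ k, A j k * x k ^ 2 = ∑ j, ∑ k, A j k * x j ^ 2 := by
    rw [Finset.sum_comm]
    exact Finset.sum_congr rfl fun j _ => Finset.sum_congr rfl fun k _ => by rw [hA.apply]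
  have h2 : ∑ j, ∑ k, A j k * (x j - x k) ^ 2 =
      ∑ j, ∑ k, A j k * x j ^ 2 + ∑ j, ∑ k, A j k * x k ^ 2
        - 2 * ∑ j, ∑ k, x j * A j k * x k := by
    simp only [Finset.mul_sum, ← Finset.sum_add_distrib, ← Finset.sum_sub_distrib]
    exact Finset.sum_congr rfl fun j _ => Finset.sum_congr rfl fun k _ => by ring
  rw [h2, h1, dotProduct_mulVec_eq_sum]
  simp only [Finset.sum_mul]
  ring

/-- If `xᵀAx ≤ ∑ⱼ (Ax)ⱼ² / rⱼ`, where `r` is the vector of row sums of a connected nonnegative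
matrix, then `A` has at most one positive eigenvalue. Rescaled to have largest eigenvalue `1`, the
matrix `B = D^{-1/2} A D^{-1/2}`, `D = diag r`, satisfies `B ≤ B²`, so each of its positive
eigenvalues is at least `1`; and by connectivity the eigenvalue `1` is simple. -/
theorem atMostOnePos_of_quadForm_le_sum_sq_div {A : Matrix ι ι ℝ} (hA : A.IsSymm)
    (h0 : ∀ i j, 0 ≤ A i j) (hconn : ConnectedPattern fun i j => A i j = 0)
    (h : ∀ x, x ⬝ᵥ A *ᵥ x ≤ ∑ j, (A *ᵥ x) j ^ 2 / ∑ k, A j k) : AtMostOnePos A := by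
  classical
  set r : ι → ℝ := fun j => ∑ k, A j k with hr
  have hr0 : ∀ j, 0 ≤ r j := fun j => Finset.sum_nonneg fun k _ => h0 j k
  have hrow : ∀ j, r j = 0 → ∀ k, A j k = 0 := fun j hj k =>
    (Finset.sum_eq_zero_iff_of_nonneg fun k _ => h0 j k).1 hj k (Finset.mem_univ _)
  -- `e j = 0` when `r j = 0`, so that `e` inverts `√r` exactly on the support of `A`
  set e : ι → ℝ := fun j => (√(r j))⁻¹ with he
  have hes : ∀ j, r j ≠ 0 → √(r j) * e j = 1 := fun j hj =>
    mul_inv_cancel₀ (Real.sqrt_ne_zero'.2 ((hr0 j).lt_of_ne' hj))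
  set B : Matrix ι ι ℝ := fun i j => e i * A i j * e j with hB
  have hBs : B.IsHermitian := isHermitian_of_isSymm (by
    ext i j
    rw [transpose_apply]
    simp only [hB]
    rw [hA.apply]; ring)
  have hAB : ∀ i j, A i j = √(r i) * B i j * √(r j) := fun i j => by
    by_cases hi : r i = 0
    · simp [hrow i hi, hi]
    by_cases hj : r j = 0
    · rw [← hA.apply, hrow j hj]; simp [hj]
    · have := hes i hi
      have h2 := hes j hj
      simp only [hB]
      calc A i j = (√(r i) * e i) * A i j * (√(r j) * e j) := by rw [this, h2]; ring
        _ = _ := by ring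
  -- an eigenvector of `B` for a positive eigenvalue is a multiple of `√r`
  have key : ∀ i, 0 < hBs.eigenvalues i → ∃ a : ℝ, ∀ j, eigenvec hBs i j = a * √(r j) := by
    intro i hi
    set v := eigenvec hBs i with hv
    set μ := hBs.eigenvalues i with hμ
    have hBv : B *ᵥ v = μ • v := mulVec_eigenvec hBs i
    have hvv : v ⬝ᵥ v = 1 := by rw [hv, eigenvec_dotProduct_eigenvec]; simp
    have hv0 : ∀ j, r j = 0 → v j = 0 := fun j hj => by
      have h1 := congrFun hBv j
      have h2 : (B *ᵥ v) j = 0 := by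
        simp [mulVec, dotProduct, hB, hrow j hj]
      rw [h2] at h1
      simpa [hi.ne'] using h1.symm
    set x : ι → ℝ := fun j => e j * v j with hx
    have hvx : ∀ j, v j = √(r j) * x j := fun j => by
      by_cases hj : r j = 0
      · simp [hv0 j hj, hj]
      · simp only [hx]; rw [← mul_assoc, hes j hj, one_mul]
    have hAx : ∀ j, (A *ᵥ x) j = √(r j) * (μ * v j) := fun j => by
      have h1 := congrFun hBv j
      simp only [Pi.smul_apply, smul_eq_mul] at h1
      rw [← h1]
      simp only [mulVec, dotProduct, Finset.mul_sum]
      refine Finset.sum_congr rfl fun k _ => ?_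
      rw [hAB, hvx k]; ring
    have hrx : ∑ j, r j * x j ^ 2 = 1 := by
      rw [← hvv, dotProduct]
      refine Finset.sum_congr rfl fun j _ => ?_
      rw [hvx j]
      nth_rewrite 1 [← Real.mul_self_sqrt (hr0 j)]
      ring
    have hxAx : x ⬝ᵥ A *ᵥ x = μ := by
      rw [dotProduct, ← mul_one μ, ← hvv, dotProduct, Finset.mul_sum]
      refine Finset.sum_congr rfl fun j _ => ?_
      rw [hAx, hvx j]; ring
    have hμ1 : μ ≤ μ ^ 2 := by
      have h1 := h x
      rw [hxAx] at h1
      refine h1.trans_eq ?_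
      rw [← mul_one (μ ^ 2), ← hvv, dotProduct, Finset.mul_sum]
      refine Finset.sum_congr rfl fun j _ => ?_
      by_cases hj : r j = 0
      · have : ∑ k, A j k = 0 := hj
        simp [this, hv0 j hj]
      · rw [hAx, mul_pow, Real.sq_sqrt (hr0 j)]
        change r j * _ / r j = _
        rw [mul_div_cancel_left₀ _ hj]; ring
    have hperron := sum_mul_sub_quadForm_eq hA x
    change ∑ j, r j * x j ^ 2 - _ = _ at hperron
    rw [hrx, hxAx] at hperron
    have hnn : ∀ j k, 0 ≤ A j k * (x j - x k) ^ 2 := fun j k =>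
      mul_nonneg (h0 j k) (sq_nonneg _)
    have hsum : ∑ j, ∑ k, A j k * (x j - x k) ^ 2 = 0 := by
      refine le_antisymm ?_ (Finset.sum_nonneg fun j _ => Finset.sum_nonneg fun k _ => hnn j k)
      nlinarith
    have hAjk : ∀ j k, x j ≠ x k → A j k = 0 := fun j k hjk => by
      rw [Finset.sum_eq_zero_iff_of_nonneg fun j _ => Finset.sum_nonneg fun k _ => hnn j k] at hsum
      have h1 := hsum j (Finset.mem_univ _)
      rw [Finset.sum_eq_zero_iff_of_nonneg fun k _ => hnn j k] at h1
      have h2 := h1 k (Finset.mem_univ _)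
      simpa [sub_ne_zero.2 hjk] using h2
    obtain ⟨j₀, hj₀⟩ : ∃ j₀, r j₀ ≠ 0 := by
      by_contra! hall
      rw [Finset.sum_eq_zero fun j _ => by rw [hall j, zero_mul]] at hrx
      exact zero_ne_one hrx
    refine ⟨x j₀, fun j => ?_⟩
    rcases hconn {j | x j = x j₀} (fun a ha b hb => hAjk a b fun hab => hb (by
      simpa [← hab] using ha)) with h1 | h1
    · exact absurd (Finset.sum_eq_zero fun k _ => h1 j₀ rfl k) hj₀
    · by_cases hj : x j = x j₀
      · rw [hvx, hj, mul_comm]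
      · have : r j = 0 := Finset.sum_eq_zero fun k _ => h1 j hj k
        rw [hv0 j this, this]; simp
  refine ⟨r, fun y hy => ?_⟩
  set y' : ι → ℝ := fun j => √(r j) * y j with hy'
  have h1 : y ⬝ᵥ A *ᵥ y = y' ⬝ᵥ B *ᵥ y' := by
    rw [dotProduct_mulVec_eq_sum, dotProduct_mulVec_eq_sum]
    refine Finset.sum_congr rfl fun j _ => Finset.sum_congr rfl fun k _ => ?_
    rw [hAB]; ring
  rw [h1, quadForm_eq_sum_eigenvalues hBs]
  refine Finset.sum_nonpos fun i _ => ?_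
  by_cases hi : 0 < hBs.eigenvalues i
  · obtain ⟨a, ha⟩ := key i hi
    have : eigenvec hBs i ⬝ᵥ y' = 0 := by
      rw [← mul_zero a, ← hy, dotProduct, dotProduct, Finset.mul_sum]
      refine Finset.sum_congr rfl fun j _ => ?_
      rw [ha]
      simp only [hy']
      nth_rewrite 3 [← Real.mul_self_sqrt (hr0 j)]
      ring
    simp [this]
  · exact mul_nonpos_of_nonpos_of_nonneg (not_lt.1 hi) (sq_nonneg _)

/-- The case `z = 1` of `atMostOnePos_of_slices`. -/
theorem atMostOnePos_of_slices_one {A : Matrix ι ι ℝ} (hA : A.IsSymm) (h0 : ∀ i j, 0 ≤ A i j)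
    (hconn : ConnectedPattern fun i j => A i j = 0) {T : ι → Matrix ι ι ℝ}
    (hT : ∀ i, (T i).IsSymm) (hT0 : ∀ i j k, 0 ≤ T i j k) {c : ℝ} (hc : 0 < c)
    (hsum : ∀ x, ∑ i, x ⬝ᵥ T i *ᵥ x = c * (x ⬝ᵥ A *ᵥ x))
    (hrow : ∀ i j, ∑ k, T i j k = c * A i j)
    (h : ∀ i, AtMostOnePos (T i)) : AtMostOnePos A := by
  refine atMostOnePos_of_quadForm_le_sum_sq_div hA h0 hconn fun x => ?_
  have h1 : c * (x ⬝ᵥ A *ᵥ x) ≤ c * ∑ j, (A *ᵥ x) j ^ 2 / ∑ k, A j k := by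
    rw [← hsum, Finset.mul_sum]
    refine Finset.sum_le_sum fun i _ => ?_
    have h2 := (h i).mul_le_sq (hT i) (hT0 i) (w := 1) (fun _ => zero_lt_one) x
    have h3 : T i *ᵥ 1 = c • A i := by
      ext j
      simpa [mulVec, dotProduct] using hrow i j
    have h4 : (1 : ι → ℝ) ⬝ᵥ T i *ᵥ 1 = c * ∑ k, A i k := by
      rw [h3, dotProduct_smul, one_dotProduct]; rfl
    have h5 : x ⬝ᵥ T i *ᵥ 1 = c * (A *ᵥ x) i := by
      rw [h3, dotProduct_smul, dotProduct_comm]; rfl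
    rw [h4, h5] at h2
    rcases (Finset.sum_nonneg fun k (_ : k ∈ Finset.univ) => h0 i k).eq_or_lt with hz | hp
    · have h6 : ∀ j k, T i j k = 0 := fun j k =>
        entry_eq_zero_of_quadForm_eq_zero (hT0 i) (w := 1) (fun _ => zero_le_one)
          (by rw [h4, ← hz, mul_zero]) zero_lt_one zero_lt_one
      rw [dotProduct_mulVec_eq_sum, ← hz]
      simp [h6]
    · rw [← mul_div_assoc, le_div_iff₀ hp]
      have : c * ((x ⬝ᵥ T i *ᵥ x) * ∑ k, A i k) ≤ c * (c * (A *ᵥ x) i ^ 2) := by linarith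
      exact le_of_mul_le_mul_left this hc
  exact le_of_mul_le_mul_left h1 hc

theorem quadForm_scale (A : Matrix ι ι ℝ) (z x : ι → ℝ) :
    x ⬝ᵥ (Matrix.of fun j k => z j * A j k * z k) *ᵥ x =
      (fun j => z j * x j) ⬝ᵥ A *ᵥ fun j => z j * x j := by
  rw [dotProduct_mulVec_eq_sum, dotProduct_mulVec_eq_sum]
  refine Finset.sum_congr rfl fun j _ => Finset.sum_congr rfl fun k _ => ?_
  simp only [of_apply]; ring

theorem atMostOnePos_scale_iff {A : Matrix ι ι ℝ} {z : ι → ℝ} (hz : ∀ i, z i ≠ 0) :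
    AtMostOnePos (Matrix.of fun j k => z j * A j k * z k) ↔ AtMostOnePos A := by
  constructor
  · rintro ⟨c, hc⟩
    refine ⟨fun j => c j / z j, fun u hu => ?_⟩
    have := hc (fun j => u j / z j) (by
      rw [← hu, dotProduct, dotProduct]
      exact Finset.sum_congr rfl fun j _ => by ring)
    rw [quadForm_scale] at this
    have hu' : (fun j => z j * (u j / z j)) = u := funext fun j => mul_div_cancel₀ _ (hz j)
    rwa [hu'] at this
  · rintro ⟨c, hc⟩
    refine ⟨fun j => c j * z j, fun u hu => ?_⟩
    rw [quadForm_scale]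
    apply hc
    rw [← hu, dotProduct, dotProduct]
    exact Finset.sum_congr rfl fun j _ => by ring

/-- The local-to-global step: let `A` be a connected nonnegative symmetric matrix which is, up to a
factor, the contraction of a symmetric tensor `T` with a positive vector `z`. If no slice `T i` has
more than one positive eigenvalue, then neither has `A`. -/
theorem atMostOnePos_of_slices {A : Matrix ι ι ℝ} (hA : A.IsSymm) (h0 : ∀ i j, 0 ≤ A i j)
    (hconn : ConnectedPattern fun i j => A i j = 0) {T : ι → Matrix ι ι ℝ}
    (hT : ∀ i, (T i).IsSymm) (hT' : ∀ i j k, T i j k = T k j i) (hT0 : ∀ i j k, 0 ≤ T i j k)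
    {c : ℝ} (hc : 0 < c) {z : ι → ℝ} (hz : ∀ i, 0 < z i)
    (hrow : ∀ i j, ∑ k, T i j k * z k = c * A i j)
    (h : ∀ i, AtMostOnePos (T i)) : AtMostOnePos A := by
  rw [← atMostOnePos_scale_iff fun i => (hz i).ne']
  refine atMostOnePos_of_slices_one (c := c)
    (T := fun i => z i • Matrix.of fun j k => z j * T i j k * z k) ?_ ?_ ?_ ?_ ?_ hc ?_ ?_ ?_
  · ext i j
    simp only [transpose_apply, of_apply]; rw [hA.apply]; ring
  · exact fun i j => mul_nonneg (mul_nonneg (hz i).le (h0 i j)) (hz j).le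
  · have hzz : ∀ i j, (Matrix.of fun j k => z j * A j k * z k) i j = 0 ↔ A i j = 0 := fun i j => by
      simp [(hz i).ne', (hz j).ne']
    simpa only [hzz] using hconn
  · intro i
    ext j k
    simp only [transpose_apply, of_apply, Matrix.smul_apply, smul_eq_mul]; rw [(hT i).apply]; ring
  · exact fun i j k =>
      mul_nonneg (hz i).le (mul_nonneg (mul_nonneg (hz j).le (hT0 i j k)) (hz k).le)
  · intro x
    simp only [dotProduct_mulVec_eq_sum, Finset.mul_sum, Matrix.smul_apply, of_apply, smul_eq_mul]
    rw [Finset.sum_comm]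
    refine Finset.sum_congr rfl fun j _ => ?_
    rw [Finset.sum_comm]
    refine Finset.sum_congr rfl fun k _ => ?_
    have := hrow k j
    calc _ = x j * x k * z j * z k * ∑ i, T k j i * z i := by
          rw [Finset.mul_sum]
          refine Finset.sum_congr rfl fun i _ => ?_
          rw [hT' i j k]; ring
      _ = _ := by rw [this, ← hA.apply]; ring
  · intro i j
    simp only [Matrix.smul_apply, of_apply, smul_eq_mul]
    calc _ = z i * z j * ∑ k, T i j k * z k := by
          rw [Finset.mul_sum]
          exact Finset.sum_congr rfl fun k _ => by ring
      _ = _ := by rw [hrow]; ring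
  · intro i
    obtain ⟨c, hc⟩ := (atMostOnePos_scale_iff fun i => (hz i).ne').2 (h i)
    refine ⟨c, fun u hu => ?_⟩
    rw [smul_mulVec, dotProduct_smul, smul_eq_mul]
    exact mul_nonpos_of_nonneg_of_nonpos (hz i).le (hc u hu)

end TrickleDown

end CLC

/-! ### Directional derivatives of forms with nonnegative coefficients -/

namespace CLC

open Matrix

variable {n : ℕ}

/-- A form of degree `d` with nonnegative coefficients. -/
structure IsNonnegForm (d : ℕ) (f : MvPolynomial (Fin n) ℝ) : Prop where
  hom : f.IsHomogeneous d
  nonneg : ∀ m, 0 ≤ f.coeff m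

/-- The derivative in direction `v`. -/
noncomputable def dirD (v : Fin n → ℝ) : Module.End ℝ (MvPolynomial (Fin n) ℝ) :=
  ∑ i, v i • (pderiv i).toLinearMap

theorem dirD_apply (v : Fin n → ℝ) (f : MvPolynomial (Fin n) ℝ) :
    dirD v f = ∑ i, v i • pderiv i f := by
  simp [dirD, LinearMap.sum_apply]

theorem pderiv_pderiv_comm (i j : Fin n) (f : MvPolynomial (Fin n) ℝ) :
    pderiv i (pderiv j f) = pderiv j (pderiv i f) := by
  ext m
  rcases eq_or_ne i j with rfl | h
  · rfl
  · simp only [coeff_pderiv, Finsupp.add_apply, Finsupp.single_eq_of_ne h,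
      Finsupp.single_eq_of_ne h.symm, add_zero]
    rw [add_right_comm]
    ring

theorem pderiv_dirD_comm (i : Fin n) (v : Fin n → ℝ) (f : MvPolynomial (Fin n) ℝ) :
    pderiv i (dirD v f) = dirD v (pderiv i f) := by
  simp only [dirD_apply, map_sum]
  exact Finset.sum_congr rfl fun j _ => by rw [Derivation.map_smul, pderiv_pderiv_comm]

theorem dirD_single (i : Fin n) (f : MvPolynomial (Fin n) ℝ) :
    dirD (Pi.single i 1) f = pderiv i f := by
  rw [dirD_apply, Finset.sum_eq_single i] <;> simp +contextual

theorem eval_dirD (v z : Fin n → ℝ) (f : MvPolynomial (Fin n) ℝ) :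
    eval z (dirD v f) = ∑ i, v i * eval z (pderiv i f) := by
  simp [dirD_apply, smul_eval]

theorem IsNonnegForm.pderiv {d : ℕ} {f : MvPolynomial (Fin n) ℝ} (h : IsNonnegForm d f)
    (i : Fin n) : IsNonnegForm (d - 1) (pderiv i f) :=
  ⟨h.hom.pderiv, fun m => by
    rw [coeff_pderiv]
    exact mul_nonneg (h.nonneg _) (by positivity)⟩

theorem IsNonnegForm.dirD {d : ℕ} {f : MvPolynomial (Fin n) ℝ} (h : IsNonnegForm d f)
    {v : Fin n → ℝ} (hv : ∀ i, 0 ≤ v i) : IsNonnegForm (d - 1) (dirD v f) := by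
  rw [dirD_apply]
  refine ⟨IsHomogeneous.sum _ _ _ fun i _ => ?_, fun m => ?_⟩
  · rw [smul_eq_C_mul]
    exact (h.pderiv i).hom.C_mul _
  · rw [coeff_sum]
    refine Finset.sum_nonneg fun i _ => ?_
    rw [coeff_smul]
    exact mul_nonneg (hv i) ((h.pderiv i).nonneg m)

theorem IsNonnegForm.eval_nonneg {d : ℕ} {f : MvPolynomial (Fin n) ℝ} (h : IsNonnegForm d f)
    {z : Fin n → ℝ} (hz : ∀ i, 0 ≤ z i) : 0 ≤ eval z f := by
  rw [eval_eq]
  exact Finset.sum_nonneg fun m _ =>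
    mul_nonneg (h.nonneg m) (Finset.prod_nonneg fun i _ => pow_nonneg (hz i) _)

theorem IsNonnegForm.eval_eq_zero_iff {d : ℕ} {f : MvPolynomial (Fin n) ℝ}
    (h : IsNonnegForm d f) {z : Fin n → ℝ} (hz : ∀ i, 0 < z i) : eval z f = 0 ↔ f = 0 := by
  refine ⟨fun h0 => ?_, fun h0 => by simp [h0]⟩
  rw [eval_eq, Finset.sum_eq_zero_iff_of_nonneg fun m _ => mul_nonneg (h.nonneg m)
    (Finset.prod_nonneg fun i _ => pow_nonneg (hz i).le _)] at h0
  ext m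
  by_cases hm : m ∈ f.support
  · have h1 := h0 m hm
    have h2 : ∏ i ∈ m.support, z i ^ m i ≠ 0 :=
      Finset.prod_ne_zero_iff.2 fun i _ => pow_ne_zero _ (hz i).ne'
    simpa [h2] using h1
  · simpa using hm

/-- Euler's identity at a point. -/
theorem sum_mul_eval_pderiv {d : ℕ} {f : MvPolynomial (Fin n) ℝ} (h : f.IsHomogeneous d)
    (z : Fin n → ℝ) : ∑ i, z i * eval z (pderiv i f) = d * eval z f := by
  have := congrArg (eval z) h.sum_X_mul_pderiv
  simpa [map_sum] using this

theorem eval_eq_coeff_zero {f : MvPolynomial (Fin n) ℝ} (h : f.IsHomogeneous 0)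
    (z : Fin n → ℝ) : eval z f = coeff 0 f := by
  have h1 : f.totalDegree = 0 := Nat.le_zero.1 h.totalDegree_le
  rw [totalDegree_eq_zero_iff_eq_C] at h1
  rw [h1]; simp

theorem pderiv_eq_zero_of_isHomogeneous_zero {f : MvPolynomial (Fin n) ℝ}
    (h : f.IsHomogeneous 0) (i : Fin n) : pderiv i f = 0 := by
  have h1 : f.totalDegree = 0 := Nat.le_zero.1 h.totalDegree_le
  rw [totalDegree_eq_zero_iff_eq_C] at h1
  rw [h1]; simp

/-- A form of positive degree all of whose partial derivatives vanish is zero. -/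
theorem eq_zero_of_pderiv_eq_zero {d : ℕ} {f : MvPolynomial (Fin n) ℝ}
    (h : f.IsHomogeneous (d + 1)) (h0 : ∀ i, pderiv i f = 0) : f = 0 := by
  have h1 := h.sum_X_mul_pderiv
  simp only [h0, mul_zero, Finset.sum_const_zero] at h1
  rw [nsmul_eq_mul, eq_comm, mul_eq_zero] at h1
  rcases h1 with h1 | h1
  · rw [Nat.cast_eq_zero] at h1; omega
  · exact h1

theorem IsNonnegForm.dirD_eq_zero {d : ℕ} {f : MvPolynomial (Fin n) ℝ}
    (h : IsNonnegForm (d + 1) f) {v : Fin n → ℝ} (hv : ∀ i, 0 < v i) (h0 : CLC.dirD v f = 0) :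
    f = 0 := by
  refine eq_zero_of_pderiv_eq_zero h.hom fun i => ?_
  have h1 : eval 1 (CLC.dirD v f) = 0 := by rw [h0]; simp
  have hn : ∀ i, 0 ≤ eval 1 (MvPolynomial.pderiv i f) := fun i =>
    (h.pderiv i).eval_nonneg fun _ => zero_le_one
  rw [eval_dirD, Finset.sum_eq_zero_iff_of_nonneg fun i _ => mul_nonneg (hv i).le (hn i)] at h1
  have h2 := h1 i (Finset.mem_univ _)
  rw [mul_eq_zero, or_iff_right (hv i).ne'] at h2
  exact ((h.pderiv i).eval_eq_zero_iff fun _ => zero_lt_one).1 h2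

theorem hessian_isSymm (f : MvPolynomial (Fin n) ℝ) (z : Fin n → ℝ) : (hessian f z).IsSymm := by
  ext i j
  simp only [hessian, transpose_apply, of_apply]
  rw [pderiv_pderiv_comm]

theorem hessian_apply (f : MvPolynomial (Fin n) ℝ) (z : Fin n → ℝ) (i j : Fin n) :
    hessian f z i j = eval z (pderiv i (pderiv j f)) := rfl

theorem IsNonnegForm.hessian_nonneg {d : ℕ} {f : MvPolynomial (Fin n) ℝ} (h : IsNonnegForm d f)
    {z : Fin n → ℝ} (hz : ∀ i, 0 ≤ z i) (i j : Fin n) : 0 ≤ hessian f z i j :=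
  ((h.pderiv j).pderiv i).eval_nonneg hz

theorem IsNonnegForm.hessian_eq_zero_iff {d : ℕ} {f : MvPolynomial (Fin n) ℝ}
    (h : IsNonnegForm d f) {z : Fin n → ℝ} (hz : ∀ i, 0 < z i) (i j : Fin n) :
    hessian f z i j = 0 ↔ MvPolynomial.pderiv i (MvPolynomial.pderiv j f) = 0 :=
  ((h.pderiv j).pderiv i).eval_eq_zero_iff hz

/-- The Hessian of a quadratic form is constant. -/
theorem hessian_eq_of_isHomogeneous_two {f : MvPolynomial (Fin n) ℝ} (h : f.IsHomogeneous 2)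
    (z w : Fin n → ℝ) : hessian f z = hessian f w := by
  ext i j
  have h1 : (MvPolynomial.pderiv i (MvPolynomial.pderiv j f)).IsHomogeneous 0 := h.pderiv.pderiv
  rw [hessian_apply, hessian_apply, eval_eq_coeff_zero h1, eval_eq_coeff_zero h1]

/-! ### Lorentzian forms, recursively -/

/-- The graph on the variables in which `i` and `j` are joined if `∂ᵢ∂ⱼf ≠ 0` is connected, apart
from isolated vertices. -/
def HasConnectedVars (f : MvPolynomial (Fin n) ℝ) : Prop :=
  ConnectedPattern fun i j => pderiv i (pderiv j f) = 0

/-- The recursive form of the two conditions: connectivity in degree at least three, passed on to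
all partial derivatives, and at most one positive eigenvalue in degree two. -/
def IsLorentzian : ℕ → MvPolynomial (Fin n) ℝ → Prop
  | 0, _ => True
  | 1, _ => True
  | 2, f => AtMostOnePos (hessian f 0)
  | d + 3, f => HasConnectedVars f ∧ ∀ i, IsLorentzian (d + 2) (pderiv i f)

theorem IsLorentzian.atMostOnePos_hessian {d : ℕ} {f : MvPolynomial (Fin n) ℝ}
    (hf : IsNonnegForm (d + 2) f) (h : IsLorentzian (d + 2) f) {z : Fin n → ℝ}
    (hz : ∀ i, 0 < z i) : AtMostOnePos (hessian f z) := by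
  induction d generalizing f with
  | zero => rw [hessian_eq_of_isHomogeneous_two hf.hom z 0]; exact h
  | succ d ih =>
    refine atMostOnePos_of_slices (hessian_isSymm f z) (hf.hessian_nonneg fun i => (hz i).le) ?_
      (T := fun i => hessian (MvPolynomial.pderiv i f) z) (fun i => hessian_isSymm _ z) ?_ ?_
      (c := (d + 1 : ℝ)) (by positivity) hz ?_ fun i => ih (hf.pderiv i) (h.2 i)
    · simp only [hf.hessian_eq_zero_iff hz]
      exact h.1
    · intro i j k
      simp only [hessian_apply]
      rw [pderiv_pderiv_comm k i, pderiv_pderiv_comm j i, pderiv_pderiv_comm j k]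
    · exact fun i => (hf.pderiv i).hessian_nonneg fun i => (hz i).le
    · intro i j
      have h1 := sum_mul_eval_pderiv ((hf.pderiv j).pderiv i).hom z
      simp only [hessian_apply]
      have h2 : ((d + 1 + 2 - 1 - 1 : ℕ) : ℝ) = d + 1 := by norm_num
      rw [h2] at h1
      rw [← h1]
      refine Finset.sum_congr rfl fun k _ => ?_
      rw [pderiv_pderiv_comm j k, pderiv_pderiv_comm j i, mul_comm]

theorem IsLorentzian.hasConnectedVars {d : ℕ} {f : MvPolynomial (Fin n) ℝ}
    (hf : IsNonnegForm (d + 2) f) (h : IsLorentzian (d + 2) f) : HasConnectedVars f := by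
  have h1 := (h.atMostOnePos_hessian hf (z := 1) fun _ => zero_lt_one).connectedPattern
    (hessian_isSymm f 1) (hf.hessian_nonneg fun _ => zero_le_one)
  simpa only [HasConnectedVars, hf.hessian_eq_zero_iff (z := 1) fun _ => zero_lt_one] using h1

theorem IsLorentzian.dirD {d : ℕ} {f : MvPolynomial (Fin n) ℝ} (hf : IsNonnegForm (d + 1) f)
    (h : IsLorentzian (d + 1) f) {v : Fin n → ℝ} (hv : ∀ i, 0 < v i) :
    IsLorentzian d (dirD v f) := by
  induction d generalizing f with
  | zero => trivial
  | succ d ih =>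
    match d with
    | 0 => trivial
    | 1 =>
      -- the Hessian of `D_v f` is the Hessian of the cubic form `f` at `v`
      have h1 : hessian (CLC.dirD v f) 0 = hessian f v := by
        ext i j
        have h2 : (MvPolynomial.pderiv i (MvPolynomial.pderiv j f)).IsHomogeneous 1 :=
          hf.hom.pderiv.pderiv
        rw [hessian_apply, hessian_apply, pderiv_dirD_comm, pderiv_dirD_comm, eval_dirD]
        have h3 := sum_mul_eval_pderiv h2 v
        rw [Nat.cast_one, one_mul] at h3
        rw [← h3]
        refine Finset.sum_congr rfl fun k _ => ?_
        have h4 := h2.pderiv (i := k)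
        rw [eval_eq_coeff_zero h4, eval_eq_coeff_zero h4]
      change AtMostOnePos _
      rw [h1]
      exact h.atMostOnePos_hessian hf hv
    | d + 2 =>
      refine ⟨?_, fun i => ?_⟩
      · have h1 : ∀ i j, MvPolynomial.pderiv i (MvPolynomial.pderiv j (CLC.dirD v f)) = 0 ↔
            MvPolynomial.pderiv i (MvPolynomial.pderiv j f) = 0 := fun i j => by
          rw [pderiv_dirD_comm, pderiv_dirD_comm]
          refine ⟨fun h0 => ?_, fun h0 => by rw [h0, map_zero]⟩
          exact IsNonnegForm.dirD_eq_zero (d := d + 1) ((hf.pderiv j).pderiv i) hv h0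
        simpa only [HasConnectedVars, h1] using h.1
      · rw [pderiv_dirD_comm]
        exact ih (hf.pderiv i) (h.2 i)

/-! ### Iterated directional derivatives -/

/-- The composition of the derivatives in the directions listed in `l`. -/
noncomputable def dirDs (l : List (Fin n → ℝ)) : Module.End ℝ (MvPolynomial (Fin n) ℝ) :=
  (l.map dirD).prod

theorem dirDs_nil (f : MvPolynomial (Fin n) ℝ) : dirDs [] f = f := rfl

theorem dirDs_cons (v : Fin n → ℝ) (l : List (Fin n → ℝ)) (f : MvPolynomial (Fin n) ℝ) :
    dirDs (v :: l) f = dirD v (dirDs l f) := by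
  simp [dirDs]

theorem dirDs_append (l l' : List (Fin n → ℝ)) (f : MvPolynomial (Fin n) ℝ) :
    dirDs (l ++ l') f = dirDs l (dirDs l' f) := by
  simp [dirDs]

theorem isCompletelyLogConcave_iff {f : MvPolynomial (Fin n) ℝ} :
    IsCompletelyLogConcave f ↔
      ∀ l : List (Fin n → ℝ), (∀ v ∈ l, ∀ i, 0 ≤ v i) → IsLogConcave (dirDs l f) := by
  have h1 : ∀ (k : ℕ) (V : Matrix (Fin n) (Fin k) ℝ),
      dirDeriv V f = dirDs (List.ofFn fun j i => V i j) f := fun k V => by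
    rw [dirDeriv, dirDs, List.map_ofFn]; rfl
  constructor
  · intro h l hl
    have h2 := h l.length (Matrix.of fun i j => l.get j i) fun i j =>
      hl _ (List.get_mem l j) i
    rw [h1] at h2
    convert h2
    exact (List.ofFn_get l).symm
  · intro h k V hV
    rw [h1]
    refine h _ fun v hv i => ?_
    obtain ⟨j, rfl⟩ := (List.mem_ofFn' _ _).1 hv
    exact hV i j

theorem IsNonnegForm.dirDs {d : ℕ} {f : MvPolynomial (Fin n) ℝ} (hf : IsNonnegForm d f)
    {l : List (Fin n → ℝ)} (hl : ∀ v ∈ l, ∀ i, 0 ≤ v i) :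
    IsNonnegForm (d - l.length) (dirDs l f) := by
  induction l with
  | nil => exact hf
  | cons v l ih =>
    rw [dirDs_cons, List.length_cons, ← Nat.sub_sub]
    exact (ih fun w hw => hl w (List.mem_cons_of_mem _ hw)).dirD (hl v List.mem_cons_self)

theorem IsLorentzian.dirDs {d : ℕ} {f : MvPolynomial (Fin n) ℝ} (hf : IsNonnegForm d f)
    (h : IsLorentzian d f) {l : List (Fin n → ℝ)} (hl : ∀ v ∈ l, ∀ i, 0 < v i) :
    IsLorentzian (d - l.length) (dirDs l f) := by
  induction l with
  | nil => exact h
  | cons v l ih =>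
    rw [dirDs_cons, List.length_cons, ← Nat.sub_sub]
    have h1 := ih fun w hw => hl w (List.mem_cons_of_mem _ hw)
    have h2 := hf.dirDs (l := l) fun w hw i => (hl w (List.mem_cons_of_mem _ hw) i).le
    generalize d - l.length = e at h1 h2
    cases e with
    | zero => trivial
    | succ e => exact h1.dirD h2 (hl v List.mem_cons_self)

theorem continuous_dirDs (l : List (Fin n → ℝ)) (f : MvPolynomial (Fin n) ℝ)
    (φ : MvPolynomial (Fin n) ℝ →ₗ[ℝ] ℝ) :
    Continuous fun ε : ℝ => φ (dirDs (l.map fun v i => v i + ε) f) := by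
  induction l generalizing φ with
  | nil => exact continuous_const (y := φ f)
  | cons v l ih =>
    simp only [List.map_cons, dirDs_cons, dirD_apply, map_sum, map_smul, smul_eq_mul]
    exact continuous_finsetSum Finset.univ fun i _ =>
      (continuous_const.add continuous_id).mul (ih (φ ∘ₗ (pderiv i).toLinearMap))

/-- Reverse Cauchy–Schwarz for the Hessians of all derivatives in nonnegative directions. It holds
in positive directions, where the derivative is again Lorentzian, and persists in the limit. -/
theorem IsLorentzian.mul_le_sq {d : ℕ} {f : MvPolynomial (Fin n) ℝ} (hf : IsNonnegForm d f)
    (h : IsLorentzian d f) {l : List (Fin n → ℝ)} (hl : ∀ v ∈ l, ∀ i, 0 ≤ v i)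
    (hld : l.length + 2 ≤ d) {z : Fin n → ℝ} (hz : ∀ i, 0 < z i) (x : Fin n → ℝ) :
    (x ⬝ᵥ hessian (CLC.dirDs l f) z *ᵥ x) * (z ⬝ᵥ hessian (CLC.dirDs l f) z *ᵥ z) ≤
      (x ⬝ᵥ hessian (CLC.dirDs l f) z *ᵥ z) ^ 2 := by
  have hcont : ∀ x y : Fin n → ℝ, Continuous fun ε : ℝ =>
      x ⬝ᵥ hessian (CLC.dirDs (l.map fun v i => v i + ε) f) z *ᵥ y := fun x y => by
    simp only [dotProduct_mulVec_eq_sum]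
    refine continuous_finsetSum _ fun i _ => continuous_finsetSum _ fun j _ =>
      (continuous_const.mul ?_).mul continuous_const
    exact continuous_dirDs l f
      ((aeval z).toLinearMap ∘ₗ (MvPolynomial.pderiv i).toLinearMap ∘ₗ
        (MvPolynomial.pderiv j).toLinearMap)
  have h0 : (l.map fun v i => v i + (0 : ℝ)) = l := by simp
  have key : ∀ ε : ℝ, 0 < ε → 0 ≤
      (x ⬝ᵥ hessian (CLC.dirDs (l.map fun v i => v i + ε) f) z *ᵥ z) ^ 2 -
      (x ⬝ᵥ hessian (CLC.dirDs (l.map fun v i => v i + ε) f) z *ᵥ x) *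
        (z ⬝ᵥ hessian (CLC.dirDs (l.map fun v i => v i + ε) f) z *ᵥ z) := by
    intro ε hε
    have hl' : ∀ v ∈ l.map fun v i => v i + ε, ∀ i, 0 < v i := by
      intro v hv i
      obtain ⟨w, hw, rfl⟩ := List.mem_map.1 hv
      exact add_pos_of_nonneg_of_pos (hl w hw i) hε
    have h1 := hf.dirDs fun v hv i => (hl' v hv i).le
    have h2 := h.dirDs hf hl'
    rw [List.length_map] at h1 h2
    obtain ⟨e, he⟩ : ∃ e, d - l.length = e + 2 := ⟨d - l.length - 2, by omega⟩
    rw [he] at h1 h2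
    rw [sub_nonneg]
    exact (h2.atMostOnePos_hessian h1 hz).mul_le_sq (hessian_isSymm _ z)
      (h1.hessian_nonneg fun i => (hz i).le) hz x
  have hc := (((hcont x z).pow 2).sub ((hcont x x).mul (hcont z z))).tendsto 0
  have h3 := ge_of_tendsto (hc.mono_left (nhdsWithin_le_nhds (s := Set.Ioi 0)))
    (Filter.eventually_of_mem self_mem_nhdsWithin fun ε hε => key ε hε)
  simp only [Pi.sub_apply, Pi.pow_apply, Pi.mul_apply, h0] at h3
  exact sub_nonneg.1 h3

end CLC

/-! ### Log-concavity and Hessians -/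

namespace CLC

open Matrix

variable {n : ℕ}

theorem hasDerivAt_eval_line (g : MvPolynomial (Fin n) ℝ) (x v : Fin n → ℝ) (t : ℝ) :
    HasDerivAt (fun t : ℝ => eval (x + t • v) g) (eval (x + t • v) (dirD v g)) t := by
  induction g using MvPolynomial.induction_on with
  | C a => simpa [dirD_apply] using hasDerivAt_const t a
  | add p q hp hq =>
    simp only [map_add]
    exact hp.add hq
  | mul_X p i hp =>
    have h1 : HasDerivAt (fun t : ℝ => (x + t • v) i) (v i) t := by
      simpa using ((hasDerivAt_id t).mul_const (v i)).const_add (x i)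
    have h2 : HasDerivAt (fun t : ℝ => eval (x + t • v) p * (x + t • v) i)
        (eval (x + t • v) (dirD v p) * (x + t • v) i + eval (x + t • v) p * v i) t := hp.mul h1
    have h3 : dirD v (p * X i) = dirD v p * X i + p * C (v i) := by
      simp only [dirD_apply, pderiv_mul, smul_add, Finset.sum_add_distrib, Finset.sum_mul,
        smul_mul_assoc]
      congr 1
      rw [Finset.sum_eq_single i]
      · simp [smul_eq_C_mul, mul_comm]
      · intro j _ hj
        simp [pderiv_X_of_ne hj.symm]
      · simp
    simpa only [h3, map_add, map_mul, eval_X, eval_C] using h2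

/-- The second-order criterion for log-concavity on the positive orthant. -/
theorem IsNonnegForm.isLogConcave {d : ℕ} {g : MvPolynomial (Fin n) ℝ} (hg : IsNonnegForm d g)
    (h : ∀ z v : Fin n → ℝ, (∀ i, 0 < z i) →
      eval z (CLC.dirD v (CLC.dirD v g)) * eval z g ≤ eval z (CLC.dirD v g) ^ 2) :
    IsLogConcave g := by
  refine ⟨fun x hx => hg.eval_nonneg fun i => (hx i).le, ?_⟩
  by_cases hg0 : g = 0
  · have : {x | x ∈ posOrthant n ∧ 0 < eval x g} = ∅ := by
      ext x; simp [hg0]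
    rw [this]
    exact ⟨convex_empty, fun x hx => absurd hx (Set.notMem_empty x)⟩
  have hpos : ∀ x ∈ posOrthant n, 0 < eval x g := fun x hx =>
    (hg.eval_nonneg fun i => (hx i).le).lt_of_ne' fun h0 => hg0 ((hg.eval_eq_zero_iff hx).1 h0)
  have hset : {x | x ∈ posOrthant n ∧ 0 < eval x g} = posOrthant n := by
    ext x
    exact ⟨fun hx => hx.1, fun hx => ⟨hx, hpos x hx⟩⟩
  have hconv : Convex ℝ (posOrthant n) := by
    intro x hx y hy a b ha hb hab i
    simp only [Pi.add_apply, Pi.smul_apply, smul_eq_mul]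
    rcases ha.eq_or_lt with rfl | ha
    · rw [zero_add] at hab
      subst hab
      simpa using hy i
    · exact add_pos_of_pos_of_nonneg (mul_pos ha (hx i)) (mul_nonneg hb (hy i).le)
  rw [hset]
  refine ⟨hconv, fun x hx y hy a b ha hb hab => ?_⟩
  set v := y - x with hv
  have hmem : ∀ t ∈ Set.Icc (0 : ℝ) 1, x + t • v ∈ posOrthant n := fun t ht => by
    have h1 : x + t • v = (1 - t) • x + t • y := by
      rw [hv, smul_sub, sub_smul, one_smul]; abel
    rw [h1]
    exact hconv hx hy (sub_nonneg.2 ht.2) ht.1 (by ring)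
  have hp := fun t => hasDerivAt_eval_line g x v t
  have hp' := fun t => hasDerivAt_eval_line (CLC.dirD v g) x v t
  have hne : ∀ t ∈ Set.Icc (0 : ℝ) 1, eval (x + t • v) g ≠ 0 := fun t ht =>
    (hpos _ (hmem t ht)).ne'
  have hint : ∀ t ∈ interior (Set.Icc (0 : ℝ) 1), t ∈ Set.Icc (0 : ℝ) 1 := fun t ht =>
    interior_subset ht
  have hφ : ConcaveOn ℝ (Set.Icc (0 : ℝ) 1) fun t => Real.log (eval (x + t • v) g) := by
    refine concaveOn_of_hasDerivWithinAt2_nonpos (convex_Icc 0 1)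
      (fun t ht => ((hp t).log (hne t ht)).continuousAt.continuousWithinAt)
      (fun t ht => ((hp t).log (hne t (hint t ht))).hasDerivWithinAt)
      (fun t ht => ((hp' t).div (hp t) (hne t (hint t ht))).hasDerivWithinAt) fun t ht => ?_
    refine div_nonpos_of_nonpos_of_nonneg ?_ (sq_nonneg _)
    have := h (x + t • v) v (hmem t (hint t ht))
    linarith [sq (eval (x + t • v) (CLC.dirD v g))]
  have h1 := hφ.2 (Set.left_mem_Icc.2 zero_le_one) (Set.right_mem_Icc.2 zero_le_one) ha hb hab
  have h2 : x + (a • (0 : ℝ) + b • (1 : ℝ)) • v = a • x + b • y := by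
    rw [hv, ← eq_sub_iff_add_eq] at *
    subst hab
    simp only [smul_eq_mul, mul_zero, zero_add, mul_one, smul_sub, sub_smul, one_smul]
    abel
  have h3 : x + (1 : ℝ) • v = y := by rw [hv, one_smul]; abel
  simp only [h2, h3, zero_smul, add_zero] at h1
  exact h1

theorem eval_dirD_dirD (g : MvPolynomial (Fin n) ℝ) (z v w : Fin n → ℝ) :
    eval z (dirD v (dirD w g)) = v ⬝ᵥ hessian g z *ᵥ w := by
  rw [eval_dirD, dotProduct_mulVec_eq_sum]
  refine Finset.sum_congr rfl fun i _ => ?_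
  rw [pderiv_dirD_comm, eval_dirD, Finset.mul_sum]
  refine Finset.sum_congr rfl fun j _ => ?_
  rw [hessian_apply, pderiv_pderiv_comm]; ring

theorem hessian_mulVec_self {d : ℕ} {g : MvPolynomial (Fin n) ℝ} (hg : g.IsHomogeneous (d + 1))
    (z v : Fin n → ℝ) : v ⬝ᵥ hessian g z *ᵥ z = d * eval z (dirD v g) := by
  rw [eval_dirD, dotProduct, Finset.mul_sum]
  refine Finset.sum_congr rfl fun i _ => ?_
  have h1 := sum_mul_eval_pderiv (hg.pderiv (i := i)) z
  rw [Nat.add_sub_cancel] at h1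
  rw [mul_left_comm, ← h1]
  congr 1
  simp only [mulVec, dotProduct, hessian_apply]
  exact Finset.sum_congr rfl fun j _ => by rw [pderiv_pderiv_comm, mul_comm]

theorem quadForm_hessian_self {d : ℕ} {g : MvPolynomial (Fin n) ℝ} (hg : g.IsHomogeneous (d + 1))
    (z : Fin n → ℝ) : z ⬝ᵥ hessian g z *ᵥ z = d * ((d + 1) * eval z g) := by
  rw [hessian_mulVec_self hg, eval_dirD, sum_mul_eval_pderiv hg, Nat.cast_add, Nat.cast_one]

/-- With Euler's identity, the reverse Cauchy–Schwarz inequality at `z` for a form `g` of degree `m`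
reads `m (m - 1) g(z) D²g(z) ≤ (m - 1)² (Dg(z))²`, which is stronger than log-concavity. -/
theorem IsLorentzian.isCompletelyLogConcave {d : ℕ} {f : MvPolynomial (Fin n) ℝ}
    (hf : IsNonnegForm d f) (h : IsLorentzian d f) : IsCompletelyLogConcave f := by
  rw [isCompletelyLogConcave_iff]
  intro l hl
  have hg := hf.dirDs hl
  refine hg.isLogConcave fun z v hz => ?_
  by_cases hld : l.length + 2 ≤ d
  · have h1 := h.mul_le_sq hf hl hld hz v
    obtain ⟨e, he⟩ : ∃ e, d - l.length = e + 1 + 1 := ⟨d - l.length - 2, by omega⟩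
    rw [he] at hg
    rw [quadForm_hessian_self hg.hom, hessian_mulVec_self hg.hom] at h1
    rw [eval_dirD_dirD]
    set a := v ⬝ᵥ hessian (CLC.dirDs l f) z *ᵥ v
    set b := eval z (CLC.dirDs l f) with hb
    set c := eval z (CLC.dirD v (CLC.dirDs l f))
    push_cast at h1
    have he0 : (0 : ℝ) ≤ e := Nat.cast_nonneg e
    have hb0 : 0 ≤ b := hg.eval_nonneg fun i => (hz i).le
    by_cases ha : a ≤ 0
    · nlinarith [mul_nonneg (neg_nonneg.2 ha) hb0, sq_nonneg c]
    · push Not at ha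
      have h2 : ((e : ℝ) + 1) * ((e + 2) * (a * b)) ≤ (e + 1) * ((e + 1) * c ^ 2) := by
        nlinarith
      have h3 := le_of_mul_le_mul_left h2 (by positivity)
      have h4 : ((e : ℝ) + 1) * (a * b) ≤ (e + 1) * c ^ 2 := by nlinarith [mul_nonneg ha.le hb0]
      exact le_of_mul_le_mul_left h4 (by positivity)
  · have h0 : CLC.dirD v (CLC.dirD v (CLC.dirDs l f)) = 0 := by
      have h1 : ∀ i, (MvPolynomial.pderiv i (CLC.dirDs l f)).IsHomogeneous 0 := fun i => by
        have := (hg.pderiv i).hom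
        rwa [show d - l.length - 1 = 0 by omega] at this
      rw [dirD_apply v (CLC.dirD v _)]
      refine Finset.sum_eq_zero fun i _ => ?_
      rw [pderiv_dirD_comm, dirD_apply, Finset.sum_eq_zero, smul_zero]
      intro j _
      rw [pderiv_eq_zero_of_isHomogeneous_zero (h1 i), smul_zero]
    rw [h0, map_zero, zero_mul]
    positivity

/-- For a direction `x` that is orthogonal to the gradient of the quadratic form `q` at the all-ones
vector `1`, concavity of `log q` between `1 - tx` and `1 + tx` forces the second derivative in
direction `x` to be nonpositive. -/
theorem IsLogConcave.atMostOnePos_hessian {q : MvPolynomial (Fin n) ℝ} (hq : IsNonnegForm 2 q)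
    (h : IsLogConcave q) : AtMostOnePos (hessian q 0) := by
  set H := hessian q 0 with hH
  have hHs : H.IsSymm := hessian_isSymm q 0
  have hval : ∀ z, z ⬝ᵥ H *ᵥ z = 2 * eval z q := fun z => by
    rw [hH, hessian_eq_of_isHomogeneous_two hq.hom 0 z, quadForm_hessian_self hq.hom]
    norm_num
  refine ⟨H *ᵥ 1, fun x hx => ?_⟩
  by_contra! hxx
  have hq0 : q ≠ 0 := by
    rintro rfl
    have := hval x
    simp only [map_zero, mul_zero] at this
    exact hxx.ne' this
  have hpos : ∀ z ∈ posOrthant n, 0 < eval z q := fun z hz =>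
    (hq.eval_nonneg fun i => (hz i).le).lt_of_ne' fun h0 => hq0 ((hq.eval_eq_zero_iff hz).1 h0)
  set t : ℝ := (1 + ∑ i, |x i|)⁻¹ with ht
  have hs : 0 ≤ ∑ i, |x i| := Finset.sum_nonneg fun i _ => abs_nonneg _
  have ht0 : 0 < t := by positivity
  have hti : ∀ i, |t * x i| < 1 := fun i => by
    rw [abs_mul, abs_of_pos ht0, ht, inv_mul_lt_iff₀ (by positivity)]
    have := Finset.single_le_sum (fun i _ => abs_nonneg (x i)) (Finset.mem_univ i)
    linarith
  have hmem : ∀ s : ℝ, s = t ∨ s = -t → (1 : ℝ) • (1 : Fin n → ℝ) + s • x ∈ posOrthant n := by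
    intro s hs i
    have h1 := abs_lt.1 (hti i)
    simp only [Pi.add_apply, Pi.smul_apply, Pi.one_apply, smul_eq_mul, mul_one]
    rcases hs with rfl | rfl
    · linarith
    · linarith
  have hone : (1 : Fin n → ℝ) ∈ posOrthant n := fun i => zero_lt_one
  have hev : ∀ s : ℝ, s ^ 2 = t ^ 2 → eval ((1 : ℝ) • (1 : Fin n → ℝ) + s • x) q =
      eval 1 q + t ^ 2 * (x ⬝ᵥ H *ᵥ x) / 2 := fun s hs => by
    have h1 := hval ((1 : ℝ) • (1 : Fin n → ℝ) + s • x)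
    rw [quadForm_add_smul hHs, hval 1, dotProduct_mulVec_symm hHs 1 x, dotProduct_comm x,
      hx, hs] at h1
    linarith
  have hcv : ConcaveOn ℝ {x | x ∈ posOrthant n ∧ 0 < eval x q} fun x => Real.log (eval x q) := h.2
  have hmem' : ∀ s : ℝ, s = t ∨ s = -t → (1 : ℝ) • (1 : Fin n → ℝ) + s • x ∈
      {x | x ∈ posOrthant n ∧ 0 < eval x q} := fun s hs => ⟨hmem s hs, hpos _ (hmem s hs)⟩
  have hc := hcv.2 (hmem' t (Or.inl rfl)) (hmem' (-t) (Or.inr rfl))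
    (show (0 : ℝ) ≤ 1 / 2 by norm_num) (show (0 : ℝ) ≤ 1 / 2 by norm_num) (by norm_num)
  have hmid : (1 / 2 : ℝ) • ((1 : ℝ) • (1 : Fin n → ℝ) + t • x) +
      (1 / 2 : ℝ) • ((1 : ℝ) • (1 : Fin n → ℝ) + (-t) • x) = 1 := by
    ext i
    simp only [Pi.add_apply, Pi.smul_apply, Pi.one_apply, smul_eq_mul]
    ring
  rw [hmid] at hc
  dsimp only at hc
  rw [hev t rfl, hev (-t) (by ring), ← add_smul] at hc
  norm_num at hc
  have hp1 := hpos 1 hone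
  have hp2 : 0 < t ^ 2 * (x ⬝ᵥ H *ᵥ x) / 2 := by positivity
  have := (Real.log_le_log_iff (by linarith) hp1).1 hc
  linarith

end CLC

/-! ### Completely log-concave forms, Lorentzian forms and contractions -/

namespace CLC

open Matrix

variable {n : ℕ}

/-- The directions `1, …, 1, e_{i₁}, …, e_{iₘ}`, with `k` copies of the all-ones vector. -/
def onesThenUnits (k : ℕ) (L : List (Fin n)) : List (Fin n → ℝ) :=
  List.replicate k 1 ++ L.map fun i => Pi.single i 1

theorem length_onesThenUnits (k : ℕ) (L : List (Fin n)) :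
    (onesThenUnits k L).length = k + L.length := by
  simp [onesThenUnits]

theorem onesThenUnits_nonneg (k : ℕ) (L : List (Fin n)) :
    ∀ v ∈ onesThenUnits k L, ∀ i, 0 ≤ v i := by
  intro v hv i
  rcases List.mem_append.1 hv with h | h
  · rw [List.eq_of_mem_replicate h]; exact zero_le_one
  · obtain ⟨j, _, rfl⟩ := List.mem_map.1 h
    by_cases hij : i = j
    · subst hij; simp
    · simp [hij]

/-- Every quadratic form `∂_{i₁} ⋯ ∂_{iₘ} D_1^{d-2-m} f` has at most one positive eigenvalue. Only
finitely many matrices are involved, one for each word of length at most `d - 2`. -/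
def HasLorentzianContractions (d : ℕ) (f : MvPolynomial (Fin n) ℝ) : Prop :=
  ∀ L : List (Fin n), L.length + 2 ≤ d →
    AtMostOnePos (hessian (dirDs (onesThenUnits (d - 2 - L.length) L) f) 0)

theorem IsCompletelyLogConcave.hasLorentzianContractions {d : ℕ} {f : MvPolynomial (Fin n) ℝ}
    (hf : IsNonnegForm d f) (h : IsCompletelyLogConcave f) : HasLorentzianContractions d f := by
  intro L hL
  rw [isCompletelyLogConcave_iff] at h
  have hnn := onesThenUnits_nonneg (d - 2 - L.length) L
  have h1 := hf.dirDs hnn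
  rw [length_onesThenUnits, show d - (d - 2 - L.length + L.length) = 2 by omega] at h1
  exact (h _ hnn).atMostOnePos_hessian h1

theorem pderiv_dirDs_comm (i : Fin n) (l : List (Fin n → ℝ)) (f : MvPolynomial (Fin n) ℝ) :
    pderiv i (dirDs l f) = dirDs l (pderiv i f) := by
  induction l with
  | nil => rfl
  | cons v l ih => rw [dirDs_cons, dirDs_cons, pderiv_dirD_comm, ih]

theorem IsNonnegForm.dirDs_eq_zero {d : ℕ} {f : MvPolynomial (Fin n) ℝ} (hf : IsNonnegForm d f)
    {l : List (Fin n → ℝ)} (hl : ∀ v ∈ l, ∀ i, 0 < v i) (hld : l.length ≤ d)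
    (h : CLC.dirDs l f = 0) : f = 0 := by
  induction l with
  | nil => exact h
  | cons v l ih =>
    rw [List.length_cons] at hld
    have h1 := hf.dirDs (l := l) fun w hw i => (hl w (List.mem_cons_of_mem _ hw) i).le
    obtain ⟨e, he⟩ : ∃ e, d - l.length = e + 1 := ⟨d - l.length - 1, by omega⟩
    rw [he] at h1
    rw [dirDs_cons] at h
    exact ih (fun w hw => hl w (List.mem_cons_of_mem _ hw)) (by omega)
      (h1.dirD_eq_zero (hl v List.mem_cons_self) h)

/-- Contracting with the positive all-ones vector creates no zeros, so the connectivity of the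
variables of `f` can be read off from the Hessian of `D_1^{d-2} f`. -/
theorem HasLorentzianContractions.isLorentzian {d : ℕ} {f : MvPolynomial (Fin n) ℝ}
    (hf : IsNonnegForm d f) (h : HasLorentzianContractions d f) : IsLorentzian d f := by
  induction d generalizing f with
  | zero => trivial
  | succ d ih =>
    match d with
    | 0 => trivial
    | 1 => exact h [] le_rfl
    | d + 2 =>
      refine ⟨?_, fun i => ih (hf.pderiv i) fun L hL => ?_⟩
      · have h1 := h [] (by simp)
        set l : List (Fin n → ℝ) := onesThenUnits (d + 2 + 1 - 2 - ([] : List (Fin n)).length) []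
          with hl
        have hlen : l.length = d + 1 := by rw [hl, length_onesThenUnits]; simp
        have hg := hf.dirDs (l := l) (onesThenUnits_nonneg _ _)
        have hgs := h1.connectedPattern (hessian_isSymm _ _)
          (hg.hessian_nonneg (z := 0) fun _ => le_rfl)
        have hzero : ∀ i j, hessian (CLC.dirDs l f) 0 i j = 0 ↔
            MvPolynomial.pderiv i (MvPolynomial.pderiv j f) = 0 := fun i j => by
          have h2 : IsNonnegForm 2 (CLC.dirDs l f) := by
            rwa [hlen, show d + 2 + 1 - (d + 1) = 2 by omega] at hg
          rw [hessian_eq_of_isHomogeneous_two h2.hom 0 1,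
            h2.hessian_eq_zero_iff (z := 1) fun _ => zero_lt_one, pderiv_dirDs_comm,
            pderiv_dirDs_comm]
          refine ⟨fun h0 => ?_, fun h0 => by rw [h0, map_zero]⟩
          refine ((hf.pderiv j).pderiv i).dirDs_eq_zero (l := l) ?_ (by omega) h0
          intro v hv i
          rw [hl, onesThenUnits, List.map_nil, List.append_nil] at hv
          rw [List.eq_of_mem_replicate hv]
          exact zero_lt_one
        simpa only [HasConnectedVars, hzero] using hgs
      · have h1 := h (L ++ [i]) (by simpa using hL)
        have h2 : dirDs (onesThenUnits (d + 2 + 1 - 2 - (L ++ [i]).length) (L ++ [i])) f =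
            dirDs (onesThenUnits (d + 2 - 2 - L.length) L) (MvPolynomial.pderiv i f) := by
          rw [onesThenUnits, onesThenUnits, List.map_append, ← List.append_assoc, dirDs_append]
          congr 1
          · rw [List.length_append, List.length_singleton,
              show d + 2 + 1 - 2 - (L.length + 1) = d + 2 - 2 - L.length by omega]
          · rw [List.map_singleton, dirDs_cons, dirDs_nil, dirD_single]
        rwa [h2] at h1

theorem isCompletelyLogConcave_iff_isLorentzian {d : ℕ} {f : MvPolynomial (Fin n) ℝ}
    (hf : IsNonnegForm d f) : IsCompletelyLogConcave f ↔ IsLorentzian d f :=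
  ⟨fun h => (h.hasLorentzianContractions hf).isLorentzian hf, fun h => h.isCompletelyLogConcave hf⟩

theorem isCompletelyLogConcave_iff_hasLorentzianContractions {d : ℕ}
    {f : MvPolynomial (Fin n) ℝ} (hf : IsNonnegForm d f) :
    IsCompletelyLogConcave f ↔ HasLorentzianContractions d f :=
  ⟨fun h => h.hasLorentzianContractions hf, fun h => (h.isLorentzian hf).isCompletelyLogConcave hf⟩

/-! ### Connected variables and indecomposability -/

theorem totalDegree_eq_zero_of_pderiv_eq_zero {f : MvPolynomial (Fin n) ℝ}
    (h : ∀ i, pderiv i f = 0) : f.totalDegree = 0 := by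
  rw [totalDegree_eq_zero_iff]
  intro m hm i
  by_contra hi
  have h1 := congrArg (coeff (m - Finsupp.single i 1)) (h i)
  rw [coeff_pderiv, coeff_zero, tsub_add_cancel_of_le (by
    rw [Finsupp.single_le_iff]; omega), mul_eq_zero] at h1
  rcases h1 with h1 | h1
  · exact (mem_support_iff.1 hm) h1
  · have : (0 : ℝ) < (((m - Finsupp.single i 1 : Fin n →₀ ℕ) i : ℕ) : ℝ) + 1 := by positivity
    exact this.ne' h1

theorem pderiv_eq_zero_of_totalDegree_eq_zero {f : MvPolynomial (Fin n) ℝ}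
    (h : f.totalDegree = 0) (i : Fin n) : pderiv i f = 0 := by
  rw [totalDegree_eq_zero_iff_eq_C] at h
  rw [h]; simp

/-- Applied to the variables of the first summand, connectivity shows that one of the summands has
vanishing derivatives. Degree at least two is needed to exclude sums of linear forms. -/
theorem HasConnectedVars.isIndecomposable {d : ℕ} {f : MvPolynomial (Fin n) ℝ}
    (hf : f.IsHomogeneous (d + 2)) (h : HasConnectedVars f) : IsIndecomposable f := by
  rintro ⟨g₁, g₂, rfl, hdisj, hg₁, hg₂⟩
  have hz₁ : ∀ i, i ∉ g₁.vars → pderiv i g₁ = 0 := fun i => pderiv_eq_zero_of_notMem_vars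
  have hz₂ : ∀ i, i ∈ g₁.vars → pderiv i g₂ = 0 := fun i hi =>
    pderiv_eq_zero_of_notMem_vars (Finset.disjoint_left.1 hdisj hi)
  have hfirst : ∀ i, (∀ j, pderiv i (pderiv j (g₁ + g₂)) = 0) → pderiv i (g₁ + g₂) = 0 :=
    fun i hi => eq_zero_of_pderiv_eq_zero (d := d) hf.pderiv fun j => by
      rw [pderiv_pderiv_comm]; exact hi j
  rcases h ↑g₁.vars (fun i hi j hj => by
    change pderiv i (pderiv j (g₁ + g₂)) = 0
    rw [map_add, hz₁ j hj, zero_add, pderiv_pderiv_comm, hz₂ i hi, map_zero]) with h1 | h1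
  · refine hg₁ (totalDegree_eq_zero_of_pderiv_eq_zero fun i => ?_)
    by_cases hi : i ∈ g₁.vars
    · have := hfirst i (h1 i hi)
      rwa [map_add, hz₂ i hi, add_zero] at this
    · exact hz₁ i hi
  · refine hg₂ (totalDegree_eq_zero_of_pderiv_eq_zero fun i => ?_)
    by_cases hi : i ∈ g₁.vars
    · exact hz₂ i hi
    · have := hfirst i (h1 i hi)
      rwa [map_add, hz₁ i hi, zero_add] at this

/-- If `S` is not joined to its complement, every monomial of `f` lies in the variables in `S` or in
those outside `S`, and `f` splits accordingly. -/
theorem IsIndecomposable.hasConnectedVars {f : MvPolynomial (Fin n) ℝ}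
    (h : IsIndecomposable f) : HasConnectedVars f := by
  classical
  intro S hS
  set p : (Fin n →₀ ℕ) → Prop := fun m => ∀ i ∈ m.support, i ∈ S with hp
  set g₁ := ∑ m ∈ f.support.filter p, monomial m (coeff m f) with hg₁
  set g₂ := ∑ m ∈ f.support.filter (fun m => ¬ p m), monomial m (coeff m f) with hg₂
  have hsum : f = g₁ + g₂ := by
    rw [hg₁, hg₂, Finset.sum_filter_add_sum_filter_not]
    exact f.as_sum
  have hv : ∀ (q : (Fin n →₀ ℕ) → Prop) [DecidablePred q] (i : Fin n),
      i ∈ (∑ m ∈ f.support.filter q, monomial m (coeff m f)).vars →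
        ∃ m, coeff m f ≠ 0 ∧ q m ∧ m i ≠ 0 := fun q _ i hi => by
    have h1 := vars_sum_subset _ _ hi
    obtain ⟨m, hm, hi'⟩ := Finset.mem_biUnion.1 h1
    rw [Finset.mem_filter, mem_support_iff] at hm
    rw [vars_monomial hm.1] at hi'
    exact ⟨m, hm.1, hm.2, Finsupp.mem_support_iff.1 hi'⟩
  have hv₁ : ∀ i ∈ g₁.vars, i ∈ S := fun i hi => by
    obtain ⟨m, _, hm, hmi⟩ := hv p i hi
    exact hm i (Finsupp.mem_support_iff.2 hmi)
  have hv₂ : ∀ i ∈ g₂.vars, i ∉ S := fun i hi hiS => by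
    obtain ⟨m, hmf, hm, hmi⟩ := hv (fun m => ¬ p m) i hi
    simp only [hp, not_forall] at hm
    obtain ⟨j, hj, hjS⟩ := hm
    have hij : i ≠ j := fun hij => hjS (hij ▸ hiS)
    have h1 := congrArg (coeff (m - Finsupp.single i 1 - Finsupp.single j 1)) (hS i hiS j hjS)
    have hle : Finsupp.single i 1 ≤ m := Finsupp.single_le_iff.2 (Nat.one_le_iff_ne_zero.2 hmi)
    have hle' : Finsupp.single j 1 ≤ m - Finsupp.single i 1 := by
      rw [Finsupp.single_le_iff, Finsupp.tsub_apply, Finsupp.single_eq_of_ne hij.symm]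
      exact Nat.one_le_iff_ne_zero.2 (Finsupp.mem_support_iff.1 hj)
    rw [pderiv_pderiv_comm, coeff_pderiv, coeff_pderiv, tsub_add_cancel_of_le hle',
      tsub_add_cancel_of_le hle, coeff_zero] at h1
    have h2 : ∀ k : ℕ, (k : ℝ) + 1 ≠ 0 := fun k => by positivity
    exact hmf (by simpa [h2] using h1)
  have hdisj : Disjoint g₁.vars g₂.vars :=
    Finset.disjoint_left.2 fun i h1 h2 => hv₂ i h2 (hv₁ i h1)
  have hd : g₁.totalDegree = 0 ∨ g₂.totalDegree = 0 := by
    by_contra! hne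
    exact h ⟨g₁, g₂, hsum, hdisj, hne.1, hne.2⟩
  rcases hd with h1 | h1
  · left
    intro i hi j
    rw [pderiv_pderiv_comm, hsum, map_add, pderiv_eq_zero_of_totalDegree_eq_zero h1,
      pderiv_eq_zero_of_notMem_vars fun h2 => hv₂ i h2 hi, add_zero, map_zero]
  · right
    intro i hi j
    rw [pderiv_pderiv_comm, hsum, map_add, pderiv_eq_zero_of_totalDegree_eq_zero h1,
      pderiv_eq_zero_of_notMem_vars fun h2 => hi (hv₁ i h2), add_zero, map_zero]

/-! ### The characterization by partial derivatives -/

theorem prod_ofFn_update_mul {M : Type*} [Monoid M] {n : ℕ} (g : Fin n → M) (a : M) (i : Fin n)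
    (h : ∀ j, Commute a (g j)) :
    (List.ofFn (Function.update g i (a * g i))).prod = a * (List.ofFn g).prod := by
  induction n with
  | zero => exact i.elim0
  | succ n ih =>
    rw [List.ofFn_succ, List.ofFn_succ, List.prod_cons, List.prod_cons]
    cases i using Fin.cases with
    | zero => simp [Fin.succ_ne_zero, mul_assoc]
    | succ i =>
      have h1 : (fun j : Fin n => Function.update g i.succ (a * g i.succ) j.succ) =
          Function.update (fun j : Fin n => g j.succ) i (a * g i.succ) := by
        ext j
        simp only [Function.update_apply, Fin.succ_inj]
      rw [h1, ih (fun j => g j.succ) i fun j => h j.succ,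
        Function.update_of_ne (Fin.succ_ne_zero i).symm, ← mul_assoc, ← (h 0).eq, mul_assoc]

theorem commute_pderiv (i j : Fin n) :
    Commute ((pderiv i).toLinearMap : Module.End ℝ (MvPolynomial (Fin n) ℝ))
      (pderiv j).toLinearMap :=
  LinearMap.ext fun f => pderiv_pderiv_comm i j f

theorem partialDeriv_zero (f : MvPolynomial (Fin n) ℝ) : partialDeriv 0 f = f := by
  have h1 : ∀ k : ℕ, (List.replicate k (1 : Module.End ℝ (MvPolynomial (Fin n) ℝ))).prod = 1 :=
    fun k => by simp
  simp [partialDeriv, List.ofFn_const, h1]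

theorem partialDeriv_add_single (α : Fin n → ℕ) (i : Fin n) (f : MvPolynomial (Fin n) ℝ) :
    partialDeriv (α + Pi.single i 1) f = pderiv i (partialDeriv α f) := by
  have h1 : (fun j : Fin n => ((pderiv j).toLinearMap :
      Module.End ℝ (MvPolynomial (Fin n) ℝ)) ^ (α + Pi.single i 1 : Fin n → ℕ) j) =
      Function.update (fun j => (pderiv j).toLinearMap ^ α j) i
        ((pderiv i).toLinearMap * (pderiv i).toLinearMap ^ α i) := by
    ext1 j
    rcases eq_or_ne j i with rfl | hj
    · simp [pow_succ']
    · simp [hj]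
  rw [partialDeriv, h1, prod_ofFn_update_mul (fun j => ((pderiv j).toLinearMap :
      Module.End ℝ (MvPolynomial (Fin n) ℝ)) ^ α j) _ i fun j => (commute_pderiv i j).pow_right _]
  rfl

theorem partialDeriv_pderiv (α : Fin n → ℕ) (i : Fin n) (f : MvPolynomial (Fin n) ℝ) :
    partialDeriv α (pderiv i f) = pderiv i (partialDeriv α f) := by
  have h1 : Commute ((pderiv i).toLinearMap : Module.End ℝ (MvPolynomial (Fin n) ℝ))
      (List.ofFn fun j : Fin n =>
        ((pderiv j).toLinearMap : Module.End ℝ (MvPolynomial (Fin n) ℝ)) ^ α j).prod := by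
    refine Commute.list_prod_right _ _ fun x hx => ?_
    obtain ⟨j, rfl⟩ := (List.mem_ofFn' _ _).1 hx
    exact (commute_pderiv i j).pow_right _
  exact (LinearMap.congr_fun h1.eq f).symm

theorem exists_eq_add_single {α : Fin n → ℕ} {k : ℕ} (h : ∑ i, α i = k + 1) :
    ∃ (β : Fin n → ℕ) (i : Fin n), α = β + Pi.single i 1 ∧ ∑ j, β j = k := by
  obtain ⟨i, hi⟩ : ∃ i, α i ≠ 0 := by
    by_contra! h0
    simp [h0] at h
  have h1 : α = Function.update α i (α i - 1) + Pi.single i 1 := by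
    ext j
    rcases eq_or_ne j i with rfl | hj
    · simp; omega
    · simp [hj]
  refine ⟨_, i, h1, ?_⟩
  rw [h1] at h
  simp only [Pi.add_apply, Finset.sum_add_distrib, Finset.sum_pi_single', Finset.mem_univ,
    if_true] at h
  omega

theorem IsLorentzian.pderiv {d : ℕ} {f : MvPolynomial (Fin n) ℝ} (h : IsLorentzian (d + 1) f)
    (i : Fin n) : IsLorentzian d (pderiv i f) :=
  match d, h with
  | 0, _ => trivial
  | 1, _ => trivial
  | _ + 2, h => h.2 i

theorem IsLorentzian.partialDeriv {d : ℕ} {f : MvPolynomial (Fin n) ℝ} {α : Fin n → ℕ} {k : ℕ}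
    (hα : ∑ i, α i = k) (hf : IsNonnegForm (d + k) f) (h : IsLorentzian (d + k) f) :
    IsNonnegForm d (partialDeriv α f) ∧ IsLorentzian d (partialDeriv α f) := by
  induction k generalizing α d with
  | zero =>
    have : α = 0 := by
      ext i; exact (Finset.sum_eq_zero_iff.1 hα) i (Finset.mem_univ i)
    subst this
    rw [partialDeriv_zero]
    exact ⟨hf, h⟩
  | succ k ih =>
    obtain ⟨β, i, rfl, hβ⟩ := exists_eq_add_single hα
    have e : d + (k + 1) = d + 1 + k := by ring
    rw [e] at hf h
    obtain ⟨h1, h2⟩ := ih hβ hf h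
    rw [partialDeriv_add_single]
    exact ⟨h1.pderiv i, h2.pderiv i⟩

theorem IsNonnegForm.numPosEigenvalues_hessian_eq_one_iff {q : MvPolynomial (Fin n) ℝ}
    (hq : IsNonnegForm 2 q) (hq0 : q ≠ 0) (z : Fin n → ℝ) :
    numPosEigenvalues (hessian q z) = 1 ↔ AtMostOnePos (hessian q 0) := by
  rw [hessian_eq_of_isHomogeneous_two hq.hom z 0]
  refine numPosEigenvalues_eq_one_iff (hessian_isSymm q 0)
    (hq.hessian_nonneg fun _ => le_rfl) fun h0 => hq0 ?_
  refine eq_zero_of_pderiv_eq_zero (d := 1) hq.hom fun j => ?_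
  refine eq_zero_of_pderiv_eq_zero (d := 0) hq.hom.pderiv fun i => ?_
  rw [← hq.hessian_eq_zero_iff (z := 1) fun _ => zero_lt_one,
    hessian_eq_of_isHomogeneous_two hq.hom 1 0, h0]
  rfl

theorem isLorentzian_iff_partialDeriv {d : ℕ} {f : MvPolynomial (Fin n) ℝ}
    (hf : IsNonnegForm d f) : IsLorentzian d f ↔
      (∀ α : Fin n → ℕ, ∑ i, α i + 2 ≤ d → IsIndecomposable (CLC.partialDeriv α f)) ∧
      (∀ α : Fin n → ℕ, ∑ i, α i + 2 = d → CLC.partialDeriv α f ≠ 0 →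
        ∀ z : Fin n → ℝ, numPosEigenvalues (hessian (CLC.partialDeriv α f) z) = 1) := by
  constructor
  · intro h
    refine ⟨fun α hα => ?_, fun α hα hne z => ?_⟩
    · obtain ⟨e, rfl⟩ : ∃ e, d = e + 2 + ∑ i, α i := ⟨d - 2 - ∑ i, α i, by omega⟩
      obtain ⟨h1, h2⟩ := h.partialDeriv rfl hf
      exact (h2.hasConnectedVars h1).isIndecomposable h1.hom
    · obtain rfl : d = 2 + ∑ i, α i := by omega
      obtain ⟨h1, h2⟩ := h.partialDeriv rfl hf
      exact (h1.numPosEigenvalues_hessian_eq_one_iff hne z).2 h2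
  · intro h
    induction d generalizing f with
    | zero => trivial
    | succ d ih =>
      match d with
      | 0 => trivial
      | 1 =>
        change AtMostOnePos _
        by_cases hne : f = 0
        · subst hne
          refine ⟨0, fun u _ => ?_⟩
          rw [dotProduct_mulVec_eq_sum]
          simp [hessian_apply]
        · have h1 := h.2 0 (by simp) (by rwa [partialDeriv_zero]) 0
          rw [partialDeriv_zero] at h1
          exact (hf.numPosEigenvalues_hessian_eq_one_iff hne 0).1 h1
      | d + 2 =>
        refine ⟨?_, fun i => ih (hf.pderiv i) ⟨fun α hα => ?_, fun α hα hne z => ?_⟩⟩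
        · have h1 := h.1 0 (by simp)
          rw [partialDeriv_zero] at h1
          exact h1.hasConnectedVars
        · rw [partialDeriv_pderiv, ← partialDeriv_add_single]
          refine h.1 _ ?_
          simp only [Pi.add_apply, Finset.sum_add_distrib, Finset.sum_pi_single', Finset.mem_univ,
            if_true]
          omega
        · rw [partialDeriv_pderiv, ← partialDeriv_add_single] at hne ⊢
          refine h.2 _ ?_ hne z
          simp only [Pi.add_apply, Finset.sum_add_distrib, Finset.sum_pi_single', Finset.mem_univ,
            if_true]
          omega

end CLC

/-! ### Reasoning about programs -/

namespace RealRAM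

/-- Started in `s`, the program `p` halts within `T` time units in a state satisfying `Q`. -/
def Runs (p : Program) (s : State) (T : ℕ) (Q : State → Prop) : Prop :=
  ∃ (s' : State) (t : ℕ), Exec p s s' t ∧ t ≤ T ∧ Q s'

/-- The instruction does not write to natural register `r`. -/
def Instr.keepsNat (r : ℕ) : Instr → Bool
  | .natConst a _ => r != a
  | .natAdd a _ _ => r != a
  | .natSub a _ _ => r != a
  | .natLoad a _ => r != a
  | _ => true

/-- The instruction does not write to real register `r`. -/
def Instr.keepsReal (r : ℕ) : Instr → Bool
  | .realConst a _ => r != a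
  | .realAdd a _ _ => r != a
  | .realSub a _ _ => r != a
  | .realMul a _ _ => r != a
  | .realDiv a _ _ => r != a
  | .realLoad a _ => r != a
  | _ => true

/-- The instruction does not write to the real memory. -/
def Instr.keepsMem : Instr → Bool
  | .realStore _ _ => false
  | _ => true

/-- The instruction is not a division. -/
def Instr.noDiv : Instr → Bool
  | .realDiv _ _ _ => false
  | _ => true

/-- All instructions of the program have property `P`. -/
def Program.all (P : Instr → Bool) : Program → Bool
  | .skip => true
  | .instr i => P i
  | .seq p q => p.all P && q.all P
  | .cond _ p q => p.all P && q.all P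
  | .loop _ p => p.all P

/-- `s'` agrees with `s` wherever the program `p` does not write. -/
structure Frame (p : Program) (s s' : State) : Prop where
  keepsNat : ∀ r, p.all (Instr.keepsNat r) = true → s'.natReg r = s.natReg r
  keepsReal : ∀ r, p.all (Instr.keepsReal r) = true → s'.realReg r = s.realReg r
  keepsMem : p.all Instr.keepsMem = true → s'.realMem = s.realMem

theorem Frame.nat {p : Program} {s s' : State} (hF : Frame p s s') (r : ℕ)
    (h : p.all (Instr.keepsNat r) = true := by rfl) : s'.natReg r = s.natReg r := hF.keepsNat r h

theorem Frame.real {p : Program} {s s' : State} (hF : Frame p s s') (r : ℕ)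
    (h : p.all (Instr.keepsReal r) = true := by rfl) : s'.realReg r = s.realReg r :=
  hF.keepsReal r h

theorem Frame.mem {p : Program} {s s' : State} (hF : Frame p s s')
    (h : p.all Instr.keepsMem = true := by rfl) : s'.realMem = s.realMem := hF.keepsMem h

theorem Frame.refl (p : Program) (s : State) : Frame p s s :=
  ⟨fun _ _ => rfl, fun _ _ => rfl, fun _ => rfl⟩

theorem Frame.trans {p : Program} {s s' s'' : State} (h : Frame p s s') (h' : Frame p s' s'') :
    Frame p s s'' :=
  ⟨fun r hr => (h'.nat r hr).trans (h.nat r hr), fun r hr => (h'.real r hr).trans (h.real r hr),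
    fun hm => (h'.mem hm).trans (h.mem hm)⟩

theorem Frame.instr (i : Instr) (s : State) : Frame (.instr i) s (i.run s) := by
  refine ⟨fun r hr => ?_, fun r hr => ?_, fun hm => ?_⟩ <;>
  cases i <;> simp_all [Instr.run, Program.all, Instr.keepsNat, Instr.keepsReal, Instr.keepsMem]

theorem Exec.frame {p : Program} {s s' : State} {t : ℕ} (h : Exec p s s' t) : Frame p s s' := by
  induction h with
  | skip s => exact Frame.refl _ s
  | instr _ => exact Frame.instr _ _
  | seq _ _ ih ih' =>
    exact ⟨fun r hr => (ih'.nat r (Bool.and_eq_true_iff.1 hr).2).trans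
        (ih.nat r (Bool.and_eq_true_iff.1 hr).1),
      fun r hr => (ih'.real r (Bool.and_eq_true_iff.1 hr).2).trans
        (ih.real r (Bool.and_eq_true_iff.1 hr).1),
      fun hm => (ih'.mem (Bool.and_eq_true_iff.1 hm).2).trans
        (ih.mem (Bool.and_eq_true_iff.1 hm).1)⟩
  | condTrue _ _ ih =>
    exact ⟨fun r hr => ih.nat r (Bool.and_eq_true_iff.1 hr).1,
      fun r hr => ih.real r (Bool.and_eq_true_iff.1 hr).1,
      fun hm => ih.mem (Bool.and_eq_true_iff.1 hm).1⟩
  | condFalse _ _ ih =>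
    exact ⟨fun r hr => ih.nat r (Bool.and_eq_true_iff.1 hr).2,
      fun r hr => ih.real r (Bool.and_eq_true_iff.1 hr).2,
      fun hm => ih.mem (Bool.and_eq_true_iff.1 hm).2⟩
  | loopEnd _ => exact Frame.refl _ _
  | loopStep _ _ _ ih ih' =>
    exact ⟨fun r hr => (ih'.nat r hr).trans (ih.nat r hr),
      fun r hr => (ih'.real r hr).trans (ih.real r hr), fun hm => (ih'.mem hm).trans (ih.mem hm)⟩

theorem Runs.mono {p : Program} {s : State} {T T' : ℕ} {Q Q' : State → Prop} (h : Runs p s T Q)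
    (hT : T ≤ T') (hQ : ∀ s', Q s' → Frame p s s' → Q' s') : Runs p s T' Q' := by
  obtain ⟨s', t, he, ht, hQs⟩ := h
  exact ⟨s', t, he, ht.trans hT, hQ s' hQs he.frame⟩

theorem Runs.seq {p q : Program} {s : State} {T T' : ℕ} {R Q : State → Prop} (h : Runs p s T R)
    (h' : ∀ s', R s' → Frame p s s' → Runs q s' T' Q) : Runs (.seq p q) s (T + T') Q := by
  obtain ⟨s', t, he, ht, hR⟩ := h
  obtain ⟨s'', t', he', ht', hQ⟩ := h' s' hR he.frame
  exact ⟨s'', t + t', .seq he he', add_le_add ht ht', hQ⟩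

theorem Runs.cond {c : Test} {p q : Program} {s : State} {T : ℕ} {Q : State → Prop}
    (h : c.Holds s → Runs p s T Q) (h' : ¬ c.Holds s → Runs q s T Q) :
    Runs (.cond c p q) s (T + 1) Q := by
  by_cases hc : c.Holds s
  · obtain ⟨s', t, he, ht, hQ⟩ := h hc
    exact ⟨s', t + 1, .condTrue hc he, Nat.succ_le_succ ht, hQ⟩
  · obtain ⟨s', t, he, ht, hQ⟩ := h' hc
    exact ⟨s', t + 1, .condFalse hc he, Nat.succ_le_succ ht, hQ⟩

/-- A loop with invariant `I` that makes `K` iterations of cost at most `B`. -/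
theorem Runs.loop {c : Test} {p : Program} {s : State} {K B : ℕ} (I : ℕ → State → Prop)
    (h0 : I 0 s)
    (hstep : ∀ k < K, ∀ s', I k s' → Frame p s s' → c.Holds s' ∧ Runs p s' B (I (k + 1)))
    (hend : ∀ s', I K s' → Frame p s s' → ¬ c.Holds s') :
    Runs (.loop c p) s (K * (B + 1) + 1) (I K) := by
  have key : ∀ m k, k + m = K → ∀ s', I k s' → Frame p s s' →
      Runs (.loop c p) s' (m * (B + 1) + 1) (I K) := by
    intro m
    induction m with
    | zero =>
      intro k hk s' hI hF
      rw [add_zero] at hk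
      subst hk
      exact ⟨s', 1, .loopEnd (hend s' hI hF), by simp, hI⟩
    | succ m ih =>
      intro k hk s' hI hF
      obtain ⟨hc, s₁, t₁, he₁, ht₁, hI₁⟩ := hstep k (by omega) s' hI hF
      obtain ⟨s₂, t₂, he₂, ht₂, hI₂⟩ := ih (k + 1) (by omega) s₁ hI₁ (hF.trans he₁.frame)
      refine ⟨s₂, t₁ + t₂ + 1, .loopStep hc he₁ he₂, ?_, hI₂⟩
      rw [add_mul, one_mul]
      omega
  exact key K 0 (zero_add K) s h0 (Frame.refl p s)

/-- Straight-line code. -/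
def straight (l : List Instr) : Program := l.foldr (fun i p => .seq (.instr i) p) .skip

/-- The effect of straight-line code. -/
noncomputable def runList (l : List Instr) (s : State) : State := l.foldl (fun s i => i.run s) s

theorem Runs.straight {l : List Instr} {s : State} {Q : State → Prop} (h : Q (runList l s))
    (hl : l.all Instr.noDiv = true := by rfl) : Runs (straight l) s l.length Q := by
  have key : ∀ (l : List Instr) (s : State), l.all Instr.noDiv = true →
      Exec (RealRAM.straight l) s (runList l s) l.length := by
    intro l
    induction l with
    | nil => exact fun s _ => .skip s
    | cons i l ih =>
      intro s hl
      have h1 : i.Allowed s := by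
        cases i <;> simp_all [Instr.noDiv, Instr.Allowed]
      have h2 := Exec.seq (Exec.instr h1) (ih (i.run s) (Bool.and_eq_true_iff.1 hl).2)
      rw [List.length_cons, add_comm]
      exact h2
  exact ⟨_, _, key l s hl, le_rfl, h⟩

/-! ### Rank-one updates of a matrix -/

/-- `dst[n i + j] := c * src[n i + j] + (e * vec[i]) * vec[j]` for all `i, j < n`. The addresses
`src`, `dst`, `vec` are in natural registers `30`, `31`, `32`, the scalars `c`, `e` in real
registers `10`, `11`; natural registers `1`, `2`, `3` hold `n`, `1`, `0`. -/
def rankOneProg : Program :=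
  .seq (straight [.natConst 33 0, .natAdd 34 32 3]) <|
  .loop (.natLt 33 1) <|
    .seq (straight [.realLoad 12 34, .realMul 12 11 12, .natConst 35 0, .natAdd 36 32 3]) <|
    .seq (.loop (.natLt 35 1) <| straight [.realLoad 13 30, .realMul 13 10 13, .realLoad 14 36,
      .realMul 14 12 14, .realAdd 13 13 14, .realStore 31 13, .natAdd 30 30 2, .natAdd 31 31 2,
      .natAdd 36 36 2, .natAdd 35 35 2]) <|
    straight [.natAdd 34 34 2, .natAdd 33 33 2]

/-- Natural registers `1`, `2`, `3` hold `n`, `1`, `0`. -/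
structure Consts (n : ℕ) (s : State) : Prop where
  r1 : s.natReg 1 = n
  r2 : s.natReg 2 = 1
  r3 : s.natReg 3 = 0

theorem Consts.of_frame {n : ℕ} {p : Program} {s s' : State} (h : Consts n s) (hF : Frame p s s')
    (h1 : p.all (Instr.keepsNat 1) = true := by rfl)
    (h2 : p.all (Instr.keepsNat 2) = true := by rfl)
    (h3 : p.all (Instr.keepsNat 3) = true := by rfl) : Consts n s' :=
  ⟨(hF.nat 1 h1).trans h.r1, (hF.nat 2 h2).trans h.r2, (hF.nat 3 h3).trans h.r3⟩

/-- Cost of a rank-one update. -/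
def rankOneTime (n : ℕ) : ℕ := 2 + (n * (4 + (n * 11 + 1 + 2) + 1) + 1)

theorem runs_rankOneProg {n : ℕ} {s : State} (hs : Consts n s) {src dst vec : ℕ}
    (h30 : s.natReg 30 = src) (h31 : s.natReg 31 = dst) (h32 : s.natReg 32 = vec)
    (hsrc : src + n * n ≤ dst) (hvec : vec + n ≤ dst) :
    Runs rankOneProg s (rankOneTime n) fun s' =>
      (∀ a < dst, s'.realMem a = s.realMem a) ∧
      ∀ a < n * n, s'.realMem (dst + a) = s.realReg 10 * s.realMem (src + a) +
        s.realReg 11 * s.realMem (vec + a / n) * s.realMem (vec + a % n) := by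
  set G : ℕ → ℝ := fun a => s.realReg 10 * s.realMem (src + a) +
        s.realReg 11 * s.realMem (vec + a / n) * s.realMem (vec + a % n) with hG
  refine Runs.seq (Runs.straight rfl) fun s₁ hs₁ hF₁ => ?_
  have hc₁ : Consts n s₁ := hs.of_frame hF₁
  let I : ℕ → State → Prop := fun i s' => s'.natReg 33 = i ∧ s'.natReg 34 = vec + i ∧
      s'.natReg 30 = src + n * i ∧ s'.natReg 31 = dst + n * i ∧
      (∀ a < dst, s'.realMem a = s.realMem a) ∧ ∀ a < n * i, s'.realMem (dst + a) = G a
  refine (Runs.loop (K := n) (B := 4 + (n * 11 + 1 + 2)) I ?_ ?_ ?_).mono le_rfl ?_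
  · subst hs₁
    simp [I, runList, Instr.run, h30, h31, h32, hs.r3]
  · rintro i hi s₂ ⟨h33, h34, h30', h31', hlo, hmem⟩ hF₂
    have hc₂ : Consts n s₂ := hc₁.of_frame hF₂
    have h32₂ : s₂.natReg 32 = vec := by
      rw [hF₂.nat 32, hF₁.nat 32, h32]
    have h10₂ : s₂.realReg 10 = s.realReg 10 := by
      rw [hF₂.real 10, hF₁.real 10]
    have h11₂ : s₂.realReg 11 = s.realReg 11 := by
      rw [hF₂.real 11, hF₁.real 11]
    refine ⟨by simpa [Test.Holds, h33, hc₂.r1] using hi, ?_⟩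
    refine Runs.seq (Runs.straight rfl) fun s₃ hs₃ hF₃ => ?_
    have hc₃ : Consts n s₃ := hc₂.of_frame hF₃
    have h12₃ : s₃.realReg 12 = s.realReg 11 * s.realMem (vec + i) := by
      subst hs₃
      simp [runList, Instr.run, h34, h11₂, hlo (vec + i) (by omega)]
    have h10₃ : s₃.realReg 10 = s.realReg 10 := by
      rw [← h10₂]; exact hF₃.real 10
    have hni : n * i + n ≤ n * n := by
      rw [← Nat.mul_succ]; exact Nat.mul_le_mul_left n hi
    let J : ℕ → State → Prop := fun j s' => s'.natReg 35 = j ∧ s'.natReg 36 = vec + j ∧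
      s'.natReg 30 = src + (n * i + j) ∧ s'.natReg 31 = dst + (n * i + j) ∧
      (∀ a < dst, s'.realMem a = s.realMem a) ∧ ∀ a < n * i + j, s'.realMem (dst + a) = G a
    refine Runs.seq (Runs.loop (K := n) (B := 10) J ?_ ?_ ?_) fun s₄ hs₄ hF₄ => ?_
    · subst hs₃
      refine ⟨?_, ?_, ?_, ?_, ?_, ?_⟩ <;>
        simp [runList, Instr.run, h30', h31', h32₂, hc₂.r3]
      · exact hlo
      · exact hmem
    · rintro j hj s₅ ⟨h35, h36, h30₅, h31₅, hlo₅, hmem₅⟩ hF₅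
      have hc₅ : Consts n s₅ := hc₃.of_frame hF₅
      have h10₅ : s₅.realReg 10 = s.realReg 10 := by
        rw [← h10₃]; exact hF₅.real 10
      have h12₅ : s₅.realReg 12 = s.realReg 11 * s.realMem (vec + i) := by
        rw [← h12₃]; exact hF₅.real 12
      refine ⟨by simpa [Test.Holds, h35, hc₅.r1] using hj, ?_⟩
      have hcell : s₅.realReg 10 * s₅.realMem (src + (n * i + j)) +
          s₅.realReg 12 * s₅.realMem (vec + j) = G (n * i + j) := by
        have hn : 0 < n := by omega
        rw [hG, h10₅, h12₅, hlo₅ _ (by omega), hlo₅ _ (by omega)]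
        dsimp only
        rw [Nat.mul_add_div hn, Nat.div_eq_of_lt hj, Nat.mul_add_mod, Nat.mod_eq_of_lt hj, add_zero]
      refine Runs.straight ⟨?_, ?_, ?_, ?_, ?_, ?_⟩ <;>
        simp [runList, Instr.run, h30₅, h31₅, h35, h36, hc₅.r2, add_assoc]
      · intro a ha
        rw [Function.update_of_ne (by omega), hlo₅ a ha]
      · intro a ha
        rcases Nat.lt_succ_iff_lt_or_eq.1 (show a < n * i + j + 1 by omega) with h | h
        · rw [Function.update_of_ne (by omega), hmem₅ a h]
        · subst h
          rw [Function.update_self, hcell]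
    · rintro s₅ ⟨h35, -⟩ hF₅
      have hc₅ : Consts n s₅ := hc₃.of_frame hF₅
      simp [Test.Holds, h35, hc₅.r1]
    · obtain ⟨h35, h36, h30₄, h31₄, hlo₄, hmem₄⟩ := hs₄
      have e33 : s₄.natReg 33 = i := by
        rw [hF₄.nat 33,
          hF₃.nat 33, h33]
      have e34 : s₄.natReg 34 = vec + i := by
        rw [hF₄.nat 34,
          hF₃.nat 34, h34]
      have e2 : s₄.natReg 2 = 1 := by
        rw [hF₄.nat 2, hc₃.r2]
      refine Runs.straight ⟨?_, ?_, ?_, ?_, ?_, ?_⟩ <;>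
        simp [runList, Instr.run, h30₄, h31₄, e33, e34, e2, add_assoc, mul_add]
      · exact hlo₄
      · exact hmem₄
  · rintro s₂ ⟨h33, -⟩ hF₂
    have hc₂ : Consts n s₂ := hc₁.of_frame hF₂
    simp [Test.Holds, h33, hc₂.r1]
  · rintro s₂ ⟨-, -, -, -, hlo, hmem⟩ -
    exact ⟨hlo, hmem⟩

end RealRAM

/-! ### Powers of the number of variables -/

namespace RealRAM

/-- The value at `n` of `xʲ + c xʲ⁻¹ + ⋯ + c`, by Horner's scheme. -/
def horner (n c : ℕ) : ℕ → ℕ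
  | 0 => 1
  | j + 1 => n * horner n c j + c

theorem horner_zero (n j : ℕ) : horner n 0 j = n ^ j := by
  induction j with
  | zero => rfl
  | succ j ih => rw [horner, ih, pow_succ']; rfl

/-- Natural register `4` becomes `n` times its value plus the content of register `a`. -/
def hornerStep (a : ℕ) : Program :=
  .seq (straight [.natConst 33 0, .natConst 34 0]) <|
  .seq (.loop (.natLt 33 1) <| straight [.natAdd 34 34 4, .natAdd 33 33 2]) <|
  straight [.natAdd 4 34 a]

/-- Natural register `4` becomes `horner n c j`, where `c` is the content of register `a`; this
value is copied to register `b`. -/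
def hornerProg (a b : ℕ) : ℕ → Program
  | 0 => straight [.natConst 4 1, .natAdd b 4 3]
  | j + 1 => .seq (hornerProg a b j) (.seq (hornerStep a) (straight [.natAdd b 4 3]))

/-- Cost of `hornerProg`. -/
def hornerTime (n j : ℕ) : ℕ := 2 + j * (n * 3 + 5)

theorem all_hornerProg (P : Instr → Bool) (a b j : ℕ)
    (h : P (.natConst 4 1) ∧ P (.natConst 33 0) ∧ P (.natConst 34 0) ∧ P (.natAdd 34 34 4) ∧
      P (.natAdd 33 33 2) ∧ P (.natAdd 4 34 a) ∧ P (.natAdd b 4 3)) :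
    (hornerProg a b j).all P = true := by
  obtain ⟨h1, h2, h3, h4, h5, h6, h7⟩ := h
  induction j with
  | zero => simp [hornerProg, straight, Program.all, h1, h7]
  | succ j ih => simp [hornerProg, hornerStep, straight, Program.all, ih, h2, h3, h4, h5, h6, h7]

theorem runs_hornerStep {n : ℕ} {s : State} (hs : Consts n s) {a c : ℕ} (ha : s.natReg a = c)
    (ha' : a = 2 ∨ a = 3) :
    Runs (hornerStep a) s (2 + ((n * (2 + 1) + 1) + 1)) fun s' =>
      s'.natReg 4 = n * s.natReg 4 + c := by
  refine Runs.seq (Runs.straight rfl) fun s₁ hs₁ hF₁ => ?_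
  have hc₁ := hs.of_frame hF₁
  refine Runs.seq (Runs.loop (K := n) (B := 2)
    (fun i s' => s'.natReg 33 = i ∧ s'.natReg 34 = i * s.natReg 4) ?_ ?_ ?_) fun s₂ hs₂ hF₂ => ?_
  · subst hs₁
    simp [runList, Instr.run]
  · rintro i hi s₂ ⟨h33, h34⟩ hF₂
    have hc₂ := hc₁.of_frame hF₂
    have h4 : s₂.natReg 4 = s.natReg 4 := by rw [hF₂.nat 4, hF₁.nat 4]
    refine ⟨by simpa [Test.Holds, h33, hc₂.r1] using hi, Runs.straight ⟨?_, ?_⟩⟩ <;>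
      simp [runList, Instr.run, h33, h34, hc₂.r2, h4, add_mul]
  · rintro s₂ ⟨h33, -⟩ hF₂
    simp [Test.Holds, h33, (hc₁.of_frame hF₂).r1]
  · have hac : s₂.natReg a = c := by
      rcases ha' with rfl | rfl
      · rw [hF₂.nat 2, hF₁.nat 2, ha]
      · rw [hF₂.nat 3, hF₁.nat 3, ha]
    exact Runs.straight (by simp [runList, Instr.run, hs₂.2, hac])

theorem runs_hornerProg {n : ℕ} {s : State} (hs : Consts n s) {a b c : ℕ} (ha : s.natReg a = c)
    (ha' : a = 2 ∨ a = 3) (hb : 4 < b) (j : ℕ) :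
    Runs (hornerProg a b j) s (hornerTime n j) fun s' =>
      s'.natReg 4 = horner n c j ∧ s'.natReg b = horner n c j := by
  have hk : ∀ j r, 0 < r → r < 4 → (hornerProg a b j).all (Instr.keepsNat r) = true := by
    intro j r hr hr'
    refine all_hornerProg _ a b j ?_
    simp only [Instr.keepsNat, bne_iff_ne]
    omega
  induction j with
  | zero =>
    refine (Runs.straight (l := [.natConst 4 1, .natAdd b 4 3])
      (Q := fun s' => s'.natReg 4 = horner n c 0 ∧ s'.natReg b = horner n c 0) ?_).mono
      (by simp [hornerTime]) fun _ h _ => h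
    simp [runList, Instr.run, hs.r3, horner, hb.ne]
  | succ j ih =>
    refine (Runs.seq ih fun s₁ hs₁ hF₁ => Runs.seq (runs_hornerStep (n := n) (c := c) (a := a)
      (hs.of_frame hF₁ (hk j 1 (by omega) (by omega)) (hk j 2 (by omega) (by omega))
        (hk j 3 (by omega) (by omega))) ?_ ha')
      fun s₂ hs₂ hF₂ => Runs.straight (Q := fun s' => s'.natReg 4 = horner n c (j + 1) ∧
        s'.natReg b = horner n c (j + 1)) ?_).mono ?_ fun _ h _ => h
    · rw [hF₁.nat a (by rcases ha' with rfl | rfl <;> exact hk j _ (by omega) (by omega)), ha]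
    · have h3 : s₂.natReg 3 = 0 := by
        rw [hF₂.nat 3 (by rcases ha' with rfl | rfl <;> rfl),
          hF₁.nat 3 (hk j 3 (by omega) (by omega)), hs.r3]
      rw [hs₁.1] at hs₂
      simp [runList, Instr.run, h3, hs₂, horner, hb.ne]
    · simp only [hornerTime, List.length_cons, List.length_nil, add_mul]
      omega

/-- The program parameters: natural registers `1`, `2`, `3` hold `n`, `1`, `0` and the next ones
the numbers `n²`, `n^(d+1)`, `n^(d+2)`, `n^(d+1) + ⋯ + 1`, `n^d + ⋯ + 1`, `n^(d+2) + ⋯ + 1`. -/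
structure Params (n d : ℕ) (s : State) : Prop extends Consts n s where
  r5 : s.natReg 5 = n * n
  r6 : s.natReg 6 = n ^ (d + 1)
  r7 : s.natReg 7 = n ^ (d + 2)
  r8 : s.natReg 8 = horner n 1 (d + 1)
  r9 : s.natReg 9 = horner n 1 d
  r10 : s.natReg 10 = n ^ (d + 2) + horner n 1 (d + 1)

theorem Params.of_frame {n d : ℕ} {p : Program} {s s' : State} (h : Params n d s)
    (hF : Frame p s s')
    (h1 : p.all (fun i => i.keepsNat 1 && i.keepsNat 2 && i.keepsNat 3 && i.keepsNat 5 &&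
      i.keepsNat 6 && i.keepsNat 7 && i.keepsNat 8 && i.keepsNat 9 && i.keepsNat 10) = true := by
      rfl) : Params n d s' := by
  have key : ∀ (P Q : Instr → Bool) (p : Program), p.all (fun i => P i && Q i) = true →
      p.all P = true ∧ p.all Q = true := by
    intro P Q p
    induction p with
    | skip => simp [Program.all]
    | instr i => simp [Program.all]
    | seq p q ih ih' => simp only [Program.all, Bool.and_eq_true]; tauto
    | cond c p q ih ih' => simp only [Program.all, Bool.and_eq_true]; tauto
    | loop c p ih => simpa only [Program.all] using ih
  obtain ⟨h1, h10⟩ := key _ _ _ h1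
  obtain ⟨h1, h9⟩ := key _ _ _ h1
  obtain ⟨h1, h8⟩ := key _ _ _ h1
  obtain ⟨h1, h7⟩ := key _ _ _ h1
  obtain ⟨h1, h6⟩ := key _ _ _ h1
  obtain ⟨h1, h5⟩ := key _ _ _ h1
  obtain ⟨h1, h3⟩ := key _ _ _ h1
  obtain ⟨h1, h2⟩ := key _ _ _ h1
  exact ⟨⟨(hF.nat 1 h1).trans h.r1, (hF.nat 2 h2).trans h.r2, (hF.nat 3 h3).trans h.r3⟩,
    (hF.nat 5 h5).trans h.r5, (hF.nat 6 h6).trans h.r6, (hF.nat 7 h7).trans h.r7,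
    (hF.nat 8 h8).trans h.r8, (hF.nat 9 h9).trans h.r9, (hF.nat 10 h10).trans h.r10⟩

/-- Computation of the parameters. -/
def setupProg (d : ℕ) : Program :=
  .seq (straight [.natConst 2 1, .natAdd 1 0 3]) <|
  .seq (hornerProg 3 5 2) <|
  .seq (hornerProg 3 6 (d + 1)) <|
  .seq (hornerProg 3 7 (d + 2)) <|
  .seq (hornerProg 2 8 (d + 1)) <|
  .seq (hornerProg 2 9 d) <|
  straight [.natAdd 10 7 8]

/-- Cost of `setupProg`. -/
def setupTime (n d : ℕ) : ℕ :=
  2 + (hornerTime n 2 + (hornerTime n (d + 1) + (hornerTime n (d + 2) +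
    (hornerTime n (d + 1) + (hornerTime n d + 1)))))

theorem runs_setupProg {n d : ℕ} {s : State} (h0 : s.natReg 0 = n) (h3 : s.natReg 3 = 0) :
    Runs (setupProg d) s (setupTime n d) fun s' => Params n d s' ∧ s'.realMem = s.realMem := by
  have hk : ∀ a b j r, r ≠ 4 → r ≠ 33 → r ≠ 34 → r ≠ b →
      (hornerProg a b j).all (Instr.keepsNat r) = true := by
    intro a b j r h4 h33 h34 hb
    refine all_hornerProg _ a b j ?_
    simp only [Instr.keepsNat, bne_iff_ne]
    omega
  have hm : ∀ a b j, (hornerProg a b j).all Instr.keepsMem = true := fun a b j =>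
    all_hornerProg _ a b j (by simp [Instr.keepsMem])
  have hc : ∀ {a b j : ℕ} {s s' : State}, Consts n s → 4 < b → Frame (hornerProg a b j) s s' →
      Consts n s' := fun h hb hF =>
    h.of_frame hF (hk _ _ _ 1 (by omega) (by omega) (by omega) (by omega))
      (hk _ _ _ 2 (by omega) (by omega) (by omega) (by omega))
      (hk _ _ _ 3 (by omega) (by omega) (by omega) (by omega))
  refine Runs.seq (Runs.straight rfl) fun s₁ hs₁ hF₁ => ?_
  have c₁ : Consts n s₁ := by
    subst hs₁
    constructor <;> simp [runList, Instr.run, h0, h3]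
  refine Runs.seq (runs_hornerProg c₁ c₁.r3 (Or.inr rfl) (by norm_num) 2) fun s₂ hs₂ hF₂ => ?_
  have c₂ := hc c₁ (by norm_num) hF₂
  refine Runs.seq (runs_hornerProg c₂ c₂.r3 (Or.inr rfl) (by norm_num) _) fun s₃ hs₃ hF₃ => ?_
  have c₃ := hc c₂ (by norm_num) hF₃
  refine Runs.seq (runs_hornerProg c₃ c₃.r3 (Or.inr rfl) (by norm_num) _) fun s₄ hs₄ hF₄ => ?_
  have c₄ := hc c₃ (by norm_num) hF₄
  refine Runs.seq (runs_hornerProg c₄ c₄.r2 (Or.inl rfl) (by norm_num) _) fun s₅ hs₅ hF₅ => ?_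
  have c₅ := hc c₄ (by norm_num) hF₅
  refine Runs.seq (runs_hornerProg c₅ c₅.r2 (Or.inl rfl) (by norm_num) _) fun s₆ hs₆ hF₆ => ?_
  have c₆ := hc c₅ (by norm_num) hF₆
  have e5 : s₆.natReg 5 = n * n := by
    rw [hF₆.nat 5 (hk _ _ _ _ (by decide) (by decide) (by decide) (by decide)),
      hF₅.nat 5 (hk _ _ _ _ (by decide) (by decide) (by decide) (by decide)),
      hF₄.nat 5 (hk _ _ _ _ (by decide) (by decide) (by decide) (by decide)),
      hF₃.nat 5 (hk _ _ _ _ (by decide) (by decide) (by decide) (by decide)), hs₂.2,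
      horner_zero, sq]
  have e6 : s₆.natReg 6 = n ^ (d + 1) := by
    rw [hF₆.nat 6 (hk _ _ _ _ (by decide) (by decide) (by decide) (by decide)),
      hF₅.nat 6 (hk _ _ _ _ (by decide) (by decide) (by decide) (by decide)),
      hF₄.nat 6 (hk _ _ _ _ (by decide) (by decide) (by decide) (by decide)), hs₃.2, horner_zero]
  have e7 : s₆.natReg 7 = n ^ (d + 2) := by
    rw [hF₆.nat 7 (hk _ _ _ _ (by decide) (by decide) (by decide) (by decide)),
      hF₅.nat 7 (hk _ _ _ _ (by decide) (by decide) (by decide) (by decide)), hs₄.2, horner_zero]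
  have e8 : s₆.natReg 8 = horner n 1 (d + 1) := by
    rw [hF₆.nat 8 (hk _ _ _ _ (by decide) (by decide) (by decide) (by decide)), hs₅.2]
  have em : s₆.realMem = s.realMem := by
    rw [hF₆.mem (hm _ _ _), hF₅.mem (hm _ _ _), hF₄.mem (hm _ _ _), hF₃.mem (hm _ _ _),
      hF₂.mem (hm _ _ _), hF₁.mem]
  refine Runs.straight ⟨⟨⟨?_, ?_, ?_⟩, ?_, ?_, ?_, ?_, ?_, ?_⟩, ?_⟩ <;>
    simp [runList, Instr.run, c₆.r1, c₆.r2, c₆.r3, e5, e6, e7, e8, hs₆.2, em]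

/-! ### Contracting the array -/

/-- Cell `n^(d+2) + t` becomes the sum of the cells `n t, …, n t + n - 1`, for
`t = 0, 1, …, n^(d+1) + ⋯ + n`. -/
def fillProg : Program :=
  .seq (straight [.natConst 11 0, .natConst 12 0, .natAdd 13 7 3]) <|
  .loop (.natLt 11 8) <|
    .seq (straight [.realConst 1 0, .natConst 14 0]) <|
    .seq (.loop (.natLt 14 1) <|
      straight [.realLoad 2 12, .realAdd 1 1 2, .natAdd 12 12 2, .natAdd 14 14 2]) <|
    straight [.realStore 13 1, .natAdd 13 13 2, .natAdd 11 11 2]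

/-- Cost of `fillProg`. -/
def fillTime (n d : ℕ) : ℕ := 3 + (horner n 1 (d + 1) * (2 + (n * 5 + 1 + 3) + 1) + 1)

theorem sub_one_mul_horner (n d : ℕ) : n * horner n 1 d + 1 = horner n 1 d + n ^ (d + 1) := by
  induction d with
  | zero => simp [horner]; ring
  | succ d ih =>
    rw [show horner n 1 (d + 1) = n * horner n 1 d + 1 from rfl, mul_add, pow_succ']
    have := congrArg (n * ·) ih
    simp only [mul_add] at this
    omega

theorem add_lt_of_lt_horner {n d t i : ℕ} (ht : t < horner n 1 d) (hi : i < n) :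
    n * t + i < n ^ (d + 1) + t := by
  have h1 := sub_one_mul_horner n d
  obtain ⟨m, rfl⟩ : ∃ m, n = m + 1 := ⟨n - 1, by omega⟩
  have h2 : m * (t + 1) ≤ m * horner (m + 1) 1 d := Nat.mul_le_mul_left m ht
  rw [add_mul, one_mul] at h1 ⊢
  rw [mul_add, mul_one] at h2
  omega

theorem runs_fillProg {n d : ℕ} {s : State} (hs : Params n d s) :
    Runs fillProg s (fillTime n d) fun s' =>
      (∀ a < n ^ (d + 2), s'.realMem a = s.realMem a) ∧
      ∀ t < horner n 1 (d + 1), s'.realMem (n ^ (d + 2) + t) =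
        ∑ i ∈ Finset.range n, s'.realMem (n * t + i) := by
  refine Runs.seq (Runs.straight rfl) fun s₁ hs₁ hF₁ => ?_
  have c₁ := hs.of_frame hF₁
  let I : ℕ → State → Prop := fun t s' => s'.natReg 11 = t ∧ s'.natReg 12 = n * t ∧
    s'.natReg 13 = n ^ (d + 2) + t ∧ (∀ a < n ^ (d + 2), s'.realMem a = s.realMem a) ∧
    ∀ t' < t, s'.realMem (n ^ (d + 2) + t') = ∑ i ∈ Finset.range n, s'.realMem (n * t' + i)
  refine (Runs.loop (K := horner n 1 (d + 1)) (B := 2 + (n * 5 + 1 + 3)) I ?_ ?_ ?_).mono le_rfl ?_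
  · subst hs₁
    simp [I, runList, Instr.run, hs.r7, hs.r3]
  · rintro t ht s₂ ⟨h11, h12, h13, hlo, hmem⟩ hF₂
    have c₂ := c₁.of_frame hF₂
    refine ⟨by simpa [Test.Holds, h11, c₂.r8] using ht, ?_⟩
    refine Runs.seq (Runs.straight rfl) fun s₃ hs₃ hF₃ => ?_
    have c₃ := c₂.of_frame hF₃
    refine Runs.seq (Runs.loop (K := n) (B := 4) (fun i s' => s'.natReg 14 = i ∧
      s'.natReg 12 = n * t + i ∧
      s'.realReg 1 = ∑ i ∈ Finset.range i, s₂.realMem (n * t + i)) ?_ ?_ ?_)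
      fun s₄ hs₄ hF₄ => ?_
    · subst hs₃
      simp [runList, Instr.run, h12]
    · rintro i hi s₅ ⟨h14, h12₅, hsum⟩ hF₅
      have c₅ := c₃.of_frame hF₅
      have hm : s₅.realMem = s₂.realMem := by rw [hF₅.mem, hF₃.mem]
      refine ⟨by simpa [Test.Holds, h14, c₅.r1] using hi, Runs.straight ⟨?_, ?_, ?_⟩⟩ <;>
        simp [runList, Instr.run, h14, h12₅, hsum, c₅.r2, hm, Finset.sum_range_succ, add_assoc]
    · rintro s₅ ⟨h14, -⟩ hF₅
      simp [Test.Holds, h14, (c₃.of_frame hF₅).r1]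
    · obtain ⟨-, h12₄, hsum⟩ := hs₄
      have c₄ := c₃.of_frame hF₄
      have hm : s₄.realMem = s₂.realMem := by rw [hF₄.mem, hF₃.mem]
      have e11 : s₄.natReg 11 = t := by rw [hF₄.nat 11, hF₃.nat 11, h11]
      have e13 : s₄.natReg 13 = n ^ (d + 2) + t := by rw [hF₄.nat 13, hF₃.nat 13, h13]
      refine Runs.straight ⟨?_, ?_, ?_, ?_, ?_⟩ <;>
        simp [runList, Instr.run, h12₄, e11, e13, c₄.r2, hm, hsum, mul_add, add_assoc]
      · intro a ha
        rw [Function.update_of_ne (by omega), hlo a ha]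
      · intro t' ht'
        have hne : ∀ i ∈ Finset.range n, Function.update s₂.realMem (n ^ (d + 2) + t)
            (∑ i ∈ Finset.range n, s₂.realMem (n * t + i)) (n * t' + i) =
            s₂.realMem (n * t' + i) := fun i hi => by
          -- the cells that have been read so far lie below the cell that is written
          have : n * t' + i < n ^ (d + 2) + t' := add_lt_of_lt_horner (lt_of_le_of_lt ht' ht)
            (Finset.mem_range.1 hi)
          rw [Function.update_of_ne (by omega)]
        rw [Finset.sum_congr rfl hne]
        rcases ht'.lt_or_eq with h | h
        · rw [Function.update_of_ne (by omega), hmem t' h]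
        · subst h
          rw [Function.update_self]
  · rintro s₂ ⟨h11, -⟩ hF₂
    simp [Test.Holds, h11, (c₁.of_frame hF₂).r8]
  · rintro s₂ ⟨-, -, -, hlo, hmem⟩ -
    exact ⟨hlo, hmem⟩

end RealRAM

/-! ### Testing positive semidefiniteness by elimination -/

namespace CLC

open Matrix

section Elimination

variable {ι : Type*}

/-- Elimination of the variable `k` without division: with pivot `p = A k k`, replaced by `1` if it
is zero, the new matrix is `p A - (A k) (A k)ᵀ`. -/
noncomputable def eliminate (A : Matrix ι ι ℝ) (k : ι) : Matrix ι ι ℝ :=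
  Matrix.of fun i j => (if A k k = 0 then 1 else A k k) * A i j - A k i * A k j

theorem eliminate_isSymm {A : Matrix ι ι ℝ} (hA : A.IsSymm) (k : ι) : (eliminate A k).IsSymm := by
  ext i j
  simp only [eliminate, transpose_apply, of_apply]
  rw [hA.apply i j]; ring

variable [Fintype ι]

theorem quadForm_eliminate (A : Matrix ι ι ℝ) (k : ι) (x : ι → ℝ) :
    x ⬝ᵥ eliminate A k *ᵥ x =
      (if A k k = 0 then 1 else A k k) * (x ⬝ᵥ A *ᵥ x) - (A k ⬝ᵥ x) ^ 2 := by
  have h1 : (A k ⬝ᵥ x) ^ 2 = ∑ i, ∑ j, x i * (A k i * A k j) * x j := by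
    rw [sq, dotProduct, Finset.sum_mul_sum]
    exact Finset.sum_congr rfl fun i _ => Finset.sum_congr rfl fun j _ => by ring
  rw [h1, dotProduct_mulVec_eq_sum, dotProduct_mulVec_eq_sum]
  simp only [Finset.mul_sum, ← Finset.sum_sub_distrib]
  refine Finset.sum_congr rfl fun i _ => Finset.sum_congr rfl fun j _ => ?_
  simp only [eliminate, of_apply]; ring

theorem nonneg_of_eliminate {A : Matrix ι ι ℝ} {k : ι} (hk : 0 ≤ A k k)
    (h : ∀ x, 0 ≤ x ⬝ᵥ eliminate A k *ᵥ x) (x : ι → ℝ) : 0 ≤ x ⬝ᵥ A *ᵥ x := by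
  have h1 := h x
  rw [quadForm_eliminate] at h1
  have hp : 0 < if A k k = 0 then 1 else A k k := by
    split_ifs with h0
    · exact one_pos
    · exact hk.lt_of_ne' h0
  have h2 : 0 ≤ (if A k k = 0 then 1 else A k k) * (x ⬝ᵥ A *ᵥ x) := by
    linarith [sq_nonneg (A k ⬝ᵥ x)]
  exact nonneg_of_mul_nonneg_right h2 hp

variable [DecidableEq ι]

theorem quadForm_smul_add_smul_single {A : Matrix ι ι ℝ} (hA : A.IsSymm) (x : ι → ℝ) (k : ι)
    (a b : ℝ) : (a • x + b • Pi.single k 1) ⬝ᵥ A *ᵥ (a • x + b • Pi.single k 1) =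
      a ^ 2 * (x ⬝ᵥ A *ᵥ x) + 2 * a * b * (A k ⬝ᵥ x) + b ^ 2 * A k k := by
  have h1 : x ⬝ᵥ A *ᵥ Pi.single k 1 = A k ⬝ᵥ x := by
    rw [dotProduct_mulVec_symm hA, single_one_dotProduct]; rfl
  have h2 : Pi.single k (1 : ℝ) ⬝ᵥ A *ᵥ Pi.single k 1 = A k k := by
    rw [single_one_dotProduct, mulVec_single_one]; rfl
  rw [quadForm_add_smul hA, h1, h2]

theorem row_eq_zero_of_nonneg {A : Matrix ι ι ℝ} (hA : A.IsSymm) {k : ι} (hk : A k k = 0)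
    (h : ∀ x, 0 ≤ x ⬝ᵥ A *ᵥ x) (x : ι → ℝ) : A k ⬝ᵥ x = 0 := by
  by_contra hne
  -- in direction `e_k` the form is affine, hence negative far out on one side
  have h2 := h ((A k ⬝ᵥ x) • x + (-(x ⬝ᵥ A *ᵥ x) - 1) • Pi.single k 1)
  rw [quadForm_smul_add_smul_single hA, hk] at h2
  have h3 : 0 < (A k ⬝ᵥ x) ^ 2 := by positivity
  nlinarith [h x, mul_nonneg h3.le (h x)]

theorem nonneg_eliminate {A : Matrix ι ι ℝ} (hA : A.IsSymm) (k : ι)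
    (h : ∀ x, 0 ≤ x ⬝ᵥ A *ᵥ x) (x : ι → ℝ) : 0 ≤ x ⬝ᵥ eliminate A k *ᵥ x := by
  rw [quadForm_eliminate]
  by_cases hk : A k k = 0
  · rw [if_pos hk, row_eq_zero_of_nonneg hA hk h]
    simpa using h x
  · rw [if_neg hk]
    have hkk : 0 ≤ A k k := by
      have := h ((0 : ℝ) • x + (1 : ℝ) • Pi.single k 1)
      rw [quadForm_smul_add_smul_single hA] at this
      linarith
    -- up to a factor, the minimum of the form on the line `x + ℝ e_k`
    have h1 := h (A k k • x + (-(A k ⬝ᵥ x)) • Pi.single k 1)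
    rw [quadForm_smul_add_smul_single hA] at h1
    have h2 : 0 ≤ A k k * (A k k * (x ⬝ᵥ A *ᵥ x) - (A k ⬝ᵥ x) ^ 2) := by nlinarith
    exact nonneg_of_mul_nonneg_right h2 (hkk.lt_of_ne' hk)

end Elimination

variable {n : ℕ}

/-- The matrix after the elimination of the first `k` variables. -/
noncomputable def eliminateFirst (A : Matrix (Fin n) (Fin n) ℝ) : ℕ → Matrix (Fin n) (Fin n) ℝ
  | 0 => A
  | k + 1 => if h : k < n then eliminate (eliminateFirst A k) ⟨k, h⟩ else eliminateFirst A k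

theorem eliminateFirst_succ (A : Matrix (Fin n) (Fin n) ℝ) (k : Fin n) :
    eliminateFirst A (k + 1) = eliminate (eliminateFirst A k) k := by
  rw [eliminateFirst, dif_pos k.2]

theorem eliminateFirst_isSymm {A : Matrix (Fin n) (Fin n) ℝ} (hA : A.IsSymm) (k : ℕ) :
    (eliminateFirst A k).IsSymm := by
  induction k with
  | zero => exact hA
  | succ k ih =>
    rw [eliminateFirst]
    split_ifs
    · exact eliminate_isSymm ih _
    · exact ih

/-- A symmetric matrix is positive semidefinite if and only if no pivot is negative and nothing is
left after the elimination of all variables. -/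
theorem nonneg_iff_eliminateFirst {A : Matrix (Fin n) (Fin n) ℝ} (hA : A.IsSymm) :
    (∀ x, 0 ≤ x ⬝ᵥ A *ᵥ x) ↔
      (∀ k : Fin n, 0 ≤ eliminateFirst A k k k) ∧ eliminateFirst A n = 0 := by
  constructor
  · intro h
    have hpsd : ∀ k x, 0 ≤ x ⬝ᵥ eliminateFirst A k *ᵥ x := by
      intro k
      induction k with
      | zero => exact h
      | succ k ih =>
        rw [eliminateFirst]
        split_ifs
        · exact nonneg_eliminate (eliminateFirst_isSymm hA k) _ ih
        · exact ih
    refine ⟨fun k => ?_, ?_⟩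
    · have := hpsd k ((0 : ℝ) • 0 + (1 : ℝ) • Pi.single k 1)
      rw [quadForm_smul_add_smul_single (eliminateFirst_isSymm hA k)] at this
      linarith
    · -- after `k` steps the rows of the first `k` variables vanish
      have hrows : ∀ k ≤ n, ∀ i : Fin n, (i : ℕ) < k → ∀ j, eliminateFirst A k i j = 0 := by
        intro k
        induction k with
        | zero => exact fun _ i hi => absurd hi (Nat.not_lt_zero _)
        | succ k ih =>
          intro hk i hi j
          have e := eliminateFirst_succ A ⟨k, hk⟩
          dsimp only at e
          rw [e]
          have hs := eliminateFirst_isSymm hA k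
          simp only [eliminate, of_apply]
          rcases (Nat.lt_succ_iff_lt_or_eq.1 hi) with h1 | h1
          · have h2 := ih (by omega) i h1
            rw [h2, hs.apply i, h2]; simp
          · obtain rfl : i = ⟨k, hk⟩ := Fin.ext h1
            by_cases h0 : eliminateFirst A k ⟨k, hk⟩ ⟨k, hk⟩ = 0
            · have h2 := row_eq_zero_of_nonneg hs h0 (hpsd k) (Pi.single j 1)
              rw [dotProduct_single_one] at h2
              rw [h2]; simp
            · rw [if_neg h0]; ring
      ext i j
      exact hrows n le_rfl i i.2 j
  · rintro ⟨hpiv, hzero⟩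
    have key : ∀ m k, k + m = n → ∀ x, 0 ≤ x ⬝ᵥ eliminateFirst A k *ᵥ x := by
      intro m
      induction m with
      | zero =>
        intro k hk x
        rw [add_zero] at hk
        subst hk
        rw [hzero]; simp
      | succ m ih =>
        intro k hk
        have h1 := ih (k + 1) (by omega)
        rw [eliminateFirst, dif_pos (show k < n by omega)] at h1
        exact nonneg_of_eliminate (hpiv ⟨k, by omega⟩) h1
    exact key n 0 (zero_add n)

/-- `r rᵀ - s A`, where `r` is the vector of row sums and `s` the sum of all entries. -/
noncomputable def lorentzDefect (A : Matrix (Fin n) (Fin n) ℝ) : Matrix (Fin n) (Fin n) ℝ :=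
  Matrix.of fun i j => (∑ k, A i k) * (∑ k, A j k) - (∑ k, ∑ l, A k l) * A i j

theorem lorentzDefect_isSymm {A : Matrix (Fin n) (Fin n) ℝ} (hA : A.IsSymm) :
    (lorentzDefect A).IsSymm := by
  ext i j
  simp only [lorentzDefect, transpose_apply, of_apply]
  rw [hA.apply]; ring

/-- The reverse Cauchy–Schwarz inequality against the all-ones vector alone already characterizes
nonnegative matrices with at most one positive eigenvalue. -/
theorem atMostOnePos_iff_lorentzDefect {A : Matrix (Fin n) (Fin n) ℝ} (hA : A.IsSymm)
    (h0 : ∀ i j, 0 ≤ A i j) : AtMostOnePos A ↔ ∀ x, 0 ≤ x ⬝ᵥ lorentzDefect A *ᵥ x := by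
  have h1 : ∀ x : Fin n → ℝ, x ⬝ᵥ lorentzDefect A *ᵥ x =
      (x ⬝ᵥ A *ᵥ 1) ^ 2 - (x ⬝ᵥ A *ᵥ x) * ((1 : Fin n → ℝ) ⬝ᵥ A *ᵥ 1) := fun x => by
    have h2 : x ⬝ᵥ A *ᵥ 1 = ∑ i, x i * ∑ k, A i k := by
      simp [dotProduct, mulVec]
    have h3 : (1 : Fin n → ℝ) ⬝ᵥ A *ᵥ 1 = ∑ k, ∑ l, A k l := by
      simp [dotProduct, mulVec]
    rw [h2, h3, sq, Finset.sum_mul_sum, dotProduct_mulVec_eq_sum, dotProduct_mulVec_eq_sum,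
      Finset.sum_mul, ← Finset.sum_sub_distrib]
    refine Finset.sum_congr rfl fun i _ => ?_
    rw [Finset.sum_mul, ← Finset.sum_sub_distrib]
    refine Finset.sum_congr rfl fun j _ => ?_
    simp only [lorentzDefect, of_apply]; ring
  constructor
  · intro h x
    rw [h1, sub_nonneg]
    exact h.mul_le_sq hA h0 (fun _ => zero_lt_one) x
  · intro h
    refine AtMostOnePos.of_mul_le_sq h0 (w := 1) (fun _ => zero_lt_one) fun x => ?_
    have := h x
    rwa [h1, sub_nonneg] at this

end CLC

/-! ### The program testing one block -/

namespace RealRAM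

open CLC Matrix

/-- The `n²` cells from address `p` on hold the matrix `A`. -/
def MatAt {n : ℕ} (m : ℕ → ℝ) (p : ℕ) (A : Matrix (Fin n) (Fin n) ℝ) : Prop :=
  ∀ i j : Fin n, m (p + (n * i + j)) = A i j

/-- Natural register `19` is `0` if `P` holds and `1` otherwise. -/
def Flag (P : Prop) (s : State) : Prop :=
  s.natReg 19 ≤ 1 ∧ (s.natReg 19 = 0 ↔ P)

theorem Flag.congr {P Q : Prop} {s s' : State} (h : Flag P s) (hs : s'.natReg 19 = s.natReg 19)
    (hPQ : P ↔ Q) : Flag Q s' := by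
  rw [Flag, hs, ← hPQ]; exact h

theorem cell_lt {n : ℕ} (i j : Fin n) : n * (i : ℕ) + j < n * n := by
  have : n * (i : ℕ) + n ≤ n * n := by
    rw [← Nat.mul_succ]; exact Nat.mul_le_mul_left n i.2
  have := j.2
  omega

theorem cell_div {n : ℕ} (i j : Fin n) : (n * (i : ℕ) + j) / n = i := by
  rw [Nat.mul_add_div (by have := i.2; omega), Nat.div_eq_of_lt j.2, add_zero]

theorem cell_mod {n : ℕ} (i j : Fin n) : (n * (i : ℕ) + j) % n = j := by
  rw [Nat.mul_add_mod, Nat.mod_eq_of_lt j.2]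

theorem exists_cell {n a : ℕ} (h : a < n * n) : ∃ i j : Fin n, a = n * i + j := by
  have hn : 0 < n := Nat.pos_of_ne_zero fun h0 => by simp [h0] at h
  exact ⟨⟨a / n, Nat.div_lt_of_lt_mul h⟩, ⟨a % n, Nat.mod_lt _ hn⟩, (Nat.div_add_mod a n).symm⟩

/-- One elimination step on the matrix at the address in natural register `21`; the addresses of
the pivot row and of the pivot are in registers `22` and `23`. The new matrix is stored right
behind the old one. -/
def pivotProg : Program :=
  .seq (straight [.realLoad 10 23, .realConst 6 0, .natAdd 30 21 3, .natAdd 31 21 5,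
    .natAdd 32 22 3, .realConst 11 1, .realSub 11 6 11]) <|
  .seq (.cond (.realLt 10 6) (straight [.natConst 19 1]) (straight [])) <|
  .seq (.cond (.realEq 10 6) (straight [.realConst 10 1]) (straight [])) <|
  .seq rankOneProg <|
  straight [.natAdd 21 21 5, .natAdd 22 22 5, .natAdd 22 22 1, .natAdd 23 23 5, .natAdd 23 23 1,
    .natAdd 23 23 2, .natAdd 20 20 2]

/-- Cost of `pivotProg`. -/
def pivotTime (n : ℕ) : ℕ := 7 + (1 + 1 + (1 + 1 + (rankOneTime n + 7)))

/-- State of the elimination of `A` after `k` steps. The computation started in state `s`, with `A`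
at address `S` and with a flag for `P`; the flag is now also raised if a pivot was negative. -/
structure ElimState {n : ℕ} (A : Matrix (Fin n) (Fin n) ℝ) (P : Prop) (s : State) (S k : ℕ)
    (s' : State) : Prop where
  r20 : s'.natReg 20 = k
  r21 : s'.natReg 21 = S + k * (n * n)
  r22 : s'.natReg 22 = S + k * (n * n) + n * k
  r23 : s'.natReg 23 = S + k * (n * n) + (n * k + k)
  mat : MatAt s'.realMem (S + k * (n * n)) (eliminateFirst A k)
  lo : ∀ a < S, s'.realMem a = s.realMem a
  flag : Flag (P ∧ ∀ i : Fin n, (i : ℕ) < k → 0 ≤ eliminateFirst A i i i) s'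

theorem runs_pivotProg {n d : ℕ} {s s' : State} (hs : Params n d s')
    {A : Matrix (Fin n) (Fin n) ℝ} {P : Prop} {S k : ℕ} (hk : k < n)
    (h : ElimState A P s S k s') :
    Runs pivotProg s' (pivotTime n) (ElimState A P s S (k + 1)) := by
  set M := eliminateFirst A k with hM
  set κ : Fin n := ⟨k, hk⟩ with hκ
  have hnk : n * k + n ≤ n * n := by
    rw [← Nat.mul_succ]; exact Nat.mul_le_mul_left n hk
  refine Runs.seq (Runs.straight rfl) fun s₁ hs₁ hF₁ => ?_
  have c₁ := hs.of_frame hF₁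
  have g10 : s₁.realReg 10 = M κ κ := by
    subst hs₁
    simp only [runList, List.foldl, Instr.run, h.r23]
    simpa using h.mat κ κ
  have g6 : s₁.realReg 6 = 0 := by
    subst hs₁; simp [runList, Instr.run]
  have g11 : s₁.realReg 11 = -1 := by
    subst hs₁; simp [runList, Instr.run]
  have g30 : s₁.natReg 30 = S + k * (n * n) := by
    subst hs₁; simp [runList, Instr.run, h.r21, hs.r3]
  have g31 : s₁.natReg 31 = S + k * (n * n) + n * n := by
    subst hs₁; simp [runList, Instr.run, h.r21, hs.r3, hs.r5]
  have g32 : s₁.natReg 32 = S + k * (n * n) + n * k := by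
    subst hs₁; simp [runList, Instr.run, h.r22, hs.r3]
  have hPk : ((P ∧ ∀ i : Fin n, (i : ℕ) < k → 0 ≤ eliminateFirst A i i i) ∧ 0 ≤ M κ κ) ↔
      P ∧ ∀ i : Fin n, (i : ℕ) < k + 1 → 0 ≤ eliminateFirst A i i i := by
    constructor
    · rintro ⟨⟨hP, h1⟩, h2⟩
      refine ⟨hP, fun i hi => ?_⟩
      rcases Nat.lt_succ_iff_lt_or_eq.1 hi with h3 | h3
      · exact h1 i h3
      · obtain rfl : i = κ := Fin.ext h3
        exact h2
    · rintro ⟨hP, h1⟩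
      exact ⟨⟨hP, fun i hi => h1 i (by omega)⟩, h1 κ (Nat.lt_succ_self k)⟩
  have f₁ : s₁.natReg 19 = s'.natReg 19 := hF₁.nat 19
  refine Runs.seq (R := Flag (P ∧ ∀ i : Fin n, (i : ℕ) < k + 1 → 0 ≤ eliminateFirst A i i i))
    (Runs.cond (fun hc => Runs.mono (Runs.straight (l := [.natConst 19 1]) rfl) le_rfl ?_)
      (fun hc => Runs.mono (Runs.straight (l := []) rfl) zero_le_one ?_)) fun s₂ hs₂ hF₂ => ?_
  · rintro _ rfl -
    simp only [Test.Holds, g10, g6] at hc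
    rw [← hPk]
    refine ⟨by simp [runList, Instr.run], ?_⟩
    simp only [runList, List.foldl, Instr.run, Function.update_self, one_ne_zero, false_iff]
    exact fun hh => absurd hh.2 (not_le.2 hc)
  · rintro _ rfl -
    simp only [Test.Holds, g10, g6, not_lt] at hc
    refine h.flag.congr f₁ ?_
    rw [← hPk]
    exact ⟨fun h1 => ⟨h1, hc⟩, fun h1 => h1.1⟩
  refine Runs.seq (R := fun s₃ => s₃.realReg 10 = if M κ κ = 0 then 1 else M κ κ)
    (Runs.cond (fun hc => Runs.mono (Runs.straight (l := [.realConst 10 1]) rfl) le_rfl ?_)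
      (fun hc => Runs.mono (Runs.straight (l := []) rfl) zero_le_one ?_)) fun s₃ hs₃ hF₃ => ?_
  · rintro _ rfl -
    simp only [Test.Holds, hF₂.real 10, hF₂.real 6, g10, g6] at hc
    simp [runList, Instr.run, hc]
  · rintro _ rfl -
    simp only [Test.Holds, hF₂.real 10, hF₂.real 6, g10, g6] at hc
    simp [runList, hF₂.real 10, g10, hc]
  have m₃ : s₃.realMem = s'.realMem := by rw [hF₃.mem, hF₂.mem, hF₁.mem]
  have c₃ := (c₁.of_frame hF₂).of_frame hF₃
  refine Runs.seq (runs_rankOneProg c₃.toConsts (by rw [hF₃.nat 30, hF₂.nat 30, g30])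
    (by rw [hF₃.nat 31, hF₂.nat 31, g31]) (by rw [hF₃.nat 32, hF₂.nat 32, g32])
    le_rfl (by omega)) fun s₄ hs₄ hF₄ => ?_
  have c₄ := c₃.of_frame hF₄
  obtain ⟨hlo, hnew⟩ := hs₄
  rw [m₃, hs₃, hF₃.real 11, hF₂.real 11, g11] at hnew
  rw [m₃] at hlo
  have e20 : s₄.natReg 20 = k := by
    rw [hF₄.nat 20, hF₃.nat 20, hF₂.nat 20, hF₁.nat 20, h.r20]
  have e21 : s₄.natReg 21 = S + k * (n * n) := by
    rw [hF₄.nat 21, hF₃.nat 21, hF₂.nat 21, hF₁.nat 21, h.r21]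
  have e22 : s₄.natReg 22 = S + k * (n * n) + n * k := by
    rw [hF₄.nat 22, hF₃.nat 22, hF₂.nat 22, hF₁.nat 22, h.r22]
  have e23 : s₄.natReg 23 = S + k * (n * n) + (n * k + k) := by
    rw [hF₄.nat 23, hF₃.nat 23, hF₂.nat 23, hF₁.nat 23, h.r23]
  refine Runs.straight ⟨?_, ?_, ?_, ?_, ?_, ?_, ?_⟩
  · simp [runList, Instr.run, e20, c₄.r2]
  · simp [runList, Instr.run, e21, c₄.r5]; ring
  · simp [runList, Instr.run, e22, c₄.r5, c₄.r1]; ring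
  · simp [runList, Instr.run, e23, c₄.r5, c₄.r1, c₄.r2]; ring
  · intro i j
    have h1 := hnew (n * i + j) (cell_lt i j)
    have h2 : s'.realMem (S + k * (n * n) + (n * i + j)) = M i j := h.mat i j
    have h3 : ∀ l : Fin n, s'.realMem (S + k * (n * n) + n * k + l) = M κ l := fun l => by
      rw [add_assoc (S + _)]; exact h.mat κ l
    rw [cell_div, cell_mod, add_assoc (S + _), h2, h3, h3] at h1
    have e : S + (k + 1) * (n * n) + (n * (i : ℕ) + j) =
      S + k * (n * n) + (n * n + (n * i + j)) := by ring
    have e' := eliminateFirst_succ A κ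
    dsimp only [κ] at e'
    rw [e', e]
    simp only [runList, List.foldl, Instr.run]
    rw [h1]
    simp only [eliminate, of_apply, ← hκ, ← hM]
    ring
  · intro a ha
    simp only [runList, List.foldl, Instr.run]
    rw [hlo a (by omega), h.lo a ha]
  · refine hs₂.congr ?_ Iff.rfl
    simp [runList, Instr.run, hF₄.nat 19, hF₃.nat 19]

/-- Elimination of all variables. -/
def elimProg : Program :=
  .seq (straight [.natConst 20 0, .natAdd 21 10 3, .natAdd 22 10 3, .natAdd 23 10 3]) <|
  .loop (.natLt 20 1) pivotProg

/-- Cost of `elimProg`. -/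
def elimTime (n : ℕ) : ℕ := 4 + (n * (pivotTime n + 1) + 1)

theorem runs_elimProg {n d : ℕ} {s : State} (hs : Params n d s)
    {A : Matrix (Fin n) (Fin n) ℝ} {P : Prop} {S : ℕ} (hS : s.natReg 10 = S)
    (hA : MatAt s.realMem S A) (hP : Flag P s) :
    Runs elimProg s (elimTime n) (ElimState A P s S n) := by
  refine Runs.seq (Runs.straight rfl) fun s₁ hs₁ hF₁ => ?_
  have c₁ := hs.of_frame hF₁
  refine Runs.loop (ElimState A P s S) ?_ ?_ ?_
  · subst hs₁
    refine ⟨?_, ?_, ?_, ?_, ?_, ?_, ?_⟩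
    · simp [runList, Instr.run]
    · simp [runList, Instr.run, hS, hs.r3]
    · simp [runList, Instr.run, hS, hs.r3]
    · simp [runList, Instr.run, hS, hs.r3]
    · simpa [runList, Instr.run, eliminateFirst] using hA
    · simp [runList, Instr.run]
    · exact hP.congr (by simp [runList, Instr.run]) (by simp)
  · intro k hk s₂ hI hF₂
    have c₂ := c₁.of_frame hF₂
    exact ⟨by simpa [Test.Holds, hI.r20, c₂.r1] using hk, runs_pivotProg c₂ hk hI⟩
  · intro s₂ hI hF₂
    simp [Test.Holds, hI.r20, (c₁.of_frame hF₂).r1]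

/-- Raises the flag unless the `n²` cells from the address in natural register `21` on are zero. -/
def zeroTestProg : Program :=
  .seq (straight [.natConst 24 0, .natAdd 25 21 3, .realConst 6 0]) <|
  .loop (.natLt 24 5) <|
    .seq (straight [.realLoad 12 25, .natAdd 25 25 2, .natAdd 24 24 2]) <|
    .cond (.realEq 12 6) (straight []) (straight [.natConst 19 1])

/-- Cost of `zeroTestProg`. -/
def zeroTestTime (n : ℕ) : ℕ := 3 + (n * n * (3 + (1 + 1) + 1) + 1)

theorem runs_zeroTestProg {n d : ℕ} {s : State} (hs : Params n d s) {P : Prop} {p : ℕ}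
    (hp : s.natReg 21 = p) (hP : Flag P s) :
    Runs zeroTestProg s (zeroTestTime n) (Flag (P ∧ ∀ a < n * n, s.realMem (p + a) = 0)) := by
  refine Runs.seq (Runs.straight rfl) fun s₁ hs₁ hF₁ => ?_
  have c₁ := hs.of_frame hF₁
  have g6 : s₁.realReg 6 = 0 := by subst hs₁; simp [runList, Instr.run]
  refine (Runs.loop (K := n * n) (B := 3 + (1 + 1)) (fun k s' => s'.natReg 24 = k ∧
    s'.natReg 25 = p + k ∧ Flag (P ∧ ∀ a < k, s.realMem (p + a) = 0) s') ?_ ?_ ?_).mono le_rfl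
    fun s' hs' _ => hs'.2.2
  · subst hs₁
    refine ⟨?_, ?_, hP.congr ?_ (by simp)⟩ <;> simp [runList, Instr.run, hp, hs.r3]
  · rintro k hk s₂ ⟨h24, h25, hfl⟩ hF₂
    have c₂ := c₁.of_frame hF₂
    refine ⟨by simpa [Test.Holds, h24, c₂.r5] using hk, ?_⟩
    refine Runs.seq (Runs.straight rfl) fun s₃ hs₃ hF₃ => ?_
    have g12 : s₃.realReg 12 = s.realMem (p + k) := by
      subst hs₃
      simp [runList, Instr.run, h25, hF₂.mem, hF₁.mem]
    have g6₃ : s₃.realReg 6 = 0 := by rw [hF₃.real 6, hF₂.real 6, g6]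
    have g24 : s₃.natReg 24 = k + 1 := by
      subst hs₃; simp [runList, Instr.run, h24, c₂.r2]
    have g25 : s₃.natReg 25 = p + (k + 1) := by
      subst hs₃; simp [runList, Instr.run, h25, c₂.r2, add_assoc]
    have hsplit : ((P ∧ ∀ a < k, s.realMem (p + a) = 0) ∧ s.realMem (p + k) = 0) ↔
        P ∧ ∀ a < k + 1, s.realMem (p + a) = 0 := by
      constructor
      · rintro ⟨⟨h1, h2⟩, h3⟩
        refine ⟨h1, fun a ha => ?_⟩
        rcases Nat.lt_succ_iff_lt_or_eq.1 ha with h4 | rfl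
        · exact h2 a h4
        · exact h3
      · rintro ⟨h1, h2⟩
        exact ⟨⟨h1, fun a ha => h2 a (by omega)⟩, h2 k (Nat.lt_succ_self k)⟩
    refine Runs.cond (fun hc => Runs.mono (Runs.straight (l := []) rfl) zero_le_one ?_)
      (fun hc => Runs.mono (Runs.straight (l := [.natConst 19 1]) rfl) le_rfl ?_)
    · rintro _ rfl -
      simp only [Test.Holds, g12, g6₃] at hc
      refine ⟨g24, g25, hfl.congr (hF₃.nat 19) ?_⟩
      rw [← hsplit]
      exact ⟨fun h1 => ⟨h1, hc⟩, fun h1 => h1.1⟩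
    · rintro _ rfl -
      simp only [Test.Holds, g12, g6₃] at hc
      refine ⟨by simpa [runList, Instr.run] using g24, by simpa [runList, Instr.run] using g25,
        by simp [runList, Instr.run], ?_⟩
      simp only [runList, List.foldl, Instr.run, Function.update_self, one_ne_zero, false_iff]
      exact fun h1 => hc (hsplit.2 h1).2
  · rintro s₂ ⟨h24, -⟩ hF₂
    simp [Test.Holds, h24, (c₁.of_frame hF₂).r5]

/-- Tests whether `r rᵀ - s A` is positive semidefinite; the addresses of the matrix `A`, of its
vector `r` of row sums and of the sum `s` of its entries are in natural registers `16`, `17`, `18`.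
-/
def blockProg : Program :=
  .seq (straight [.natAdd 30 16 3, .natAdd 31 10 3, .natAdd 32 17 3, .realConst 6 0,
    .realLoad 10 18, .realSub 10 6 10, .realConst 11 1]) <|
  .seq rankOneProg <|
  .seq elimProg zeroTestProg

/-- Cost of `blockProg`. -/
def blockTime (n : ℕ) : ℕ := 7 + (rankOneTime n + (elimTime n + zeroTestTime n))

theorem runs_blockProg {n d : ℕ} {s : State} (hs : Params n d s)
    {A : Matrix (Fin n) (Fin n) ℝ} (hA : A.IsSymm) {P : Prop} {S p₂ p₁ p₀ : ℕ}
    (hS : s.natReg 10 = S) (h16 : s.natReg 16 = p₂) (h17 : s.natReg 17 = p₁)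
    (h18 : s.natReg 18 = p₀) (hp₂ : p₂ + n * n ≤ S) (hp₁ : p₁ + n ≤ S)
    (hmat : MatAt s.realMem p₂ A) (hrow : ∀ i : Fin n, s.realMem (p₁ + i) = ∑ j, A i j)
    (hsum : s.realMem p₀ = ∑ i, ∑ j, A i j) (hP : Flag P s) :
    Runs blockProg s (blockTime n) fun s' => (∀ a < S, s'.realMem a = s.realMem a) ∧
      Flag (P ∧ ∀ x, 0 ≤ x ⬝ᵥ lorentzDefect A *ᵥ x) s' := by
  refine Runs.seq (Runs.straight rfl) fun s₁ hs₁ hF₁ => ?_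
  have c₁ := hs.of_frame hF₁
  have g10 : s₁.realReg 10 = -∑ i, ∑ j, A i j := by
    subst hs₁; simp [runList, Instr.run, h18, hsum]
  have g11 : s₁.realReg 11 = 1 := by
    subst hs₁; simp [runList, Instr.run]
  refine Runs.seq (runs_rankOneProg (src := p₂) (dst := S) (vec := p₁) c₁.toConsts ?_ ?_ ?_ hp₂ hp₁)
    fun s₂ hs₂ hF₂ => ?_
  · subst hs₁; simp [runList, Instr.run, h16, hs.r3]
  · subst hs₁; simp [runList, Instr.run, hS, hs.r3]
  · subst hs₁; simp [runList, Instr.run, h17, hs.r3]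
  obtain ⟨hlo, hnew⟩ := hs₂
  have c₂ := c₁.of_frame hF₂
  have hmat₂ : MatAt s₂.realMem S (lorentzDefect A) := fun i j => by
    rw [hnew _ (cell_lt i j), cell_div, cell_mod, g10, g11, hF₁.mem, hmat, hrow, hrow]
    simp only [lorentzDefect, of_apply]; ring
  have hP₂ : Flag P s₂ := hP.congr ((hF₂.nat 19).trans (hF₁.nat 19)) Iff.rfl
  refine Runs.seq (runs_elimProg c₂ ((hF₂.nat 10).trans ((hF₁.nat 10).trans hS)) hmat₂ hP₂)
    fun s₃ hs₃ hF₃ => ?_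
  have c₃ := c₂.of_frame hF₃
  refine (runs_zeroTestProg c₃ hs₃.r21 hs₃.flag).mono le_rfl fun s₄ hs₄ hF₄ => ⟨fun a ha => ?_, ?_⟩
  · rw [hF₄.mem, hs₃.lo a ha, hlo a ha, hF₁.mem]
  · refine hs₄.congr rfl ?_
    rw [nonneg_iff_eliminateFirst (lorentzDefect_isSymm hA), and_assoc]
    refine and_congr_right fun _ => and_congr ?_ ?_
    · exact ⟨fun h k => h k k.2, fun h k _ => h k⟩
    · constructor
      · intro h
        ext i j
        rw [← hs₃.mat i j]
        exact h _ (cell_lt i j)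
      · intro h a ha
        obtain ⟨i, j, rfl⟩ := exists_cell ha
        rw [hs₃.mat i j, h]; rfl

/-- Tests all blocks, the `b`-th of which has its matrix at `n² b`, the row sums at `n^(d+2) + n b`
and the total at `n^(d+2) + n^(d+1) + b`. -/
def checkProg : Program :=
  .seq (straight [.natConst 15 0, .natConst 16 0, .natAdd 17 7 3, .natAdd 18 7 6,
    .natConst 19 0]) <|
  .loop (.natLt 15 9) <|
    .seq blockProg <|
    straight [.natAdd 16 16 5, .natAdd 17 17 1, .natAdd 18 18 2, .natAdd 15 15 2]

/-- Cost of `checkProg`. -/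
def checkTime (n d : ℕ) : ℕ := 5 + (horner n 1 d * (blockTime n + 4 + 1) + 1)

theorem runs_checkProg {n d : ℕ} {s : State} (hs : Params n d s)
    (A : ℕ → Matrix (Fin n) (Fin n) ℝ) (hA : ∀ b < horner n 1 d, (A b).IsSymm)
    (hmat : ∀ b < horner n 1 d, MatAt s.realMem (n * n * b) (A b))
    (hrow : ∀ b < horner n 1 d, ∀ i : Fin n,
      s.realMem (n ^ (d + 2) + n * b + i) = ∑ j, A b i j)
    (hsum : ∀ b < horner n 1 d, s.realMem (n ^ (d + 2) + n ^ (d + 1) + b) = ∑ i, ∑ j, A b i j) :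
    Runs checkProg s (checkTime n d)
      (Flag (∀ b < horner n 1 d, ∀ x, 0 ≤ x ⬝ᵥ lorentzDefect (A b) *ᵥ x)) := by
  set S := n ^ (d + 2) + horner n 1 (d + 1) with hS
  refine Runs.seq (Runs.straight rfl) fun s₁ hs₁ hF₁ => ?_
  have c₁ := hs.of_frame hF₁
  refine (Runs.loop (K := horner n 1 d) (B := blockTime n + 4) (fun b s' =>
    s'.natReg 15 = b ∧ s'.natReg 16 = n * n * b ∧ s'.natReg 17 = n ^ (d + 2) + n * b ∧
    s'.natReg 18 = n ^ (d + 2) + n ^ (d + 1) + b ∧ (∀ a < S, s'.realMem a = s.realMem a) ∧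
    Flag (∀ b' < b, ∀ x, 0 ≤ x ⬝ᵥ lorentzDefect (A b') *ᵥ x) s') ?_ ?_ ?_).mono le_rfl
    fun s' hs' _ => hs'.2.2.2.2.2
  · subst hs₁
    refine ⟨?_, ?_, ?_, ?_, ?_, ?_⟩
    · simp [runList, Instr.run]
    · simp [runList, Instr.run]
    · simp [runList, Instr.run, hs.r7, hs.r3]
    · simp [runList, Instr.run, hs.r7, hs.r6]
    · simp [runList, Instr.run]
    · simp [Flag, runList, Instr.run]
  · rintro b hb s₂ ⟨h15, h16, h17, h18, hlo, hfl⟩ hF₂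
    have c₂ := c₁.of_frame hF₂
    refine ⟨by simpa [Test.Holds, h15, c₂.r9] using hb, ?_⟩
    -- the addresses of the block lie below `S`
    have hH : horner n 1 (d + 1) = n * horner n 1 d + 1 := rfl
    have h1 : n * b + n ≤ n * horner n 1 d := by
      rw [← Nat.mul_succ]; exact Nat.mul_le_mul_left n hb
    have h2 : n * n * b + n * n ≤ S := by
      have h3 := Nat.mul_le_mul_left n h1
      have h4 := sub_one_mul_horner n (d + 1)
      rw [hH, mul_add] at h4
      rw [mul_add, ← mul_assoc] at h3
      have h5 : n ^ (d + 1 + 1) = n ^ (d + 2) := rfl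
      omega
    have h3 : n ^ (d + 2) + n * b + n ≤ S := by omega
    have h4 : n ^ (d + 2) + n ^ (d + 1) + b < S := by
      have := sub_one_mul_horner n d
      omega
    refine Runs.seq (runs_blockProg c₂ (hA b hb) (S := S) c₂.r10 h16 h17 h18 h2 h3 ?_ ?_ ?_ hfl)
      fun s₃ hs₃ hF₃ => ?_
    · intro i j
      rw [hlo _ (by have := cell_lt i j; omega), hmat b hb]
    · intro i
      rw [hlo _ (by have := i.2; omega), hrow b hb]
    · rw [hlo _ h4, hsum b hb]
    have c₃ := c₂.of_frame hF₃
    refine Runs.straight ⟨?_, ?_, ?_, ?_, ?_, ?_⟩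
    · simp [runList, Instr.run, hF₃.nat 15, h15, c₃.r2]
    · simp [runList, Instr.run, hF₃.nat 16, h16, c₃.r5, mul_add]
    · simp [runList, Instr.run, hF₃.nat 17, h17, c₃.r1, mul_add, add_assoc]
    · simp [runList, Instr.run, hF₃.nat 18, h18, c₃.r2, add_assoc]
    · intro a ha
      simp only [runList, List.foldl, Instr.run]
      rw [hs₃.1 a ha, hlo a ha]
    · refine hs₃.2.congr (by simp [runList, Instr.run]) ?_
      constructor
      · rintro ⟨h5, h6⟩ b' hb'
        rcases Nat.lt_succ_iff_lt_or_eq.1 hb' with h7 | rfl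
        · exact h5 b' h7
        · exact h6
      · exact fun h5 => ⟨fun b' hb' => h5 b' (by omega), h5 b (Nat.lt_succ_self b)⟩
  · rintro s₂ ⟨h15, -⟩ hF₂
    simp [Test.Holds, h15, (c₁.of_frame hF₂).r9]

end RealRAM

/-! ### Multiplying the coefficients by factorials -/

namespace RealRAM

/-- How often `v` occurs among the lowest `m` digits of `h` in base `n`. -/
def digitCount (n m h v : ℕ) : ℕ := ∑ l ∈ Finset.range m, if h / n ^ l % n = v then 1 else 0

/-- The product of the factorials of the multiplicities of the lowest `m` digits of `h` in base
`n`, see `digitWeight_eq`; the recursion adds the digits one by one, the lowest one last. -/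
def digitWeight (n : ℕ) : ℕ → ℕ → ℕ
  | 0, _ => 1
  | m + 1, h => digitWeight n m (h / n) * (digitCount n m (h / n) (h % n) + 1)

/-- Real register `4` becomes one more than the number of `l < m` for which natural register
`40 + (j + 1 + l)` agrees with natural register `40 + j`. -/
def countProg (j : ℕ) : ℕ → Program
  | 0 => straight [.realConst 4 1, .realConst 5 1]
  | m + 1 => .seq (countProg j m) <|
    .cond (.natEq (40 + (j + 1 + m)) (40 + j)) (straight [.realAdd 4 4 5]) (straight [])

/-- The `j` innermost of `d` nested loops, through all values of the lowest `j` digits of the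
address. The digits are in natural registers `40, 41, …`, the address is in natural register `11`,
and real register `20 + l` holds the weight of the digits from the `l`-th on. -/
def nestProg (d : ℕ) : ℕ → Program
  | 0 => straight [.realLoad 3 11, .realMul 3 3 20, .realStore 11 3, .natAdd 11 11 2]
  | j + 1 => .seq (straight [.natConst (40 + j) 0]) <|
    .loop (.natLt (40 + j) 1) <|
      .seq (countProg j (d - (j + 1))) <|
      .seq (straight [.realMul (20 + j) (20 + (j + 1)) 4]) <|
      .seq (nestProg d j) <|
      straight [.natAdd (40 + j) (40 + j) 2]

/-- Cost of `nestProg`. -/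
def nestTime (n d : ℕ) : ℕ → ℕ
  | 0 => 4
  | j + 1 => 1 + (n * (2 + (d - (j + 1)) * 2 + (1 + (nestTime n d j + 1)) + 1) + 1)

theorem all_countProg (P : Instr → Bool) (j m : ℕ) (h4 : P (.realConst 4 1) = true)
    (h5 : P (.realConst 5 1) = true) (h45 : P (.realAdd 4 4 5) = true) :
    (countProg j m).all P = true := by
  induction m with
  | zero => simp [countProg, straight, Program.all, h4, h5]
  | succ m ih => simp [countProg, straight, Program.all, ih, h45]

theorem all_nestProg (P : Instr → Bool) (d j : ℕ) (h4 : P (.realConst 4 1) = true)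
    (h5 : P (.realConst 5 1) = true) (h45 : P (.realAdd 4 4 5) = true)
    (h3 : P (.realLoad 3 11) = true) (h33 : P (.realMul 3 3 20) = true)
    (hst : P (.realStore 11 3) = true) (h11 : P (.natAdd 11 11 2) = true)
    (hl : ∀ l < j, P (.natConst (40 + l) 0) = true ∧ P (.natAdd (40 + l) (40 + l) 2) = true ∧
      P (.realMul (20 + l) (20 + (l + 1)) 4) = true) : (nestProg d j).all P = true := by
  induction j with
  | zero => simp [nestProg, straight, Program.all, h3, h33, hst, h11]
  | succ j ih =>
    obtain ⟨h6, h7, h8⟩ := hl j (Nat.lt_succ_self j)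
    simp [nestProg, straight, Program.all, ih fun l hlj => hl l (by omega),
      all_countProg P _ _ h4 h5 h45, h6, h7, h8]

theorem keepsNat_nestProg {d j r : ℕ} (hr : r ≠ 11) (hr' : r < 40 ∨ 40 + j ≤ r) :
    (nestProg d j).all (Instr.keepsNat r) = true := by
  refine all_nestProg _ d j rfl rfl rfl rfl rfl rfl ?_ fun l hl => ?_ <;>
    simp only [Instr.keepsNat, bne_iff_ne, and_true] <;> omega

theorem keepsReal_nestProg {d j r : ℕ} (hr : 20 + j ≤ r) :
    (nestProg d j).all (Instr.keepsReal r) = true := by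
  refine all_nestProg _ d j ?_ ?_ ?_ ?_ ?_ rfl rfl fun l hl => ?_ <;>
    simp only [Instr.keepsReal, bne_iff_ne, true_and] <;> omega

theorem runs_countProg {n j h v : ℕ} {s : State} (hv : s.natReg (40 + j) = v) (m : ℕ)
    (hdig : ∀ l < m, s.natReg (40 + (j + 1 + l)) = h / n ^ l % n) :
    Runs (countProg j m) s (2 + m * 2) fun s' =>
      s'.realReg 4 = digitCount n m h v + 1 ∧ s'.realReg 5 = 1 := by
  have hk : ∀ m r, (countProg j m).all (Instr.keepsNat r) = true := fun m r =>
    all_countProg _ _ _ rfl rfl rfl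
  induction m with
  | zero =>
    refine (Runs.straight (l := [.realConst 4 1, .realConst 5 1]) rfl).mono (by simp) ?_
    rintro _ rfl -
    simp [runList, Instr.run, digitCount]
  | succ m ih =>
    refine (Runs.seq (ih fun l hl => hdig l (by omega)) fun s₁ hs₁ hF₁ => Runs.cond (T := 1)
      (Q := fun s' => s'.realReg 4 = digitCount n (m + 1) h v + 1 ∧ s'.realReg 5 = 1)
      (fun hc => Runs.mono (Runs.straight (l := [.realAdd 4 4 5]) rfl) le_rfl ?_)
      (fun hc => Runs.mono (Runs.straight (l := []) rfl) zero_le_one ?_)).mono ?_ fun _ h _ => h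
    · rintro _ rfl -
      simp only [Test.Holds, hF₁.nat _ (hk _ _), hdig m (Nat.lt_succ_self m), hv] at hc
      rw [digitCount, Finset.sum_range_succ, if_pos hc, ← digitCount]
      simp [runList, Instr.run, hs₁.1, hs₁.2]
    · rintro _ rfl -
      simp only [Test.Holds, hF₁.nat _ (hk _ _), hdig m (Nat.lt_succ_self m), hv] at hc
      rw [digitCount, Finset.sum_range_succ, if_neg hc, ← digitCount]
      simp [runList, hs₁.1, hs₁.2]
    · rw [add_mul]; omega

/-- The outer loops have fixed the digits from the `j`-th on, those of the number `h`; the cells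
whose addresses have these upper digits are multiplied by their weights. -/
theorem runs_nestProg {n d j h : ℕ} {s : State} (hj : j ≤ d) (h1 : s.natReg 1 = n)
    (h2 : s.natReg 2 = 1) (h11 : s.natReg 11 = h * n ^ j)
    (hdig : ∀ m < d - j, s.natReg (40 + (j + m)) = h / n ^ m % n)
    (hw : s.realReg (20 + j) = digitWeight n (d - j) h) :
    Runs (nestProg d j) s (nestTime n d j) fun s' => s'.natReg 11 = (h + 1) * n ^ j ∧
      ∀ a, s'.realMem a = if h * n ^ j ≤ a ∧ a < (h + 1) * n ^ j then
        s.realMem a * digitWeight n d a else s.realMem a := by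
  induction j generalizing h s with
  | zero =>
    simp only [pow_zero, mul_one, Nat.sub_zero, add_zero] at *
    refine Runs.straight ⟨?_, fun a => ?_⟩
    · simp [runList, Instr.run, h11, h2]
    · simp only [runList, List.foldl, Instr.run, Function.update_apply]
      by_cases ha : a = h
      · subst ha
        simp [h11, hw]
      · have : ¬ (h ≤ a ∧ a < h + 1) := by omega
        rw [if_neg (by rw [h11]; exact ha), if_neg this]
  | succ j ih =>
    refine Runs.seq (Runs.straight rfl) fun s₁ hs₁ hF₁ => ?_
    have hbody : ∀ r, r ≠ 11 → (r < 40 ∨ 40 + (j + 1) ≤ r) →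
        (Program.seq (countProg j (d - (j + 1))) <|
          .seq (straight [.realMul (20 + j) (20 + (j + 1)) 4]) <|
          .seq (nestProg d j) <|
          straight [.natAdd (40 + j) (40 + j) 2]).all (Instr.keepsNat r) = true := by
      intro r hr hr'
      simp only [Program.all, straight, List.foldr, Bool.and_eq_true,
        all_countProg (Instr.keepsNat r) j _ rfl rfl rfl,
        keepsNat_nestProg (d := d) (j := j) hr (by omega), Instr.keepsNat, bne_iff_ne, and_true,
        true_and]
      omega
    have hbody' : (Program.seq (countProg j (d - (j + 1))) <|
          .seq (straight [.realMul (20 + j) (20 + (j + 1)) 4]) <|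
          .seq (nestProg d j) <|
          straight [.natAdd (40 + j) (40 + j) 2]).all (Instr.keepsReal (20 + (j + 1))) = true := by
      have hc : (countProg j (d - (j + 1))).all (Instr.keepsReal (20 + (j + 1))) = true := by
        refine all_countProg _ j _ ?_ ?_ ?_ <;> simp only [Instr.keepsReal, bne_iff_ne] <;> omega
      simp only [Program.all, straight, List.foldr, Bool.and_eq_true, hc,
        keepsReal_nestProg (d := d) (j := j) (r := 20 + (j + 1)) (by omega), Instr.keepsReal,
        bne_iff_ne, and_true, true_and]
      omega
    have hs₁n : ∀ r, r ≠ 40 + j → s₁.natReg r = s.natReg r := fun r hr => by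
      subst hs₁
      simp [runList, Instr.run, hr]
    have hs₁r : s₁.realReg = s.realReg := by subst hs₁; rfl
    have hs₁m : s₁.realMem = s.realMem := by subst hs₁; rfl
    have hpow : n ^ (j + 1) = n * n ^ j := pow_succ' n j
    let I : ℕ → State → Prop := fun i s' => s'.natReg (40 + j) = i ∧
      s'.natReg 11 = (h * n + i) * n ^ j ∧
      ∀ a, s'.realMem a = if h * n ^ (j + 1) ≤ a ∧ a < (h * n + i) * n ^ j then
        s.realMem a * digitWeight n d a else s.realMem a
    refine (Runs.loop (K := n) I ?_ ?_ ?_).mono le_rfl ?_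
    · refine ⟨by subst hs₁; simp [runList, Instr.run], ?_, fun a => ?_⟩
      · rw [hs₁n 11 (by omega), h11, hpow]; ring
      · rw [hs₁m, if_neg]
        rw [hpow, add_zero, mul_assoc]
        omega
    · rintro i hi s₂ ⟨h40, h11₂, hmem₂⟩ hF₂
      have hk₂ : ∀ r, r ≠ 11 → (r < 40 ∨ 40 + (j + 1) ≤ r) → s₂.natReg r = s.natReg r :=
        fun r hr hr' => by
          rw [hF₂.nat r (hbody r hr hr'), hs₁n r (by omega)]
      refine ⟨by simpa [Test.Holds, h40, hk₂ 1 (by omega) (by omega), h1] using hi, ?_⟩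
      have hn : 0 < n := by omega
      have hdig₂ : ∀ m < d - (j + 1), s₂.natReg (40 + (j + 1 + m)) = h / n ^ m % n := fun m hm => by
        rw [hk₂ _ (by omega) (by omega), hdig m hm]
      refine Runs.seq (runs_countProg h40 _ hdig₂) fun s₃ hs₃ hF₃ => ?_
      refine Runs.seq (Runs.straight rfl) fun s₄ hs₄ hF₄ => ?_
      have hnat₄ : ∀ r, s₄.natReg r = s₂.natReg r := fun r => by
        rw [← hF₃.nat r (all_countProg _ _ _ rfl rfl rfl)]
        subst hs₄
        simp [runList, Instr.run]
      have hmem₄ : s₄.realMem = s₂.realMem := by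
        rw [← hF₃.mem (all_countProg _ _ _ rfl rfl rfl)]
        subst hs₄
        simp [runList, Instr.run]
      have hdj : d - j = d - (j + 1) + 1 := by omega
      have hq : (h * n + i) / n = h := by
        rw [mul_comm, Nat.mul_add_div hn, Nat.div_eq_of_lt hi, add_zero]
      have hr : (h * n + i) % n = i := by
        rw [mul_comm, Nat.mul_add_mod, Nat.mod_eq_of_lt hi]
      have hw₄ : s₄.realReg (20 + j) = digitWeight n (d - j) (h * n + i) := by
        have e : s₃.realReg (20 + (j + 1)) = digitWeight n (d - (j + 1)) h := by
          rw [hF₃.real _ (all_countProg _ _ _ (by simp [Instr.keepsReal]; omega)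
            (by simp [Instr.keepsReal]; omega) (by simp [Instr.keepsReal]; omega)),
            hF₂.real _ hbody', hs₁r, hw]
        rw [hdj, digitWeight, hq, hr]
        subst hs₄
        simp [runList, Instr.run, e, hs₃.1]
      refine Runs.seq (ih (s := s₄) (h := h * n + i) (by omega)
        (by rw [hnat₄, hk₂ 1 (by omega) (by omega), h1])
        (by rw [hnat₄, hk₂ 2 (by omega) (by omega), h2]) (by rw [hnat₄, h11₂]) ?_ hw₄)
        fun s₅ hs₅ hF₅ => ?_
      · intro m hm
        rw [hnat₄]
        cases m with
        | zero => rw [add_zero, h40, pow_zero, Nat.div_one, hr]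
        | succ m =>
          rw [pow_succ', ← Nat.div_div_eq_div_mul, hq, ← hdig₂ m (by omega)]
          congr 1
          ring
      · have h40₅ : s₅.natReg (40 + j) = i := by
          rw [hF₅.nat _ (keepsNat_nestProg (by omega) (by omega)), hnat₄, h40]
        have h2₅ : s₅.natReg 2 = 1 := by
          rw [hF₅.nat _ (keepsNat_nestProg (by omega) (by omega)), hnat₄,
            hk₂ 2 (by omega) (by omega), h2]
        refine Runs.straight ⟨?_, ?_, fun a => ?_⟩
        · simp [runList, Instr.run, h40₅, h2₅]
        · have e : 11 ≠ 40 + j := by omega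
          simp [runList, Instr.run, hs₅.1, add_assoc, e]
        · simp only [runList, List.foldl, Instr.run]
          rw [hs₅.2 a, hmem₄, hmem₂ a, hpow]
          have e1 : (h * n + (i + 1)) * n ^ j = (h * n + i) * n ^ j + n ^ j := by ring
          have e2 : (h * n + i + 1) * n ^ j = (h * n + i) * n ^ j + n ^ j := by ring
          have e3 : h * (n * n ^ j) ≤ (h * n + i) * n ^ j := by
            rw [← mul_assoc]; exact Nat.mul_le_mul_right _ (by omega)
          rw [e1, e2]
          by_cases ha : (h * n + i) * n ^ j ≤ a
          · have h3 : ¬ (h * (n * n ^ j) ≤ a ∧ a < (h * n + i) * n ^ j) := by omega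
            rw [if_neg h3]
            by_cases ha' : a < (h * n + i) * n ^ j + n ^ j
            · rw [if_pos ⟨ha, ha'⟩, if_pos ⟨by omega, ha'⟩]
            · rw [if_neg (by omega), if_neg (by omega)]
          · rw [if_neg (by omega)]
            by_cases ha' : h * (n * n ^ j) ≤ a
            · rw [if_pos ⟨ha', by omega⟩, if_pos ⟨ha', by omega⟩]
            · rw [if_neg (by omega), if_neg (by omega)]
    · rintro s₂ ⟨h40, -⟩ hF₂
      simp [Test.Holds, h40, hF₂.nat 1 (hbody 1 (by omega) (by omega)), hs₁n 1 (by omega), h1]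
    · rintro s₂ ⟨-, h11₂, hmem₂⟩ -
      have e : (h + 1) * n ^ (j + 1) = (h * n + n) * n ^ j := by rw [hpow]; ring
      rw [e]
      exact ⟨h11₂, hmem₂⟩

end RealRAM

/-! ### The array of partial derivatives and its contractions -/

namespace CLC

open Matrix

variable {n : ℕ}

theorem dirD_one (f : MvPolynomial (Fin n) ℝ) : dirD 1 f = ∑ i, pderiv i f := by
  simp [dirD_apply]

/-- The constant `∂_{i₁} ⋯ ∂_{iₘ} D_1^{d-m} f` for the word `L = i₁ ⋯ iₘ`. -/
noncomputable def contraction (d : ℕ) (f : MvPolynomial (Fin n) ℝ) (L : List (Fin n)) : ℝ :=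
  coeff 0 (dirDs (onesThenUnits (d - L.length) L) f)

theorem dirDs_onesThenUnits_cons (k : ℕ) (i : Fin n) (L : List (Fin n))
    (f : MvPolynomial (Fin n) ℝ) :
    dirDs (onesThenUnits k (i :: L)) f = pderiv i (dirDs (onesThenUnits k L) f) := by
  rw [onesThenUnits, onesThenUnits, dirDs_append, dirDs_append, List.map_cons, dirDs_cons,
    dirD_single, pderiv_dirDs_comm, pderiv_dirDs_comm, pderiv_dirDs_comm]

/-- Since `D_1 = ∑ ∂ᵢ`, the contractions for words of length `m` are sums of `n` contractions for
words of length `m + 1`. -/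
theorem contraction_eq_sum (d : ℕ) (f : MvPolynomial (Fin n) ℝ) {L : List (Fin n)}
    (hL : L.length < d) : contraction d f L = ∑ i, contraction d f (i :: L) := by
  have h1 : d - L.length = d - (L.length + 1) + 1 := by omega
  simp only [contraction, List.length_cons, dirDs_onesThenUnits_cons]
  rw [h1, onesThenUnits, List.replicate_succ, List.cons_append, dirDs_cons, dirD_one, coeff_sum]
  rfl

theorem hessian_dirDs_onesThenUnits {d : ℕ} (f : MvPolynomial (Fin n) ℝ) (L : List (Fin n))
    (i j : Fin n) : hessian (dirDs (onesThenUnits (d - 2 - L.length) L) f) 0 i j =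
      contraction d f (i :: j :: L) := by
  rw [hessian_apply, contraction, dirDs_onesThenUnits_cons, dirDs_onesThenUnits_cons,
    List.length_cons, List.length_cons, eval_zero, constantCoeff_eq]
  congr 6
  omega

/-- The exponent vector of the monomial given by a word. -/
noncomputable def wordExp (L : List (Fin n)) : Fin n →₀ ℕ :=
  (L.map fun i => Finsupp.single i 1).sum

/-- The product of the factorials of the exponents. -/
def multiFactorial (β : Fin n →₀ ℕ) : ℕ := ∏ i, (β i).factorial

theorem multiFactorial_add_single (β : Fin n →₀ ℕ) (i : Fin n) :
    multiFactorial (β + Finsupp.single i 1) = multiFactorial β * (β i + 1) := by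
  rw [multiFactorial, multiFactorial, ← Finset.mul_prod_erase _ _ (Finset.mem_univ i),
    ← Finset.mul_prod_erase _ (fun j => (β j).factorial) (Finset.mem_univ i)]
  have h1 : ∏ j ∈ Finset.univ.erase i, ((β + Finsupp.single i 1 : Fin n →₀ ℕ) j).factorial =
      ∏ j ∈ Finset.univ.erase i, (β j).factorial :=
    Finset.prod_congr rfl fun j hj => by
      rw [Finsupp.add_apply, Finsupp.single_eq_of_ne (Finset.ne_of_mem_erase hj), add_zero]
  rw [h1, Finsupp.add_apply, Finsupp.single_eq_same, Nat.factorial_succ]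
  ring

/-- A derivative along a word multiplies each coefficient by a quotient of products of factorials.
-/
theorem coeff_dirDs_units (f : MvPolynomial (Fin n) ℝ) (L : List (Fin n)) (β : Fin n →₀ ℕ) :
    coeff β (dirDs (L.map fun i => Pi.single i 1) f) * multiFactorial β =
      coeff (β + wordExp L) f * multiFactorial (β + wordExp L) := by
  induction L generalizing β with
  | nil => simp [wordExp, dirDs_nil]
  | cons i L ih =>
    have h1 := ih (β + Finsupp.single i 1)
    rw [multiFactorial_add_single β i] at h1
    rw [List.map_cons, dirDs_cons, dirD_single, coeff_pderiv,
      show wordExp (i :: L) = Finsupp.single i 1 + wordExp L from rfl, ← add_assoc, ← h1]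
    push_cast
    ring

theorem contraction_eq_coeff (f : MvPolynomial (Fin n) ℝ) (L : List (Fin n)) :
    contraction L.length f L = coeff (wordExp L) f * multiFactorial (wordExp L) := by
  have h1 := coeff_dirDs_units f L 0
  rw [zero_add] at h1
  rw [← h1, contraction, Nat.sub_self, onesThenUnits]
  simp [multiFactorial]

/-! ### Words as numbers in base `n` -/

section Words

variable [NeZero n]

/-- The word of length `m` whose letters are the lowest `m` digits of `t` in base `n`, the lowest
one first. -/
def wordOf (n : ℕ) [NeZero n] : ℕ → ℕ → List (Fin n)
  | 0, _ => []
  | m + 1, t => Fin.ofNat n t :: wordOf n m (t / n)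

theorem length_wordOf (m t : ℕ) : (wordOf n m t).length = m := by
  induction m generalizing t with
  | zero => rfl
  | succ m ih => rw [wordOf, List.length_cons, ih]

theorem wordOf_succ (m t : ℕ) (i : Fin n) :
    wordOf n (m + 1) (n * t + i) = i :: wordOf n m t := by
  have h1 : (n * t + i) / n = t := by
    rw [Nat.mul_add_div (Nat.pos_of_neZero n), Nat.div_eq_of_lt i.2, add_zero]
  have h2 : Fin.ofNat n (n * t + i) = i := by
    ext
    rw [Fin.val_ofNat, Nat.mul_add_mod, Nat.mod_eq_of_lt i.2]
  rw [wordOf, h1, h2]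

theorem exists_wordOf_eq (L : List (Fin n)) : ∃ t < n ^ L.length, wordOf n L.length t = L := by
  induction L with
  | nil => exact ⟨0, by simp, rfl⟩
  | cons i L ih =>
    obtain ⟨t, ht, h⟩ := ih
    refine ⟨n * t + i, ?_, ?_⟩
    · have h1 : n * t + n ≤ n * n ^ L.length := by
        rw [← Nat.mul_succ]; exact Nat.mul_le_mul_left n ht
      rw [List.length_cons, pow_succ']
      have := i.2
      omega
    · rw [List.length_cons, wordOf_succ, h]

theorem digitCount_eq (m t : ℕ) (v : Fin n) :
    RealRAM.digitCount n m t v = wordExp (wordOf n m t) v := by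
  induction m generalizing t with
  | zero => simp [RealRAM.digitCount, wordOf, wordExp]
  | succ m ih =>
    have h1 : wordExp (wordOf n (m + 1) t) =
        Finsupp.single (Fin.ofNat n t) 1 + wordExp (wordOf n m (t / n)) := rfl
    rw [h1, Finsupp.add_apply, ← ih, RealRAM.digitCount, Finset.sum_range_succ', add_comm]
    congr 1
    · rw [pow_zero, Nat.div_one, Finsupp.single_apply]
      exact if_congr (by rw [Fin.ext_iff, Fin.val_ofNat]) rfl rfl
    · refine Finset.sum_congr rfl fun l _ => ?_
      rw [pow_succ', Nat.div_div_eq_div_mul]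

theorem digitWeight_eq (m t : ℕ) :
    RealRAM.digitWeight n m t = multiFactorial (wordExp (wordOf n m t)) := by
  induction m generalizing t with
  | zero => simp [RealRAM.digitWeight, wordOf, wordExp, multiFactorial]
  | succ m ih =>
    have h1 : wordExp (wordOf n (m + 1) t) =
        wordExp (wordOf n m (t / n)) + Finsupp.single (Fin.ofNat n t) 1 := add_comm _ _
    have h2 : t % n = (Fin.ofNat n t : Fin n) := (Fin.val_ofNat n t).symm
    rw [RealRAM.digitWeight, h1, multiFactorial_add_single, ih, h2, digitCount_eq]

theorem sum_single_eq_wordExp (d t : ℕ) :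
    ∑ j : Fin d, Finsupp.single (Fin.ofNat n (t / n ^ (j : ℕ))) 1 = wordExp (wordOf n d t) := by
  induction d generalizing t with
  | zero => simp [wordOf, wordExp]
  | succ d ih =>
    have h1 : wordExp (wordOf n (d + 1) t) =
        Finsupp.single (Fin.ofNat n t) 1 + wordExp (wordOf n d (t / n)) := rfl
    rw [h1, Fin.sum_univ_succ, ← ih]
    simp only [Fin.val_zero, pow_zero, Nat.div_one, Fin.val_succ, pow_succ',
      ← Nat.div_div_eq_div_mul]

theorem input_realMem (d : ℕ) (f : MvPolynomial (Fin n) ℝ) {k : ℕ} (hk : k < n ^ d) :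
    (RealRAM.input d n f).realMem k = coeff (wordExp (wordOf n d k)) f := by
  simp only [RealRAM.input, dif_pos hk]
  rw [← sum_single_eq_wordExp]
  congr 1

/-! ### The levels of the memory -/

open RealRAM

/-- The first address of the contractions for words of length `m`. -/
def level (n d m : ℕ) : ℕ := ∑ i ∈ Finset.Ioc m d, n ^ i

theorem level_self (n d : ℕ) : level n d d = 0 := by simp [level]

theorem level_succ {n d m : ℕ} (h : m ≤ d) : level n (d + 1) m = n ^ (d + 1) + level n d m := by
  rw [level, Finset.sum_Ioc_succ_top h, add_comm]; rfl

/-- The successors `n t, …, n t + n - 1` of the cell for a word are the cells for its extensions by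
a letter. -/
theorem level_succ_succ {n d m : ℕ} (h : m ≤ d) :
    level n (d + 1) (m + 1) = n * level n d m := by
  induction d, h using Nat.le_induction with
  | base => simp [level_self]
  | succ d h ih =>
    rw [level_succ (by omega), ih, level_succ h, mul_add, pow_succ' n (d + 1)]

theorem horner_one_succ (n d : ℕ) : horner n 1 (d + 1) = n ^ (d + 1) + horner n 1 d := by
  have := sub_one_mul_horner n d
  rw [horner]; omega

theorem level_add_lt {n d m t : ℕ} (h : m ≤ d) (ht : t < n ^ m) :
    level n d m + t < horner n 1 d := by
  induction d, h using Nat.le_induction with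
  | base =>
    rw [level_self, zero_add]
    refine ht.trans_le ?_
    cases m with
    | zero => simp [horner]
    | succ m => rw [horner_one_succ]; omega
  | succ d h ih =>
    rw [level_succ h, horner_one_succ]
    omega

/-- Every `b` below `n^d + ⋯ + 1` lies in one of the levels. -/
theorem exists_level {n d b : ℕ} (hb : b < horner n 1 d) :
    ∃ m ≤ d, ∃ t < n ^ m, b = level n d m + t := by
  induction d generalizing b with
  | zero =>
    simp only [horner, Nat.lt_one_iff] at hb
    exact ⟨0, le_rfl, 0, by simp, by simp [hb, level_self]⟩
  | succ d ih =>
    by_cases h : b < n ^ (d + 1)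
    · exact ⟨d + 1, le_rfl, b, h, by simp [level_self]⟩
    · rw [horner_one_succ] at hb
      obtain ⟨m, hm, t, ht, h1⟩ := ih (b := b - n ^ (d + 1)) (by omega)
      exact ⟨m, by omega, t, ht, by rw [level_succ hm]; omega⟩

/-- A memory that starts with the derivatives of order `d + 1` and is continued by summing
consecutive groups of `n` cells contains all contractions, ordered by decreasing word length. -/
theorem realMem_level {d : ℕ} {f : MvPolynomial (Fin n) ℝ} {mem : ℕ → ℝ}
    (h0 : ∀ k < n ^ (d + 1), mem k = contraction (d + 1) f (wordOf n (d + 1) k))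
    (h1 : ∀ t < horner n 1 d, mem (n ^ (d + 1) + t) = ∑ i ∈ Finset.range n, mem (n * t + i))
    {m t : ℕ} (hm : m ≤ d + 1) (ht : t < n ^ m) :
    mem (level n (d + 1) m + t) = contraction (d + 1) f (wordOf n m t) := by
  obtain ⟨k, hk⟩ : ∃ k, m + k = d + 1 := ⟨d + 1 - m, by omega⟩
  induction k generalizing m t with
  | zero =>
    obtain rfl : m = d + 1 := by omega
    rw [level_self, zero_add, h0 t ht]
  | succ k ih =>
    have hmd : m ≤ d := by omega
    rw [level_succ hmd, add_assoc, h1 _ (level_add_lt hmd ht), contraction_eq_sum _ _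
      (by rw [length_wordOf]; omega), Finset.sum_range]
    refine Finset.sum_congr rfl fun i _ => ?_
    rw [mul_add, ← level_succ_succ hmd, add_assoc, ← wordOf_succ]
    refine ih (by omega) ?_ (by omega)
    have h2 : n * t + n ≤ n * n ^ m := by
      rw [← Nat.mul_succ]; exact Nat.mul_le_mul_left n ht
    rw [pow_succ']
    have := i.2
    omega

/-- The `b`-th block of `n²` consecutive cells. -/
def blockMatrix (n : ℕ) (mem : ℕ → ℝ) (b : ℕ) : Matrix (Fin n) (Fin n) ℝ :=
  Matrix.of fun i j => mem (n * n * b + (n * i + j))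

theorem blockMatrix_level {d : ℕ} {f : MvPolynomial (Fin n) ℝ} {mem : ℕ → ℝ}
    (h0 : ∀ k < n ^ (d + 2), mem k = contraction (d + 2) f (wordOf n (d + 2) k))
    (h1 : ∀ t < horner n 1 (d + 1), mem (n ^ (d + 2) + t) = ∑ i ∈ Finset.range n, mem (n * t + i))
    {m t : ℕ} (hm : m ≤ d) (ht : t < n ^ m) :
    blockMatrix n mem (level n d m + t) =
      hessian (dirDs (onesThenUnits (d + 2 - 2 - (wordOf n m t).length) (wordOf n m t)) f) 0 := by
  rw [← hessian_isSymm]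
  ext i j
  rw [transpose_apply, hessian_dirDs_onesThenUnits, ← wordOf_succ, ← wordOf_succ,
    ← realMem_level (d := d + 1) h0 h1 (by omega), level_succ_succ (by omega), level_succ_succ hm,
    blockMatrix, of_apply]
  · congr 1
    ring
  · have h2 : n * t + n ≤ n * n ^ m := by
      rw [← Nat.mul_succ]; exact Nat.mul_le_mul_left n ht
    have h3 : n * (n * t + i) + n ≤ n * (n * n ^ m) := by
      rw [← Nat.mul_succ]
      exact Nat.mul_le_mul_left n (by have := i.2; omega)
    rw [pow_succ', pow_succ']
    have := j.2
    omega

theorem hasLorentzianContractions_iff_blocks {d : ℕ} {f : MvPolynomial (Fin n) ℝ} {mem : ℕ → ℝ}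
    (hf : IsNonnegForm (d + 2) f)
    (h0 : ∀ k < n ^ (d + 2), mem k = contraction (d + 2) f (wordOf n (d + 2) k))
    (h1 : ∀ t < horner n 1 (d + 1), mem (n ^ (d + 2) + t) = ∑ i ∈ Finset.range n, mem (n * t + i)) :
    (∀ b < horner n 1 d, (blockMatrix n mem b).IsSymm) ∧
    (HasLorentzianContractions (d + 2) f ↔
      ∀ b < horner n 1 d, ∀ x, 0 ≤ x ⬝ᵥ lorentzDefect (blockMatrix n mem b) *ᵥ x) := by
  have hsymm : ∀ b < horner n 1 d, (blockMatrix n mem b).IsSymm := fun b hb => by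
    obtain ⟨m, hm, t, ht, rfl⟩ := exists_level hb
    rw [blockMatrix_level h0 h1 hm ht]
    exact hessian_isSymm _ _
  have hiff : ∀ m ≤ d, ∀ t < n ^ m,
      (AtMostOnePos (hessian (dirDs (onesThenUnits (d + 2 - 2 - (wordOf n m t).length)
        (wordOf n m t)) f) 0) ↔
      ∀ x, 0 ≤ x ⬝ᵥ lorentzDefect (blockMatrix n mem (level n d m + t)) *ᵥ x) :=
    fun m hm t ht => by
      rw [blockMatrix_level h0 h1 hm ht]
      exact atMostOnePos_iff_lorentzDefect (hessian_isSymm _ _)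
        ((hf.dirDs (onesThenUnits_nonneg _ _)).hessian_nonneg fun _ => le_rfl)
  refine ⟨hsymm, fun h b hb => ?_, fun h L hL => ?_⟩
  · obtain ⟨m, hm, t, ht, rfl⟩ := exists_level hb
    exact (hiff m hm t ht).1 (h _ (by rw [length_wordOf]; omega))
  · obtain ⟨t, ht, hw⟩ := exists_wordOf_eq L
    have h2 := (hiff L.length (by omega) t ht).2 (h _ (level_add_lt (by omega) ht))
    rwa [hw] at h2

end Words

end CLC

/-! ### The running time -/

namespace RealRAM

theorem horner_one_le (n k : ℕ) : horner n 1 k ≤ (n + 1) ^ k := by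
  induction k with
  | zero => rfl
  | succ k ih =>
    rw [horner, pow_succ']
    have h1 := Nat.mul_le_mul_left n ih
    have h2 : 1 ≤ (n + 1) ^ k := Nat.one_le_pow _ _ n.succ_pos
    rw [add_mul, one_mul]
    omega

/-- The additive constant makes the bound inductive: one more loop multiplies it by at most `n + 1`.
-/
theorem nestTime_le (n d j : ℕ) : nestTime n d j + (2 * d + 6) ≤ (n + 1) ^ j * (2 * d + 10) := by
  have h0 : ∀ j, 2 ≤ nestTime n d j := fun j => by cases j <;> simp only [nestTime] <;> omega
  induction j with
  | zero => simp only [nestTime, pow_zero, one_mul]; omega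
  | succ j ih =>
    have h1 : n * (2 + (d - (j + 1)) * 2 + (1 + (nestTime n d j + 1)) + 1) ≤
        n * (nestTime n d j + (2 * d + 6)) := Nat.mul_le_mul_left n (by omega)
    have h2 := Nat.mul_le_mul_left (n + 1) ih
    have h3 := h0 j
    rw [← mul_assoc, ← pow_succ', add_mul n 1 (_ + _), one_mul] at h2
    rw [nestTime]
    omega

theorem setupTime_le (n d : ℕ) : setupTime n d ≤ (20 * d + 43) * (n + 1) := by
  simp only [setupTime, hornerTime]
  nlinarith [Nat.zero_le (d * n), Nat.zero_le n]

theorem fillTime_le (n d : ℕ) : fillTime n d ≤ 11 * (n + 1) ^ (d + 2) := by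
  have h1 := Nat.mul_le_mul_right (n * 5 + 7) (horner_one_le n (d + 1))
  have h2 : 1 ≤ (n + 1) ^ (d + 2) := Nat.one_le_pow _ _ n.succ_pos
  have h3 : (n + 1) ^ (d + 1) * (n * 5 + 7) ≤ (n + 1) ^ (d + 1) * (7 * (n + 1)) :=
    Nat.mul_le_mul_left _ (by omega)
  have h4 : (n + 1) ^ (d + 1) * (7 * (n + 1)) = 7 * (n + 1) ^ (d + 2) := by ring
  have h5 : fillTime n d = 4 + horner n 1 (d + 1) * (n * 5 + 7) := by rw [fillTime]; ring
  omega

theorem blockTime_le (n : ℕ) : blockTime n ≤ 19 * (n + 1) ^ 3 := by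
  have h : blockTime n + (8 * n ^ 3 + 32 * n ^ 2 + 27 * n) = 19 * (n + 1) ^ 3 := by
    simp only [blockTime, elimTime, pivotTime, rankOneTime, zeroTestTime]
    ring
  omega

theorem checkTime_le (n d : ℕ) : checkTime n d ≤ 30 * (n + 1) ^ (d + 3) := by
  have h0 : 1 ≤ (n + 1) ^ 3 := Nat.one_le_pow _ _ n.succ_pos
  have h1 : horner n 1 d * (blockTime n + 4 + 1) ≤ (n + 1) ^ d * (24 * (n + 1) ^ 3) :=
    Nat.mul_le_mul (horner_one_le n d) (by have := blockTime_le n; omega)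
  have h2 : 1 ≤ (n + 1) ^ (d + 3) := Nat.one_le_pow _ _ n.succ_pos
  have h3 : (n + 1) ^ d * (24 * (n + 1) ^ 3) = 24 * (n + 1) ^ (d + 3) := by ring
  rw [checkTime]
  omega

/-- Cost of `lorentzianProg`. -/
def lorentzianTime (n d : ℕ) : ℕ :=
  setupTime n d + (2 + (nestTime n (d + 2) (d + 2) + (fillTime n d + (checkTime n d + 1)))) + 1

theorem lorentzianTime_le (n d : ℕ) :
    lorentzianTime n d ≤ (22 * d + 102) * (n + 1) ^ (d + 3) := by
  have h1 := setupTime_le n d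
  have h2 := nestTime_le n (d + 2) (d + 2)
  have h3 := fillTime_le n d
  have h4 := checkTime_le n d
  have h5 : n + 1 ≤ (n + 1) ^ (d + 3) := Nat.le_self_pow (by omega) _
  have h6 : (n + 1) ^ (d + 2) ≤ (n + 1) ^ (d + 3) :=
    Nat.pow_le_pow_right n.succ_pos (by omega)
  have h7 := Nat.mul_le_mul_left (20 * d + 43) h5
  have h8 := Nat.mul_le_mul_right (2 * (d + 2) + 10) h6
  rw [lorentzianTime]
  generalize (n + 1) ^ (d + 3) = N at *
  have h9 : (22 * d + 102) * N = (20 * d + 43) * N + N * (2 * (d + 2) + 10) + 45 * N := by ring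
  omega

theorem isBigO_of_le {T : ℕ → ℕ} {K k : ℕ} (h : ∀ n, T n ≤ K * (n + 1) ^ k) :
    (fun n : ℕ => (T n : ℝ)) =O[Filter.atTop] fun n : ℕ => (n : ℝ) ^ k := by
  refine Asymptotics.IsBigO.of_bound (K * 2 ^ k) ?_
  filter_upwards [Filter.eventually_ge_atTop 1] with n hn
  have h1 : T n ≤ K * 2 ^ k * n ^ k := by
    refine (h n).trans ?_
    rw [mul_assoc, ← mul_pow]
    exact Nat.mul_le_mul_left _ (Nat.pow_le_pow_left (by omega) _)
  rw [Real.norm_of_nonneg (by positivity), Real.norm_of_nonneg (by positivity)]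
  exact_mod_cast h1

/-! ### The decision program -/

/-- The decision program for forms of degree `d + 2`. Forms in no variables are accepted without
computation; register `3` is still zero when this is tested. -/
def lorentzianProg (d : ℕ) : Program :=
  .cond (.natEq 0 3) (straight [.natConst 0 1]) <|
  .seq (setupProg d) <|
  .seq (straight [.natConst 11 0, .realConst (20 + (d + 2)) 1]) <|
  .seq (nestProg (d + 2) (d + 2)) <|
  .seq fillProg <|
  .seq checkProg <|
  straight [.natSub 0 2 19]

open CLC in
theorem runs_lorentzianProg {n d : ℕ} {f : MvPolynomial (Fin n) ℝ}
    (hf : IsNonnegForm (d + 2) f) :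
    Runs (lorentzianProg d) (input (d + 2) n f) (lorentzianTime n d) fun s' =>
      (IsCompletelyLogConcave f → s'.natReg 0 = 1) ∧
      (¬ IsCompletelyLogConcave f → s'.natReg 0 = 0) := by
  rw [isCompletelyLogConcave_iff_hasLorentzianContractions hf]
  have h0 : (input (d + 2) n f).natReg 0 = n := by simp [input]
  have h3 : (input (d + 2) n f).natReg 3 = 0 := by simp [input]
  refine Runs.cond (fun hc => ?_) fun hc => ?_
  · obtain rfl : n = 0 := by simpa [Test.Holds, h0, h3] using hc
    have h : HasLorentzianContractions (d + 2) f := fun L _ =>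
      ⟨0, fun u _ => by rw [Subsingleton.elim u 0]; simp⟩
    refine (Runs.straight (l := [.natConst 0 1]) ⟨fun _ => ?_, fun h' => absurd h h'⟩).mono
      (by simp only [List.length_cons, List.length_nil]; omega) fun _ h _ => h
    simp [runList, Instr.run]
  have hn : n ≠ 0 := by simpa [Test.Holds, h0, h3] using hc
  have : NeZero n := ⟨hn⟩
  refine Runs.seq (runs_setupProg h0 h3) fun s₁ ⟨c₁, m₁⟩ _ => ?_
  refine Runs.seq (Runs.straight rfl) fun s₂ hs₂ hF₂ => ?_
  have c₂ := c₁.of_frame hF₂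
  have m₂ : s₂.realMem = s₁.realMem := hF₂.mem
  have hw₂ : s₂.realReg (20 + (d + 2)) = digitWeight n (d + 2 - (d + 2)) 0 := by
    subst hs₂
    rw [Nat.sub_self, digitWeight]
    simp [runList, Instr.run]
  have h11₂ : s₂.natReg 11 = 0 * n ^ (d + 2) := by
    subst hs₂
    simp [runList, Instr.run]
  refine Runs.seq (runs_nestProg le_rfl c₂.r1 c₂.r2 h11₂ (fun m hm => by omega) hw₂)
    fun s₃ hs₃ hF₃ => ?_
  have c₃ : Params n d s₃ := c₂.of_frame hF₃ (all_nestProg _ _ _ rfl rfl rfl rfl rfl rfl rfl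
    fun l _ => by simp only [Instr.keepsNat, Bool.and_eq_true, bne_iff_ne, and_true]; omega)
  have m₃ : ∀ k < n ^ (d + 2), s₃.realMem k = contraction (d + 2) f (wordOf n (d + 2) k) :=
    fun k hk => by
      have h := contraction_eq_coeff f (wordOf n (d + 2) k)
      rw [length_wordOf] at h
      rw [hs₃.2 k, if_pos ⟨by omega, by omega⟩, m₂, m₁, input_realMem _ _ hk, digitWeight_eq, h]
  refine Runs.seq (runs_fillProg c₃) fun s₄ ⟨hlo, hsum⟩ hF₄ => ?_
  have c₄ := c₃.of_frame hF₄
  obtain ⟨hsymm, hiff⟩ := hasLorentzianContractions_iff_blocks hf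
    (fun k hk => (hlo k hk).trans (m₃ k hk)) hsum
  have hrow : ∀ b < horner n 1 d, ∀ i : Fin n, s₄.realMem (n ^ (d + 2) + n * b + i) =
      ∑ j, blockMatrix n s₄.realMem b i j := fun b hb i => by
    have h1 : n * b + n ≤ n * horner n 1 d := by
      rw [← Nat.mul_succ]; exact Nat.mul_le_mul_left n hb
    have h2 : n * b + i < horner n 1 (d + 1) := by
      have := i.2
      rw [horner]; omega
    rw [add_assoc, hsum _ h2, Finset.sum_range]
    refine Finset.sum_congr rfl fun j _ => ?_
    rw [blockMatrix, Matrix.of_apply]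
    congr 1
    ring
  refine Runs.seq (runs_checkProg c₄ (blockMatrix n s₄.realMem) hsymm (fun b _ i j => rfl) hrow
    fun b hb => ?_) fun s₅ ⟨hle, hflag⟩ hF₅ => Runs.straight ?_
  · rw [add_assoc, hsum _ (by rw [horner_one_succ]; omega), Finset.sum_range]
    refine Finset.sum_congr rfl fun i _ => ?_
    rw [← hrow b hb i]
    congr 1
    ring
  · have e : (runList [.natSub 0 2 19] s₅).natReg 0 = 1 - s₅.natReg 19 := by
      simp [runList, Instr.run, (c₄.of_frame hF₅).r2]
    rw [e]
    rw [← hiff] at hflag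
    constructor
    · intro h
      rw [hflag.2 h]
    · intro h
      have : s₅.natReg 19 ≠ 0 := fun h' => h (hflag.1 h')
      omega

end RealRAM

open CLC in
/-- Forms of degree at most one are always completely log-concave. -/
theorem CLC.IsNonnegForm.isCompletelyLogConcave_of_le_one {n d : ℕ} {f : MvPolynomial (Fin n) ℝ}
    (hf : IsNonnegForm d f) (hd : d ≤ 1) : IsCompletelyLogConcave f := by
  rw [isCompletelyLogConcave_iff_isLorentzian hf]
  interval_cases d <;> trivial

theorem mainTheorem3 (d : ℕ) :
    (∃ (p : RealRAM.Program) (T : ℕ → ℕ),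
      ((fun n : ℕ => (T n : ℝ)) =O[Filter.atTop] fun n : ℕ => (n : ℝ) ^ (d + 1)) ∧
      ∀ (n : ℕ) (f : MvPolynomial (Fin n) ℝ), f.IsHomogeneous d → (∀ m, 0 ≤ f.coeff m) →
        RealRAM.DecidesWithin p (RealRAM.input d n f) (T n) (CLC.IsCompletelyLogConcave f)) ∧
    (∀ (n : ℕ) (f : MvPolynomial (Fin n) ℝ), f.IsHomogeneous d → (∀ m, 0 ≤ f.coeff m) →
      (CLC.IsCompletelyLogConcave f ↔
        (∀ α : Fin n → ℕ, ∑ i, α i + 2 ≤ d → CLC.IsIndecomposable (CLC.partialDeriv α f)) ∧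
        (∀ α : Fin n → ℕ, ∑ i, α i + 2 = d → CLC.partialDeriv α f ≠ 0 →
          ∀ z : Fin n → ℝ, CLC.numPosEigenvalues (CLC.hessian (CLC.partialDeriv α f) z) = 1))) := by
  refine ⟨?_, fun n f hom nonneg => (CLC.isCompletelyLogConcave_iff_isLorentzian
    ⟨hom, nonneg⟩).trans (CLC.isLorentzian_iff_partialDeriv ⟨hom, nonneg⟩)⟩
  obtain hd | ⟨e, rfl⟩ : d ≤ 1 ∨ ∃ e, d = e + 2 := by
    by_cases h : d ≤ 1
    · exact Or.inl h
    · exact Or.inr ⟨d - 2, by omega⟩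
  · refine ⟨.instr (.natConst 0 1), fun _ => 1, RealRAM.isBigO_of_le (K := 1) fun n => ?_,
      fun n f hom nonneg => ⟨_, 1, .instr trivial, le_rfl, fun _ => ?_, fun h => absurd
        (CLC.IsNonnegForm.isCompletelyLogConcave_of_le_one ⟨hom, nonneg⟩ hd) h⟩⟩
    · rw [one_mul]
      exact Nat.one_le_pow _ _ n.succ_pos
    · simp [RealRAM.Instr.run]
  · exact ⟨RealRAM.lorentzianProg e, fun n => RealRAM.lorentzianTime n e,
      RealRAM.isBigO_of_le fun n => RealRAM.lorentzianTime_le n e,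
      fun n f hom nonneg => RealRAM.runs_lorentzianProg ⟨hom, nonneg⟩⟩
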